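/- **Setting.** Let $\mathcal X$ be a standard Borel space and $\mathcal H_K$ a separable real reproducing kernel Hilbert space of measurable functions on $\mathcal X$ with kernel $K$, $K_x=K(x,\cdot)$, and $\|f\|_\infty\le\kappa\|f\|_{\mathcal H_K}$ for all $f\in\mathcal H_K$, where $\kappa>0$. For a probability measure $\nu$ on $\mathcal X$ put $\bar T=\bar T_\nu=\kappa^{-2}\int \langle\cdot,K_x\rangle K_x\,\nu(dx)$, and for a sample $\mathbf x=(x_1,\dots,x_N)$, $\mathbf y=(y_1,\dots,y_N)$ put $\bar T_{\mathbf x}=\kappa^{-2}\frac1N\sum_i\langle\cdot,K_{x_i}\rangle K_{x_i}$ and $\bar S^*_{\mathbf x}\mathbf y=\kappa^{-2}\frac1N\sum_i y_iK_{x_i}$. **Models.** Fix $r>0$, $b>1$, $\beta>0$. For $\sigma,M,R>0$ let $\mathcal M_{\sigma,M,R}$ be the set of distributions $\rho(dx,dy)=\rho(dy|x)\nu(dx)$ on $\mathcal X\times\mathbb R$ such that the positive eigenvalues $\mu_1\ge\mu_2\ge\dots$ of $\bar T_\nu$, counted with multiplicity, satisfy $\mu_j\le\beta j^{-b}$ for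 all $j$, and such that for some $f_\rho\in\{\bar T_\nu^rh:\|h\|_{\mathcal H_K}\le R\}$, for $\nu$-almost all $x$, $$\mathbb E_\rho[Y|X=x]=f_\rho(x),\qquad \mathbb E_\rho\big[|Y-f_\rho(X)|^l\,\big|\,X=x\big]\le\tfrac12\,l!\,\sigma^2M^{l-2}\quad\text{for all integers } l\ge2 .$$ Let $\mathcal M'_{\sigma,R}\supseteq\mathcal M_{\sigma,M,R}$ be defined in the same way, but with the last condition required for $l=2$ only, i.e. $\mathbb E_\rho[|Y-f_\rho(X)|^2|X=x]\le\sigma^2$. **Regularization.** Let $g:(0,1]\times[0,1]\to\mathbb R$, $g_\lambda=g(\lambda,\cdot)$ Borel measurable, and $D',E,\gamma_0<\infty$ be such that $|tg_\lambda(t)|\le D'$, $|g_\lambda(t)|\le E/\lambda$ and $|1-tg_\lambda(t)|\le\gamma_0$ for all $\lambda,t\in(0,1]$. Let $s\in[0,\frac12]$, and assume that for some $q\ge r+s$ and $\gamma_q>0$ one has $|1-tg_\lambda(t)|\,t^q\le\gamma_q\lambda^q$ for all $\lambda,t\in(0,1]$. **Estimators.** Partition an i.i.d. sample $D=((x_i,y_i))_{i\le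 n}$ into $m$ blocks $(\mathbf x_j,\mathbf y_j)$ of equal size $n/m$ (in particular $m$ divides $n$), and put $$\bar f^\lambda_D=\frac1m\sum_{j=1}^m g_\lambda(\bar T_{\mathbf x_j})\bar S^*_{\mathbf x_j}\mathbf y_j,\quad \tilde f^\lambda_D=\frac1m\sum_{j=1}^m g_\lambda(\bar T_{\mathbf x_j})\bar T_{\mathbf x_j}f_\rho,$$ $$\lambda_n=\min\Big\{\Big(\frac{\sigma^2}{R^2n}\Big)^{\frac{b}{2br+b+1}},1\Big\},\qquad a_n=R\Big(\frac{\sigma^2}{R^2n}\Big)^{\frac{b(r+s)}{2br+b+1}} .$$ **Theorem.** Let $1\le p<\infty$. There is a constant $C<\infty$, which depends neither on $\sigma,M,R$ nor on $\alpha$ nor on the partitions, such that for every $\alpha<\frac{2br}{2br+b+1}$ and every choice, for each $n$, of a partition into $m=m_n$ blocks with $m_n\le n^\alpha$ (it suffices that these requirements on the partition hold for all large $n$), $$\sup_{\sigma,M,R>0}\ \limsup_{n\to\infty}\ \sup_{\rho\in\mathcal M_{\sigma,M,R}}\frac{\mathbb E_{\rho^{\otimes n}}\big[\|\bar T^s(\tilde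 f_D^{\lambda_n}-\bar f_D^{\lambda_n})\|^p_{\mathcal H_K}\big]^{1/p}}{a_n}\le C .$$ If $p\le2$, the same holds (with a possibly different $C$) with $\mathcal M'_{\sigma,R}$ in place of $\mathcal M_{\sigma,M,R}$. -/

import Mathlib

open MeasureTheory ProbabilityTheory Filter Set
open scoped ENNReal NNReal InnerProductSpace Topology

namespace DistLearn

noncomputable section

/-! ### Functional calculus and eigenvalues of compact self-adjoint operators -/

/-- The eigenspace `ker (A - t)`, a closed subspace. -/
def eigsp {H : Type*} [NormedAddCommGroup H] [InnerProductSpace ℝ H]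
    (A : H →L[ℝ] H) (t : ℝ) : Submodule ℝ H :=
  Module.End.eigenspace (A : H →ₗ[ℝ] H) t

instance eigsp_completeSpace {H : Type*} [NormedAddCommGroup H] [InnerProductSpace ℝ H]
    [CompleteSpace H] (A : H →L[ℝ] H) (t : ℝ) : CompleteSpace (eigsp A t) := by
  have h : IsClosed ((eigsp A t : Submodule ℝ H) : Set H) := by
    have : ((eigsp A t : Submodule ℝ H) : Set H) = {f | A f = t • f} := by
      ext f
      simp [eigsp]
    rw [this]
    exact isClosed_eq A.continuous (continuous_const_smul t)
  exact h.completeSpace_coe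

/-- `φ(A) f = ∑ₜ φ(t) Pₜ f`, the sum over the eigenvalues `t` of `A` (including `0`), with `Pₜ` the
orthogonal projection onto `ker (A - t)` (which is `0` if `t` is not an eigenvalue). For a compact
self-adjoint `A` and a function `φ` that is bounded on the eigenvalues of `A`, this is the
functional calculus given by the spectral theorem. -/
def opFun {H : Type*} [NormedAddCommGroup H] [InnerProductSpace ℝ H] [CompleteSpace H]
    (φ : ℝ → ℝ) (A : H →L[ℝ] H) (f : H) : H :=
  ∑' t : ℝ, φ t • (eigsp A t).starProjection f

/-- The power `A ^ u` of a positive compact operator, with `A ^ 0 = 1`. -/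
def opPow {H : Type*} [NormedAddCommGroup H] [InnerProductSpace ℝ H] [CompleteSpace H]
    (A : H →L[ℝ] H) (u : ℝ) (f : H) : H :=
  opFun (fun t => t ^ u) A f

/-- `μ 0 ≥ μ 1 ≥ …` is the sequence of positive eigenvalues of the positive compact operator `A`,
repeated according to multiplicity, and continued by `0` if there are only finitely many:
`A = ∑ⱼ μⱼ ⟨eⱼ, ·⟩ eⱼ`, where those `eⱼ` with `μⱼ > 0` are orthonormal. -/
def IsEigenvalueSeq {H : Type*} [NormedAddCommGroup H] [InnerProductSpace ℝ H]
    (A : H →L[ℝ] H) (μ : ℕ → ℝ) : Prop :=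
  Antitone μ ∧ (∀ j, 0 ≤ μ j) ∧
    ∃ e : ℕ → H, Orthonormal ℝ (fun j : {j : ℕ // 0 < μ j} => e j) ∧
      ∀ f : H, HasSum (fun j => (μ j * ⟪e j, f⟫_ℝ) • e j) (A f)

/-! ### Kernel operators -/

/-- The kernel section `K_x = K(x, ·)`. -/
def kerSec {X : Type*} (H : Type*) [NormedAddCommGroup H] [InnerProductSpace ℝ H]
    [CompleteSpace H] [RKHS ℝ H X ℝ] (x : X) : H :=
  RKHS.kerFun H x (1 : ℝ)

/-- The normalised covariance operator `T̄ = κ⁻² ∫ K_x ⊗ K_x ν(dx)`. -/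
def covOp {X : Type*} [MeasurableSpace X] (H : Type*) [NormedAddCommGroup H]
    [InnerProductSpace ℝ H] [CompleteSpace H] [RKHS ℝ H X ℝ] (κ : ℝ) (ν : Measure X) :
    H →L[ℝ] H :=
  (κ ^ 2)⁻¹ • ∫ x, InnerProductSpace.rankOne ℝ (kerSec H x) (kerSec H x) ∂ν

/-- The normalised empirical covariance operator `T̄_x = κ⁻² |I|⁻¹ ∑_{i ∈ I} K_{x_i} ⊗ K_{x_i}` of
the subsample with index set `I`. -/
def empCov {X : Type*} (H : Type*) [NormedAddCommGroup H] [InnerProductSpace ℝ H]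
    [CompleteSpace H] [RKHS ℝ H X ℝ] (κ : ℝ) {n : ℕ} (I : Finset (Fin n)) (z : Fin n → X × ℝ) :
    H →L[ℝ] H :=
  (κ ^ 2)⁻¹ • (I.card : ℝ)⁻¹ •
    ∑ i ∈ I, InnerProductSpace.rankOne ℝ (kerSec H (z i).1) (kerSec H (z i).1)

/-- The vector `κ⁻² S_x^* y = κ⁻² |I|⁻¹ ∑_{i ∈ I} y_i K_{x_i}` of the subsample with index set
`I`. -/
def empAdj {X : Type*} (H : Type*) [NormedAddCommGroup H] [InnerProductSpace ℝ H]
    [CompleteSpace H] [RKHS ℝ H X ℝ] (κ : ℝ) {n : ℕ} (I : Finset (Fin n)) (z : Fin n → X × ℝ) :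
    H :=
  (κ ^ 2)⁻¹ • (I.card : ℝ)⁻¹ • ∑ i ∈ I, (z i).2 • kerSec H (z i).1

/-! ### The class of models -/

/-- `ν ∈ P^<(b, β)`: the eigenvalues of `T̄_ν` satisfy `μ_j ≤ β / j ^ b` for `j = 1, 2, …`. -/
def EigenDecay {X : Type*} [MeasurableSpace X] (H : Type*) [NormedAddCommGroup H]
    [InnerProductSpace ℝ H] [CompleteSpace H] [RKHS ℝ H X ℝ] (κ b β : ℝ) (ν : Measure X) : Prop :=
  ∃ μ : ℕ → ℝ, IsEigenvalueSeq (covOp H κ ν) μ ∧ ∀ j, μ j ≤ β / ((j : ℝ) + 1) ^ b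

/-- The source set `Ω_ν(r, R) = {T̄_ν ^ r h : ‖h‖ ≤ R}`. -/
def sourceSet {X : Type*} [MeasurableSpace X] (H : Type*) [NormedAddCommGroup H]
    [InnerProductSpace ℝ H] [CompleteSpace H] [RKHS ℝ H X ℝ] (κ r R : ℝ) (ν : Measure X) : Set H :=
  {f | ∃ h : H, ‖h‖ ≤ R ∧ f = opPow (covOp H κ ν) r h}

/-- The distribution `ρ(dx, dy) = η(dy | x) ν(dx)` belongs to the model with second-moment noise
bound `σ ^ 2`, and `f` is its regression function. -/
structure IsModel {X : Type*} [MeasurableSpace X] {H : Type*} [NormedAddCommGroup H]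
    [InnerProductSpace ℝ H] [CompleteSpace H] [RKHS ℝ H X ℝ] (κ b β r σ R : ℝ)
    (ν : Measure X) (η : Kernel X ℝ) (f : H) : Prop where
  prob : IsProbabilityMeasure ν
  markov : IsMarkovKernel η
  decay : EigenDecay H κ b β ν
  source : f ∈ sourceSet H κ r R ν
  integrable : ∀ᵐ x ∂ν, Integrable (fun y => y) (η x)
  mean : ∀ᵐ x ∂ν, ∫ y, y ∂(η x) = f x
  variance : ∀ᵐ x ∂ν, ∫⁻ y, ‖y - f x‖ₑ ^ 2 ∂(η x) ≤ ENNReal.ofReal (σ ^ 2)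

/-- The distribution `ρ(dx, dy) = η(dy | x) ν(dx)` belongs to the model with Bernstein noise of
parameters `σ`, `M`, and `f` is its regression function. -/
structure IsBernsteinModel {X : Type*} [MeasurableSpace X] {H : Type*} [NormedAddCommGroup H]
    [InnerProductSpace ℝ H] [CompleteSpace H] [RKHS ℝ H X ℝ] (κ b β r σ M R : ℝ)
    (ν : Measure X) (η : Kernel X ℝ) (f : H) : Prop extends IsModel κ b β r σ R ν η f where
  bernstein : ∀ᵐ x ∂ν, ∀ l : ℕ, 2 ≤ l → ∫⁻ y, ‖y - f x‖ₑ ^ l ∂(η x) ≤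
    ENNReal.ofReal (1 / 2 * (l.factorial : ℝ) * σ ^ 2 * M ^ (l - 2))

/-! ### Regularization and distributed estimators -/

/-- Regularization function; only the values `g λ t` with `0 < λ ≤ 1` and `0 ≤ t ≤ 1` matter. -/
structure IsRegularization (g : ℝ → ℝ → ℝ) : Prop where
  measurable : ∀ l, 0 < l → l ≤ 1 → Measurable (g l)
  bound_mul : ∃ D : ℝ, ∀ l, 0 < l → l ≤ 1 → ∀ t, 0 < t → t ≤ 1 → |t * g l t| ≤ D
  bound : ∃ E : ℝ, ∀ l, 0 < l → l ≤ 1 → ∀ t, 0 < t → t ≤ 1 → |g l t| ≤ E / l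
  bound_res : ∃ γ : ℝ, ∀ l, 0 < l → l ≤ 1 → ∀ t, 0 < t → t ≤ 1 → |1 - g l t * t| ≤ γ

/-- The residual satisfies the qualification inequality with exponent `q`. (Maximality of `q` is
not asked for, so that methods of arbitrary qualification are included.) -/
def HasQualification (g : ℝ → ℝ → ℝ) (q : ℝ) : Prop :=
  ∃ γ : ℝ, 0 < γ ∧ ∀ l, 0 < l → l ≤ 1 → ∀ t, 0 < t → t ≤ 1 →
    |1 - g l t * t| * t ^ q ≤ γ * l ^ q

/-- The `j`-th block of the partition of the sample given by the block labels `part`. -/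
def block {n m : ℕ} (part : Fin n → Fin m) (j : Fin m) : Finset (Fin n) :=
  Finset.univ.filter (fun i => part i = j)

/-- The averaged estimator `f̄_D = m⁻¹ ∑ⱼ g_λ(T̄_{x_j}) κ⁻² S_{x_j}^* y_j`; here `φ = g_λ`. -/
def avgEst {X : Type*} (H : Type*) [NormedAddCommGroup H] [InnerProductSpace ℝ H]
    [CompleteSpace H] [RKHS ℝ H X ℝ] (κ : ℝ) (φ : ℝ → ℝ) {n m : ℕ} (part : Fin n → Fin m)
    (z : Fin n → X × ℝ) : H :=
  (m : ℝ)⁻¹ • ∑ j, opFun φ (empCov H κ (block part j) z) (empAdj H κ (block part j) z)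

/-- Its noise-free version `f̃_D = m⁻¹ ∑ⱼ g_λ(T̄_{x_j}) T̄_{x_j} f`; here `φ = g_λ`. -/
def avgNoiseless {X : Type*} {H : Type*} [NormedAddCommGroup H] [InnerProductSpace ℝ H]
    [CompleteSpace H] [RKHS ℝ H X ℝ] (κ : ℝ) (φ : ℝ → ℝ) {n m : ℕ} (part : Fin n → Fin m)
    (f : H) (z : Fin n → X × ℝ) : H :=
  (m : ℝ)⁻¹ • ∑ j, opFun φ (empCov H κ (block part j) z) (empCov H κ (block part j) z f)

/-- `λ_n = min ((σ² / (R² n)) ^ (b / (2br + b + 1))) 1`. -/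
def regParam (b r σ R : ℝ) (n : ℕ) : ℝ :=
  min ((σ ^ 2 / (R ^ 2 * n)) ^ (b / (2 * b * r + b + 1))) 1

/-- `a_n = R (σ² / (R² n)) ^ (b (r + s) / (2br + b + 1))`. -/
def rate (b r s σ R : ℝ) (n : ℕ) : ℝ :=
  R * (σ ^ 2 / (R ^ 2 * n)) ^ (b * (r + s) / (2 * b * r + b + 1))

/-- `E_{ρ^{⊗ n}} [‖T̄ ^ s (f̃_D^{λ_n} - f̄_D^{λ_n})‖ ^ p] ^ (1 / p) / a_n`, for
`ρ(dx, dy) = η(dy | x) ν(dx)`. -/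
def normalizedRisk {X : Type*} [MeasurableSpace X] {H : Type*} [NormedAddCommGroup H]
    [InnerProductSpace ℝ H] [CompleteSpace H] [RKHS ℝ H X ℝ] (κ : ℝ) (g : ℝ → ℝ → ℝ)
    (b r s p σ R : ℝ) {n m : ℕ} (part : Fin n → Fin m)
    (ν : Measure X) (η : Kernel X ℝ) (f : H) : ℝ≥0∞ :=
  (∫⁻ z : Fin n → X × ℝ,
      ‖opPow (covOp H κ ν) s
        (avgNoiseless κ (g (regParam b r σ R n)) part f z
          - avgEst H κ (g (regParam b r σ R n)) part z)‖ₑ ^ p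
      ∂(Measure.pi fun _ : Fin n => ν ⊗ₘ η)) ^ (1 / p)
    / ENNReal.ofReal (rate b r s σ R n)

/-- For all large `n`, the sample of size `n` is partitioned into `m n` blocks of equal size, and
`m n ≤ n ^ α`. -/
def IsAdmissible (α : ℝ) (m : ℕ → ℕ) (part : ∀ n, Fin n → Fin (m n)) : Prop :=
  ∀ᶠ n : ℕ in atTop, (m n : ℝ) ≤ (n : ℝ) ^ α ∧ ∀ j, m n * (block (part n) j).card = n

end

end DistLearn

/-! Write `N = n / m` for the block size, `λ` for the regularisation parameter and `k_i` for the
normalised kernel section at `x_i`. The difference of the two estimators is pure noise: given the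
inputs it equals `-(κ m N)⁻¹ ∑ ε_i w_i`, where the `ε_i` are independent and centred, and `w_i` is
the filter `g_λ` of the covariance of the block of `i`, applied to `k_i`. The blocks thus contribute
independent terms, and averaging reduces the variance to order `1 / n`.

By interpolation (`norm_sq_opPow_le`) the norm `‖T̄ ^ s u‖ ^ 2` is at most `λ ^ (2 s - 1)` times the
quadratic form of `T̄ + λ`. For that form, the Rosenthal-type inequality `integral_quad_pow_le`
bounds the conditional `K`-th moment by the `K`-th power of a variance term plus `M ^ 2` times a
bound on single summands.

Since `|g_λ(t)| (t + λ)` is bounded, `filtered_bounds` and `exists_filtered_block` control both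
terms by the empirical effective dimension of the block and the mixed quantity `N ∫ ⟪k_x, (∑ k_i ⊗
k_i + N λ)⁻¹ k_x⟫ ν(dx)`. The latter couples population and sample, but no concentration of
operators is needed: its moments involve fresh points, which may be added to the sample at the cost
of a bounded factor. By exchangeability they can then be replaced by sample points, and only the
empirical effective dimension remains (`lintegral_resQ_pow_le`). Cutting the spectrum after about `λ
^ (-1 / b)` eigenvalues bounds that by a rank plus a sum of i.i.d. bounded variables, both of order
`λ ^ (-1 / b)`.

Altogether the squared error has size `σ ^ 2 / n * λ ^ (2 s - 1 - 1 / b)`, which equals `a_n ^ 2`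
for `λ = λ_n` (`rate_sq`). The bound on `α` gives `N λ_n → ∞`, so that for large `n` the term with
`M` is dominated by the variance. Hence the constant depends neither on `M` nor on `α`. -/

namespace DistLearn

/-! ### Regularised inverses of finite sums of rank-one operators, and leverage scores. -/

section Resolvent

variable {H : Type*} [NormedAddCommGroup H] [InnerProductSpace ℝ H]

/-- The quadratic form `⟪x, (∑ i, k i ⊗ k i + Λ)⁻¹ x⟫` of the regularised inverse, written as a
supremum. -/
noncomputable def resQ {ι : Type*} [Fintype ι] (Λ : ℝ) (k : ι → H) (x : H) : ℝ≥0∞ :=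
  ⨆ v : H, ENNReal.ofReal (2 * ⟪x, v⟫_ℝ - ∑ i, ⟪k i, v⟫_ℝ ^ 2 - Λ * ‖v‖ ^ 2)

/-- A finite family of vectors has a singular value decomposition. -/
lemma exists_singular_basis {ι : Type*} [Fintype ι] (k : ι → H) :
    ∃ (d : ℕ) (e : Fin d → H) (τ : Fin d → ℝ), Orthonormal ℝ e ∧ (∀ a, 0 < τ a) ∧
      (∀ i, k i = ∑ a, ⟪e a, k i⟫_ℝ • e a) ∧ ∀ a, ∑ i, ⟪k i, e a⟫_ℝ • k i = τ a • e a := by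
  let U : Submodule ℝ H := Submodule.span ℝ (range k)
  have : FiniteDimensional ℝ U := FiniteDimensional.span_of_finite ℝ (finite_range k)
  let kU : ι → U := fun i => ⟨k i, Submodule.subset_span ⟨i, rfl⟩⟩
  let T : U →ₗ[ℝ] U := ∑ i, ((InnerProductSpace.rankOne ℝ (kU i) (kU i) : U →L[ℝ] U) : U →ₗ[ℝ] U)
  have hTv : ∀ v, T v = ∑ i, ⟪kU i, v⟫_ℝ • kU i := fun v => by
    simp [T, LinearMap.sum_apply, InnerProductSpace.rankOne_apply]
  have hT : T.IsSymmetric := by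
    intro u v
    simp only [hTv, sum_inner, inner_sum, real_inner_smul_left, real_inner_smul_right]
    refine Finset.sum_congr rfl fun i _ => ?_
    rw [real_inner_comm u (kU i)]
    ring
  let b := hT.eigenvectorBasis rfl
  have hb : ∀ a, T (b a) = hT.eigenvalues rfl a • b a := fun a => by
    exact hT.apply_eigenvectorBasis rfl a
  have hexp : ∀ i, kU i = ∑ a, ⟪b a, kU i⟫_ℝ • b a := fun i => (b.sum_repr' (kU i)).symm
  have hτ : ∀ a, hT.eigenvalues rfl a = ∑ i, ⟪kU i, b a⟫_ℝ ^ 2 := fun a => by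
    have h1 : ⟪T (b a), b a⟫_ℝ = hT.eigenvalues rfl a := by
      rw [hb, real_inner_smul_left, real_inner_self_eq_norm_sq, b.orthonormal.1 a]; simp
    rw [← h1, hTv, sum_inner]
    refine Finset.sum_congr rfl fun i _ => ?_
    rw [real_inner_smul_left]; ring
  refine ⟨_, fun a => (b a : H), hT.eigenvalues rfl, ?_, ?_, ?_, ?_⟩
  · exact b.orthonormal.comp_linearIsometry U.subtypeₗᵢ
  · intro a
    -- An eigenvector for the eigenvalue `0` would be orthogonal to all `k i`, hence to their span
    -- `U`, which contains it.
    refine lt_of_le_of_ne (by rw [hτ]; positivity) fun h => ?_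
    rw [hτ] at h
    have h2 : ∀ i, ⟪kU i, b a⟫_ℝ = 0 := fun i => by
      have := (Finset.sum_eq_zero_iff_of_nonneg (fun i _ => sq_nonneg ⟪kU i, b a⟫_ℝ)).1 h.symm i
        (Finset.mem_univ i)
      simpa using this
    have h3 : ∀ u ∈ U, ⟪u, (b a : H)⟫_ℝ = 0 := by
      intro u hu
      induction hu using Submodule.span_induction with
      | mem x hx => obtain ⟨i, rfl⟩ := hx; exact h2 i
      | zero => simp
      | add x y _ _ hx hy => rw [inner_add_left, hx, hy, add_zero]
      | smul c x _ hx => rw [real_inner_smul_left, hx, mul_zero]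
    have h4 := h3 (b a) (b a).2
    rw [real_inner_self_eq_norm_sq] at h4
    have h5 : ‖(b a : H)‖ = 1 := b.orthonormal.1 a
    rw [h5] at h4; norm_num at h4
  · intro i
    have := congrArg (fun u : U => (u : H)) (hexp i)
    simpa using this
  · intro a
    have := congrArg (fun u : U => (u : H)) ((hTv (b a)).symm.trans (hb a))
    simpa [kU] using this

variable {ι : Type*} [Fintype ι] {k : ι → H} {d : ℕ} {e : Fin d → H} {τ : Fin d → ℝ}

lemma inner_sum_orthonormal (he : Orthonormal ℝ e) (c : Fin d → ℝ) (a : Fin d) :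
    ⟪e a, ∑ b, c b • e b⟫_ℝ = c a := by
  rw [he.inner_right_fintype]

lemma norm_sq_sum_orthonormal (he : Orthonormal ℝ e) (c : Fin d → ℝ) :
    ‖∑ b, c b • e b‖ ^ 2 = ∑ b, c b ^ 2 := by
  rw [← real_inner_self_eq_norm_sq, sum_inner]
  refine Finset.sum_congr rfl fun a _ => ?_
  rw [real_inner_smul_left, inner_sum_orthonormal he]; ring

lemma bessel_fin (he : Orthonormal ℝ e) (x : H) : ∑ a, ⟪e a, x⟫_ℝ ^ 2 ≤ ‖x‖ ^ 2 := by
  have := he.sum_inner_products_le x (s := Finset.univ)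
  simpa using this

/-- In the singular basis, `∑ i, ⟪k i, v⟫ ^ 2` is diagonal. -/
lemma sum_inner_sq_eq (hk : ∀ i, k i = ∑ a, ⟪e a, k i⟫_ℝ • e a)
    (hτ : ∀ a, ∑ i, ⟪k i, e a⟫_ℝ • k i = τ a • e a) (v : H) :
    ∑ i, ⟪k i, v⟫_ℝ ^ 2 = ∑ a, τ a * ⟪e a, v⟫_ℝ ^ 2 := by
  have h1 : ∀ i, ⟪k i, v⟫_ℝ = ∑ a, ⟪k i, e a⟫_ℝ * ⟪e a, v⟫_ℝ := fun i => by
    conv_lhs => rw [hk i]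
    rw [sum_inner]
    refine Finset.sum_congr rfl fun a _ => ?_
    rw [real_inner_smul_left, real_inner_comm]
  calc ∑ i, ⟪k i, v⟫_ℝ ^ 2 = ∑ i, ∑ a, ⟪k i, e a⟫_ℝ * ⟪e a, v⟫_ℝ * ⟪k i, v⟫_ℝ := by
        refine Finset.sum_congr rfl fun i _ => ?_
        rw [sq, ← Finset.sum_mul, ← h1]
    _ = ∑ a, ⟪e a, v⟫_ℝ * ⟪∑ i, ⟪k i, e a⟫_ℝ • k i, v⟫_ℝ := by
        rw [Finset.sum_comm]
        refine Finset.sum_congr rfl fun a _ => ?_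
        rw [sum_inner, Finset.mul_sum]
        refine Finset.sum_congr rfl fun i _ => ?_
        rw [real_inner_smul_left]; ring
    _ = _ := by
        refine Finset.sum_congr rfl fun a _ => ?_
        rw [hτ, real_inner_smul_left]; ring

lemma sum_inner_mul_inner_eq (he : Orthonormal ℝ e)
    (hτ : ∀ a, ∑ i, ⟪k i, e a⟫_ℝ • k i = τ a • e a) (a b : Fin d) :
    ∑ i, ⟪k i, e a⟫_ℝ * ⟪k i, e b⟫_ℝ = if a = b then τ a else 0 := by
  have : ∑ i, ⟪k i, e a⟫_ℝ * ⟪k i, e b⟫_ℝ = ⟪∑ i, ⟪k i, e a⟫_ℝ • k i, e b⟫_ℝ := by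
    rw [sum_inner]
    exact Finset.sum_congr rfl fun i _ => (real_inner_smul_left _ _ _).symm
  rw [this, hτ, real_inner_smul_left, orthonormal_iff_ite.1 he]
  split_ifs <;> simp

/-- The test vector is the maximiser within the span of the `e a`. Only an inequality is possible
for general `x`, whose component outside the span contributes to `resQ` as well; for `x = k i` there
is none, and `resQ_le` gives the converse. -/
lemma le_resQ (he : Orthonormal ℝ e) (hpos : ∀ a, 0 < τ a)
    (hk : ∀ i, k i = ∑ a, ⟪e a, k i⟫_ℝ • e a)
    (hτ : ∀ a, ∑ i, ⟪k i, e a⟫_ℝ • k i = τ a • e a) {Λ : ℝ} (hΛ : 0 < Λ) (x : H) :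
    ENNReal.ofReal (∑ a, ⟪e a, x⟫_ℝ ^ 2 / (τ a + Λ)) ≤ resQ Λ k x := by
  refine le_trans (ENNReal.ofReal_le_ofReal ?_)
    (le_iSup (fun v : H => ENNReal.ofReal (2 * ⟪x, v⟫_ℝ - ∑ i, ⟪k i, v⟫_ℝ ^ 2 - Λ * ‖v‖ ^ 2))
      (∑ a, (⟪e a, x⟫_ℝ / (τ a + Λ)) • e a))
  rw [sum_inner_sq_eq hk hτ, norm_sq_sum_orthonormal he, inner_sum, Finset.mul_sum, Finset.mul_sum,
    ← Finset.sum_sub_distrib, ← Finset.sum_sub_distrib]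
  refine Finset.sum_le_sum fun a _ => le_of_eq ?_
  rw [inner_sum_orthonormal he, real_inner_smul_right, real_inner_comm]
  have := (add_pos (hpos a) hΛ).ne'
  field_simp
  ring

lemma resQ_le (he : Orthonormal ℝ e) (hpos : ∀ a, 0 < τ a)
    (hk : ∀ i, k i = ∑ a, ⟪e a, k i⟫_ℝ • e a)
    (hτ : ∀ a, ∑ i, ⟪k i, e a⟫_ℝ • k i = τ a • e a) {Λ : ℝ} (hΛ : 0 < Λ) (i : ι) :
    resQ Λ k (k i) ≤ ENNReal.ofReal (∑ a, ⟪e a, k i⟫_ℝ ^ 2 / (τ a + Λ)) := by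
  refine iSup_le fun v => ENNReal.ofReal_le_ofReal ?_
  have h1 : ⟪k i, v⟫_ℝ = ∑ a, ⟪e a, k i⟫_ℝ * ⟪e a, v⟫_ℝ := by
    conv_lhs => rw [hk i]
    rw [sum_inner]
    exact Finset.sum_congr rfl fun a _ => real_inner_smul_left _ _ _
  have h2 := mul_le_mul_of_nonneg_left (bessel_fin he v) hΛ.le
  have h3 : 2 * ⟪k i, v⟫_ℝ - ∑ i, ⟪k i, v⟫_ℝ ^ 2 - Λ * ∑ a, ⟪e a, v⟫_ℝ ^ 2 ≤
      ∑ a, ⟪e a, k i⟫_ℝ ^ 2 / (τ a + Λ) := by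
    rw [sum_inner_sq_eq hk hτ, h1, Finset.mul_sum, Finset.mul_sum, ← Finset.sum_sub_distrib,
      ← Finset.sum_sub_distrib]
    refine Finset.sum_le_sum fun a _ => ?_
    rw [le_div_iff₀ (add_pos (hpos a) hΛ)]
    nlinarith [sq_nonneg (⟪e a, k i⟫_ℝ - (τ a + Λ) * ⟪e a, v⟫_ℝ)]
  linarith

/-- The sum of the leverage scores of the sample is the trace of `T (T + Λ)⁻¹` with `T = ∑ k i ⊗ k
i`, the empirical effective dimension. -/
lemma sum_resQ_le_sum_div (he : Orthonormal ℝ e) (hpos : ∀ a, 0 < τ a)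
    (hk : ∀ i, k i = ∑ a, ⟪e a, k i⟫_ℝ • e a)
    (hτ : ∀ a, ∑ i, ⟪k i, e a⟫_ℝ • k i = τ a • e a) {Λ : ℝ} (hΛ : 0 < Λ) :
    ∑ i, resQ Λ k (k i) ≤ ENNReal.ofReal (∑ a, τ a / (τ a + Λ)) := by
  refine (Finset.sum_le_sum fun i _ => resQ_le he hpos hk hτ hΛ i).trans ?_
  rw [← ENNReal.ofReal_sum_of_nonneg fun i _ => Finset.sum_nonneg fun a _ =>
    div_nonneg (sq_nonneg _) (add_pos (hpos a) hΛ).le]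
  refine ENNReal.ofReal_le_ofReal ?_
  rw [Finset.sum_comm]
  refine Finset.sum_le_sum fun a _ => ?_
  rw [← Finset.sum_div]
  have := sum_inner_mul_inner_eq he hτ a a
  simp only [if_true] at this
  rw [← this]
  refine le_of_eq ?_
  congr 1
  refine Finset.sum_congr rfl fun i _ => ?_
  rw [real_inner_comm]; ring

/-- The component of `x` orthogonal to the finite orthonormal family `f`. -/
noncomputable def orthPart {J : ℕ} (f : Fin J → H) (x : H) : H := x - ∑ j, ⟪f j, x⟫_ℝ • f j

lemma norm_sq_orthPart {J : ℕ} {f : Fin J → H} (hf : Orthonormal ℝ f) (x : H) :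
    ‖orthPart f x‖ ^ 2 = ‖x‖ ^ 2 - ∑ j, ⟪f j, x⟫_ℝ ^ 2 := by
  rw [orthPart, @norm_sub_sq ℝ, norm_sq_sum_orthonormal hf, inner_sum]
  have : ∀ j, ⟪x, ⟪f j, x⟫_ℝ • f j⟫_ℝ = ⟪f j, x⟫_ℝ ^ 2 := fun j => by
    rw [real_inner_smul_right, real_inner_comm]; ring
  simp only [this, RCLike.re_to_real]
  ring

lemma orthPart_sum {J : ℕ} (f : Fin J → H) {α : Type*} (s : Finset α) (c : α → ℝ) (x : α → H) :
    orthPart f (∑ a ∈ s, c a • x a) = ∑ a ∈ s, c a • orthPart f (x a) := by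
  simp only [orthPart, smul_sub, Finset.sum_sub_distrib, Finset.smul_sum, inner_sum,
    real_inner_smul_right, Finset.sum_smul, smul_smul]
  rw [Finset.sum_comm]

lemma sum_norm_sq_orthPart {J : ℕ} (f : Fin J → H) (he : Orthonormal ℝ e)
    (hk : ∀ i, k i = ∑ a, ⟪e a, k i⟫_ℝ • e a)
    (hτ : ∀ a, ∑ i, ⟪k i, e a⟫_ℝ • k i = τ a • e a) :
    ∑ i, ‖orthPart f (k i)‖ ^ 2 = ∑ a, τ a * ‖orthPart f (e a)‖ ^ 2 := by
  have h1 : ∀ i, ‖orthPart f (k i)‖ ^ 2 =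
      ∑ a, ∑ b, (⟪k i, e a⟫_ℝ * ⟪k i, e b⟫_ℝ) * ⟪orthPart f (e a), orthPart f (e b)⟫_ℝ := fun i => by
    conv_lhs => rw [hk i]
    rw [orthPart_sum, ← real_inner_self_eq_norm_sq, sum_inner]
    refine Finset.sum_congr rfl fun a _ => ?_
    rw [inner_sum]
    refine Finset.sum_congr rfl fun b _ => ?_
    rw [real_inner_smul_left, real_inner_smul_right, real_inner_comm (k i), real_inner_comm (k i)]
    ring
  simp only [h1]
  rw [Finset.sum_comm]
  refine Finset.sum_congr rfl fun a _ => ?_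
  rw [Finset.sum_comm]
  simp only [← Finset.sum_mul, sum_inner_mul_inner_eq he hτ, ite_mul, zero_mul]
  simp

/-- The empirical effective dimension is controlled by any spectral cut-off. -/
lemma sum_div_le {J : ℕ} {f : Fin J → H} (hf : Orthonormal ℝ f) (he : Orthonormal ℝ e)
    (hpos : ∀ a, 0 < τ a) (hk : ∀ i, k i = ∑ a, ⟪e a, k i⟫_ℝ • e a)
    (hτ : ∀ a, ∑ i, ⟪k i, e a⟫_ℝ • k i = τ a • e a) {Λ : ℝ} (hΛ : 0 < Λ) :
    ∑ a, τ a / (τ a + Λ) ≤ J + Λ⁻¹ * ∑ i, ‖orthPart f (k i)‖ ^ 2 := by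
  rw [sum_norm_sq_orthPart f he hk hτ, Finset.mul_sum]
  have h1 : ∑ a, ∑ j, ⟪f j, e a⟫_ℝ ^ 2 ≤ (J : ℝ) := by
    rw [Finset.sum_comm]
    calc _ ≤ ∑ j : Fin J, (1 : ℝ) := Finset.sum_le_sum fun j _ => by
          have := bessel_fin he (f j)
          rw [hf.1 j] at this
          simpa [real_inner_comm] using this
      _ = J := by simp
  refine le_trans ?_ (add_le_add_left h1 _)
  rw [← Finset.sum_add_distrib]
  refine Finset.sum_le_sum fun a _ => ?_
  have h2 := norm_sq_orthPart hf (e a)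
  rw [he.1 a] at h2
  have h3 : ∑ j, ⟪f j, e a⟫_ℝ ^ 2 = 1 - ‖orthPart f (e a)‖ ^ 2 := by linarith
  have h4 : 0 ≤ ∑ j, ⟪f j, e a⟫_ℝ ^ 2 := Finset.sum_nonneg fun j _ => sq_nonneg _
  rw [h3] at h4 ⊢
  -- The unit mass of `e a` splits into its part in the span of `f`, where `τ / (τ + Λ) ≤ 1` is
  -- used, and its part orthogonal to it, where `τ / (τ + Λ) ≤ τ / Λ` is used.
  have hp := add_pos (hpos a) hΛ
  have h5 : τ a / (τ a + Λ) ≤ 1 := (div_le_one hp).2 (by linarith)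
  have h6 : τ a / (τ a + Λ) ≤ Λ⁻¹ * τ a := by
    rw [div_eq_inv_mul]
    exact mul_le_mul_of_nonneg_right (inv_anti₀ hΛ (by linarith [hpos a])) (hpos a).le
  nlinarith [sq_nonneg ‖orthPart f (e a)‖]

lemma sum_resQ_le {J : ℕ} {f : Fin J → H} (hf : Orthonormal ℝ f) {Λ : ℝ} (hΛ : 0 < Λ)
    (k : ι → H) :
    ∑ i, resQ Λ k (k i) ≤ ENNReal.ofReal (J + Λ⁻¹ * ∑ i, ‖orthPart f (k i)‖ ^ 2) := by
  obtain ⟨d, e, τ, he, hpos, hk, hτ⟩ := exists_singular_basis k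
  exact (sum_resQ_le_sum_div he hpos hk hτ hΛ).trans
    (ENNReal.ofReal_le_ofReal (sum_div_le hf he hpos hk hτ hΛ))

/-- Adding `Fintype.card β` vectors of norm at most one changes the regularised inverse by a
bounded factor. -/
lemma resQ_inl_le {β : Type*} [Fintype β] {Λ : ℝ} (hΛ : 1 ≤ Λ) (k : ι ⊕ β → H)
    (hk : ∀ i, ‖k i‖ ≤ 1) (x : H) :
    resQ Λ (fun i => k (Sum.inl i)) x ≤ ENNReal.ofReal (1 + Fintype.card β) * resQ Λ k x := by
  have hc : (0 : ℝ) < 1 + Fintype.card β := by positivity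
  refine iSup_le fun v => ?_
  -- The extra vectors add at most `card β * ‖v‖ ^ 2 ≤ card β * Λ * ‖v‖ ^ 2` to the form, since `1 ≤
  -- Λ`. Shrinking the test vector by `1 + card β` compensates for this.
  refine le_trans ?_ (mul_le_mul_right (le_iSup (fun v : H => ENNReal.ofReal
    (2 * ⟪x, v⟫_ℝ - ∑ i, ⟪k i, v⟫_ℝ ^ 2 - Λ * ‖v‖ ^ 2)) ((1 + Fintype.card β : ℝ)⁻¹ • v)) _)
  rw [← ENNReal.ofReal_mul hc.le]
  refine ENNReal.ofReal_le_ofReal ?_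
  have h1 : ∑ j : β, ⟪k (Sum.inr j), v⟫_ℝ ^ 2 ≤ Fintype.card β * ‖v‖ ^ 2 := by
    calc _ ≤ ∑ j : β, ‖v‖ ^ 2 := Finset.sum_le_sum fun j _ => by
          have := abs_real_inner_le_norm (k (Sum.inr j)) v
          rw [← sq_abs]
          have h2 : |⟪k (Sum.inr j), v⟫_ℝ| ≤ ‖v‖ :=
            this.trans (mul_le_of_le_one_left (norm_nonneg _) (hk _))
          gcongr
      _ = _ := by simp
  have h3 : Fintype.card β * ‖v‖ ^ 2 ≤ Λ * (Fintype.card β * ‖v‖ ^ 2) :=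
    le_mul_of_one_le_left (by positivity) hΛ
  simp only [real_inner_smul_right, norm_smul, Fintype.sum_sum_type, mul_pow, ← Finset.mul_sum]
  rw [Real.norm_of_nonneg (by positivity)]
  have h4 : 0 ≤ ∑ i : ι, ⟪k (Sum.inl i), v⟫_ℝ ^ 2 := by positivity
  set c : ℝ := 1 + Fintype.card β with hcdef
  set A := ∑ i : ι, ⟪k (Sum.inl i), v⟫_ℝ ^ 2
  set B := ∑ j : β, ⟪k (Sum.inr j), v⟫_ℝ ^ 2
  have h5 : c * (2 * (c⁻¹ * ⟪x, v⟫_ℝ) - (c⁻¹ ^ 2 * A + c⁻¹ ^ 2 * B) - Λ * (c⁻¹ ^ 2 * ‖v‖ ^ 2)) =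
      2 * ⟪x, v⟫_ℝ - c⁻¹ * (A + B + Λ * ‖v‖ ^ 2) := by
    field_simp
    ring
  have h6 : c⁻¹ * (A + B + Λ * ‖v‖ ^ 2) ≤ A + Λ * ‖v‖ ^ 2 := by
    rw [inv_mul_le_iff₀ hc]
    have : (0:ℝ) ≤ Fintype.card β * A := by positivity
    rw [hcdef]; nlinarith
  linarith [h5, h6]

lemma resQ_equiv {Λ : ℝ} {β : Type*} [Fintype β] (σ : β ≃ ι) (k : ι → H) (x : H) :
    resQ Λ (fun j => k (σ j)) x = resQ Λ k x := by
  simp only [resQ]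
  congr 1
  ext v
  rw [σ.sum_comp fun i => ⟪k i, v⟫_ℝ ^ 2]

/-- As a supremum of continuous functions, `resQ` is lower semicontinuous; this is one benefit of
the variational definition. -/
lemma measurable_resQ [MeasurableSpace H] [BorelSpace H] [SecondCountableTopology H] (Λ : ℝ) :
    Measurable fun z : (ι → H) × H => resQ Λ z.1 z.2 := by
  refine LowerSemicontinuous.measurable (lowerSemicontinuous_iSup fun v => ?_)
  refine Continuous.lowerSemicontinuous (ENNReal.continuous_ofReal.comp ?_)
  fun_prop

end Resolvent


/-! ### Functional calculus on eigenvectors, and interpolation. -/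

section FunctionalCalculus

variable {H : Type*} [NormedAddCommGroup H] [InnerProductSpace ℝ H] {A : H →L[ℝ] H}

lemma mem_eigsp {t : ℝ} {v : H} : v ∈ eigsp A t ↔ A v = t • v := by
  simp [eigsp]

lemma inner_eq_zero_of_mem_eigsp (hA : ∀ u v, ⟪A u, v⟫_ℝ = ⟪u, A v⟫_ℝ) {t t' : ℝ} (h : t ≠ t')
    {u v : H} (hu : u ∈ eigsp A t) (hv : v ∈ eigsp A t') : ⟪u, v⟫_ℝ = 0 := by
  have h1 := hA u v
  rw [mem_eigsp.1 hu, mem_eigsp.1 hv, real_inner_smul_left, real_inner_smul_right] at h1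
  have h2 : (t - t') * ⟪u, v⟫_ℝ = 0 := by linarith
  exact (mul_eq_zero.1 h2).resolve_left (sub_ne_zero.2 h)

variable [CompleteSpace H]

/-- The functional calculus on a finite orthonormal family of eigenvectors. -/
lemma opFun_sum (hA : ∀ u v, ⟪A u, v⟫_ℝ = ⟪u, A v⟫_ℝ) {d : ℕ} {e : Fin d → H} {t : Fin d → ℝ}
    (ht : ∀ a, A (e a) = t a • e a) (φ : ℝ → ℝ) (c : Fin d → ℝ) :
    opFun φ A (∑ a, c a • e a) = ∑ a, (φ (t a) * c a) • e a := by
  have h1 : ∀ (s : ℝ) a, (eigsp A s).starProjection (e a) = if s = t a then e a else 0 := by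
    intro s a
    split_ifs with h
    · exact Submodule.starProjection_eq_self_iff.2 (mem_eigsp.2 (by rw [h, ht]))
    · refine (Submodule.starProjection_apply_eq_zero_iff _).2 ?_
      rw [Submodule.mem_orthogonal]
      exact fun u hu => inner_eq_zero_of_mem_eigsp hA h hu (mem_eigsp.2 (ht a))
  refine HasSum.tsum_eq ?_
  have h2 : ∀ s : ℝ, φ s • (eigsp A s).starProjection (∑ a, c a • e a) =
      ∑ a, if s = t a then (φ (t a) * c a) • e a else 0 := by
    intro s
    rw [map_sum, Finset.smul_sum]
    refine Finset.sum_congr rfl fun a _ => ?_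
    rw [map_smul, h1]
    split_ifs with h
    · rw [h, smul_smul]
    · simp
  simp only [h2]
  exact hasSum_sum fun a _ => hasSum_ite_eq (t a) _

/-- For `t ≤ l` the second summand on the right dominates `t ^ (2 s)`; for `t ≥ l` the first does,
because `2 s - 1 ≤ 0`. -/
lemma rpow_two_mul_le {t l s : ℝ} (ht : 0 ≤ t) (hl : 0 < l) (hs : s ∈ Icc (0 : ℝ) (1 / 2)) :
    (t ^ s) ^ 2 ≤ l ^ (2 * s - 1) * (t + l) := by
  have h1 : (t ^ s) ^ 2 = t ^ (2 * s) := by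
    rw [← Real.rpow_natCast, ← Real.rpow_mul ht]; norm_num [mul_comm]
  have h2 : l ^ (2 * s) = l ^ (2 * s - 1) * l := by
    rw [← Real.rpow_add_one hl.ne']; ring_nf
  have hlp := Real.rpow_pos_of_pos hl (2 * s - 1)
  rw [h1]
  rcases le_total t l with h | h
  · calc t ^ (2 * s) ≤ l ^ (2 * s) := Real.rpow_le_rpow ht h (by linarith [hs.1])
      _ ≤ _ := by rw [h2]; nlinarith
  · have htp : 0 < t := hl.trans_le h
    have h3 : t ^ (2 * s) = t ^ (2 * s - 1) * t := by
      rw [← Real.rpow_add_one htp.ne']; ring_nf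
    have h4 : t ^ (2 * s - 1) ≤ l ^ (2 * s - 1) :=
      Real.rpow_le_rpow_of_nonpos hl h (by linarith [hs.2])
    rw [h3]
    nlinarith

/-- Interpolation: `‖A ^ s u‖ ^ 2 ≤ l ^ (2 s - 1) ⟪(A + l) u, u⟫` for `0 ≤ s ≤ 1 / 2`. -/
lemma norm_sq_opPow_le (hA : ∀ u v, ⟪A u, v⟫_ℝ = ⟪u, A v⟫_ℝ) (hpos : ∀ u, 0 ≤ ⟪A u, u⟫_ℝ)
    {l s : ℝ} (hl : 0 < l) (hs : s ∈ Icc (0 : ℝ) (1 / 2)) (u : H) :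
    ‖opPow A s u‖ ^ 2 ≤ l ^ (2 * s - 1) * (⟪A u, u⟫_ℝ + l * ‖u‖ ^ 2) := by
  set P : ℝ → H := fun t => (eigsp A t).starProjection u with hP
  have hmem : ∀ t, P t ∈ eigsp A t := fun t => Submodule.starProjection_apply_mem _ _
  have hAP : ∀ t, A (P t) = t • P t := fun t => mem_eigsp.1 (hmem t)
  have hPP : ∀ t t', t ≠ t' → ⟪P t, P t'⟫_ℝ = 0 := fun t t' h =>
    inner_eq_zero_of_mem_eigsp hA h (hmem t) (hmem t')
  have hPu : ∀ t, ⟪P t, u⟫_ℝ = ‖P t‖ ^ 2 := fun t => by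
    have h1 : ⟪P t, u - P t⟫_ℝ = 0 :=
      (Submodule.mem_orthogonal _ _).1 (Submodule.sub_starProjection_mem_orthogonal u) _ (hmem t)
    rw [inner_sub_right, real_inner_self_eq_norm_sq] at h1
    linarith
  have hneg : ∀ t, t < 0 → P t = 0 := fun t ht => by
    have h1 := hpos (P t)
    rw [hAP, real_inner_smul_left, real_inner_self_eq_norm_sq] at h1
    have : ‖P t‖ ^ 2 = 0 := le_antisymm (by nlinarith [sq_nonneg ‖P t‖]) (sq_nonneg _)
    simpa using this
  have hlp := Real.rpow_pos_of_pos hl (2 * s - 1)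
  have hnn : 0 ≤ l ^ (2 * s - 1) * (⟪A u, u⟫_ℝ + l * ‖u‖ ^ 2) := by
    have := hpos u
    positivity
  have horth : ∀ (F : Finset ℝ) (c c' : ℝ → ℝ),
      ⟪∑ t ∈ F, c t • P t, ∑ t ∈ F, c' t • P t⟫_ℝ = ∑ t ∈ F, c t * c' t * ‖P t‖ ^ 2 := by
    intro F c c'
    rw [sum_inner]
    refine Finset.sum_congr rfl fun t ht => ?_
    rw [inner_sum, Finset.sum_eq_single t]
    · rw [real_inner_smul_left, real_inner_smul_right, real_inner_self_eq_norm_sq]; ring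
    · intro t' _ h
      rw [real_inner_smul_left, real_inner_smul_right, hPP t t' h.symm]; ring
    · exact fun h => absurd ht h
  have hfin : ∀ F : Finset ℝ, ‖∑ t ∈ F, t ^ s • P t‖ ^ 2 ≤
      l ^ (2 * s - 1) * (⟪A u, u⟫_ℝ + l * ‖u‖ ^ 2) := by
    intro F
    have h1 : ‖∑ t ∈ F, t ^ s • P t‖ ^ 2 ≤
        l ^ (2 * s - 1) * (∑ t ∈ F, t * ‖P t‖ ^ 2 + l * ∑ t ∈ F, ‖P t‖ ^ 2) := by
      rw [← real_inner_self_eq_norm_sq, horth, mul_add, Finset.mul_sum, Finset.mul_sum,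
        Finset.mul_sum, ← Finset.sum_add_distrib]
      refine Finset.sum_le_sum fun t _ => ?_
      rcases lt_or_ge t 0 with ht | ht
      · simp [hneg t ht]
      · have := mul_le_mul_of_nonneg_right (rpow_two_mul_le ht hl hs) (sq_nonneg ‖P t‖)
        nlinarith
    set w := ∑ t ∈ F, P t with hw
    have hw' : w = ∑ t ∈ F, (1 : ℝ) • P t := by simp [hw]
    have hww : ‖w‖ ^ 2 = ∑ t ∈ F, ‖P t‖ ^ 2 := by
      rw [← real_inner_self_eq_norm_sq, hw', horth]; simp
    have hwu : ⟪w, u⟫_ℝ = ∑ t ∈ F, ‖P t‖ ^ 2 := by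
      rw [hw, sum_inner]; exact Finset.sum_congr rfl fun t _ => hPu t
    have hAw : A w = ∑ t ∈ F, t • P t := by
      rw [hw, map_sum]; exact Finset.sum_congr rfl fun t _ => hAP t
    have hAww : ⟪A w, w⟫_ℝ = ∑ t ∈ F, t * ‖P t‖ ^ 2 := by
      rw [hAw, hw', horth]; simp
    have hAwu : ⟪A w, u⟫_ℝ = ∑ t ∈ F, t * ‖P t‖ ^ 2 := by
      rw [hAw, sum_inner]
      exact Finset.sum_congr rfl fun t _ => by rw [real_inner_smul_left, hPu]
    -- Compactness is not assumed, so `u` need not be the sum of its eigencomponents. Positivity of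
    -- `A` on the remainder `u - w` still gives `∑ t ‖P t‖ ^ 2 ≤ ⟪A u, u⟫`.
    have h2 := hpos (u - w)
    have h3 : ⟪A u, w⟫_ℝ = ⟪A w, u⟫_ℝ := by rw [hA, real_inner_comm]
    rw [map_sub, inner_sub_left, inner_sub_right, inner_sub_right, h3, hAwu, hAww] at h2
    have h4 : ‖u - w‖ ^ 2 = ‖u‖ ^ 2 - ∑ t ∈ F, ‖P t‖ ^ 2 := by
      rw [@norm_sub_sq ℝ, hww]
      simp only [RCLike.re_to_real]
      rw [real_inner_comm, hwu]; ring
    have h5 := sq_nonneg ‖u - w‖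
    rw [h4] at h5
    refine h1.trans (mul_le_mul_of_nonneg_left ?_ hlp.le)
    nlinarith
  -- If the defining series diverges, its value is `0` by convention and the bound is trivial.
  by_cases hsum : Summable fun t : ℝ => t ^ s • P t
  · have h1 := ((hsum.hasSum).norm.pow 2)
    exact le_of_tendsto h1 (Eventually.of_forall hfin)
  · have : opPow A s u = 0 := tsum_eq_zero_of_not_summable hsum
    rw [this]; simpa using hnn

end FunctionalCalculus

/-! ### Deterministic bounds on the filtered vectors of one block. -/

section BlockBounds

variable {H : Type*} [NormedAddCommGroup H] [InnerProductSpace ℝ H]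
  {ι : Type*} [Fintype ι] {k : ι → H} {d : ℕ} {e : Fin d → H} {τ : Fin d → ℝ}

/-- Bounds on the filtered vectors `w i = φ(n⁻¹ ∑ k ⊗ k) k i` of one block, for a filter with
`|φ t| (t + l) ≤ B`. -/
lemma filtered_bounds (he : Orthonormal ℝ e) (hpos : ∀ a, 0 < τ a)
    (hk : ∀ i, k i = ∑ a, ⟪e a, k i⟫_ℝ • e a)
    (hτ : ∀ a, ∑ i, ⟪k i, e a⟫_ℝ • k i = τ a • e a) (hk1 : ∀ i, ‖k i‖ ≤ 1)
    {n l B : ℝ} (hn : 0 < n) (hl : 0 < l) {φ : Fin d → ℝ}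
    (hφ : ∀ a, |φ a| * (τ a / n + l) ≤ B) :
    let w : ι → H := fun i => ∑ a, (φ a * ⟪e a, k i⟫_ℝ) • e a
    (∀ x, ∑ i, ⟪w i, x⟫_ℝ ^ 2 ≤ B ^ 2 * n ^ 2 * ∑ a, ⟪e a, x⟫_ℝ ^ 2 / (τ a + n * l)) ∧
    (l * ∑ i, ‖w i‖ ^ 2 ≤ B ^ 2 * n * ∑ a, τ a / (τ a + n * l)) ∧
    (∀ i x, ⟪w i, x⟫_ℝ ^ 2 ≤ B ^ 2 / l * n * ∑ a, ⟪e a, x⟫_ℝ ^ 2 / (τ a + n * l)) ∧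
    (∀ i, l * ‖w i‖ ^ 2 ≤ B ^ 2 / l) := by
  intro w
  have hnl : 0 < n * l := mul_pos hn hl
  have hp : ∀ a, 0 < τ a + n * l := fun a => add_pos (hpos a) hnl
  have hφ2 : ∀ a, φ a ^ 2 * (τ a + n * l) ^ 2 ≤ B ^ 2 * n ^ 2 := fun a => by
    have h1 : |φ a| * (τ a + n * l) ≤ B * n := by
      have := mul_le_mul_of_nonneg_right (hφ a) hn.le
      calc _ = |φ a| * (τ a / n + l) * n := by field_simp
        _ ≤ _ := this
    have h2 : 0 ≤ |φ a| * (τ a + n * l) := mul_nonneg (abs_nonneg _) (hp a).le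
    calc _ = (|φ a| * (τ a + n * l)) ^ 2 := by rw [mul_pow, sq_abs]
      _ ≤ (B * n) ^ 2 := by gcongr
      _ = _ := by ring
  have hφ3 : ∀ a, φ a ^ 2 ≤ B ^ 2 * n ^ 2 / (τ a + n * l) ^ 2 := fun a => by
    rw [le_div_iff₀ (pow_pos (hp a) 2)]; exact hφ2 a
  have hwx : ∀ i x, ⟪w i, x⟫_ℝ = ∑ a, φ a * ⟪e a, k i⟫_ℝ * ⟪e a, x⟫_ℝ := fun i x => by
    rw [sum_inner]; exact Finset.sum_congr rfl fun a _ => real_inner_smul_left _ _ _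
  have hwn : ∀ i, ‖w i‖ ^ 2 = ∑ a, φ a ^ 2 * ⟪e a, k i⟫_ℝ ^ 2 := fun i => by
    rw [norm_sq_sum_orthonormal he]; exact Finset.sum_congr rfl fun a _ => by ring
  have hbes : ∀ i, ∑ a, ⟪e a, k i⟫_ℝ ^ 2 ≤ 1 := fun i =>
    (bessel_fin he (k i)).trans (pow_le_one₀ (norm_nonneg _) (hk1 i))
  have hdiag : ∀ a, ∑ i, ⟪e a, k i⟫_ℝ ^ 2 = τ a := fun a => by
    have := sum_inner_mul_inner_eq he hτ a a
    simp only [if_true] at this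
    rw [← this]
    exact Finset.sum_congr rfl fun i _ => by rw [real_inner_comm]; ring
  refine ⟨fun x => ?_, ?_, fun i x => ?_, fun i => ?_⟩
  -- The filter is self-adjoint and may be moved from `k i` to `x`, after which the sum over `i` is
  -- diagonal in the singular basis.
  · have h1 : ∀ i, ⟪w i, x⟫_ℝ = ⟪k i, ∑ a, (φ a * ⟪e a, x⟫_ℝ) • e a⟫_ℝ := fun i => by
      rw [hwx, inner_sum]
      refine Finset.sum_congr rfl fun a _ => ?_
      rw [real_inner_smul_right, real_inner_comm (e a)]; ring
    simp only [h1]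
    rw [sum_inner_sq_eq hk hτ, Finset.mul_sum]
    refine Finset.sum_le_sum fun a _ => ?_
    rw [inner_sum_orthonormal he]
    calc τ a * (φ a * ⟪e a, x⟫_ℝ) ^ 2 ≤
        (τ a + n * l) * (B ^ 2 * n ^ 2 / (τ a + n * l) ^ 2 * ⟪e a, x⟫_ℝ ^ 2) := by
          rw [mul_pow]
          have := hφ3 a
          have := (hpos a).le
          gcongr
          linarith
      _ = _ := by
          have := (hp a).ne'
          field_simp
  · simp only [hwn]
    rw [Finset.sum_comm, Finset.mul_sum, Finset.mul_sum]
    refine Finset.sum_le_sum fun a _ => ?_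
    rw [← Finset.mul_sum, hdiag]
    have h1 : l ≤ (τ a + n * l) / n := by
      rw [le_div_iff₀ hn]; nlinarith [hpos a]
    calc l * (φ a ^ 2 * τ a) ≤
        (τ a + n * l) / n * (B ^ 2 * n ^ 2 / (τ a + n * l) ^ 2 * τ a) := by
          have := hφ3 a
          have := (hpos a).le
          have := hp a
          gcongr
      _ = _ := by
          have := (hp a).ne'
          field_simp
  · rw [hwx]
    -- For a single `i` only `‖k i‖ ≤ 1` is available: Cauchy–Schwarz separates `k i` from the
    -- filtered `x`. This loses a factor `1 / (n l)` against the bound on the average over `i`.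
    have h1 : (∑ a, φ a * ⟪e a, k i⟫_ℝ * ⟪e a, x⟫_ℝ) ^ 2 ≤
        (∑ a, ⟪e a, k i⟫_ℝ ^ 2) * ∑ a, (φ a * ⟪e a, x⟫_ℝ) ^ 2 := by
      refine le_trans (le_of_eq ?_) (Finset.sum_mul_sq_le_sq_mul_sq _ _ _)
      congr 1
      exact Finset.sum_congr rfl fun a _ => by ring
    refine h1.trans ((mul_le_mul_of_nonneg_right (hbes i) (by positivity)).trans ?_)
    rw [one_mul, Finset.mul_sum]
    refine Finset.sum_le_sum fun a _ => ?_
    rw [mul_pow]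
    have h2 : B ^ 2 * n ^ 2 / (τ a + n * l) ^ 2 ≤ B ^ 2 / l * n / (τ a + n * l) := by
      rw [div_le_div_iff₀ (pow_pos (hp a) 2) (hp a)]
      have h3 : (n : ℝ) ≤ (τ a + n * l) / l := by
        rw [le_div_iff₀ hl]; linarith [hpos a]
      calc B ^ 2 * n ^ 2 * (τ a + n * l) = B ^ 2 * n * (τ a + n * l) * n := by ring
        _ ≤ B ^ 2 * n * (τ a + n * l) * ((τ a + n * l) / l) := by
            have := hp a
            gcongr
        _ = _ := by ring
    calc φ a ^ 2 * ⟪e a, x⟫_ℝ ^ 2 ≤ B ^ 2 / l * n / (τ a + n * l) * ⟪e a, x⟫_ℝ ^ 2 := by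
          have := (hφ3 a).trans h2
          gcongr
      _ = _ := by ring
  · rw [hwn]
    have h1 : ∀ a, φ a ^ 2 ≤ B ^ 2 / l ^ 2 := fun a => by
      refine (hφ3 a).trans ?_
      rw [div_le_div_iff₀ (pow_pos (hp a) 2) (pow_pos hl 2)]
      have : (n * l) ^ 2 ≤ (τ a + n * l) ^ 2 := by
        gcongr
        linarith [hpos a]
      calc B ^ 2 * n ^ 2 * l ^ 2 = B ^ 2 * (n * l) ^ 2 := by ring
        _ ≤ _ := by gcongr
    calc l * ∑ a, φ a ^ 2 * ⟪e a, k i⟫_ℝ ^ 2 ≤ l * ∑ a, B ^ 2 / l ^ 2 * ⟪e a, k i⟫_ℝ ^ 2 := by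
          gcongr with a
          exact h1 a
      _ ≤ l * (B ^ 2 / l ^ 2 * 1) := by
          rw [← Finset.mul_sum]
          have := hbes i
          gcongr
      _ = _ := by field_simp

end BlockBounds


/-! ### A Rosenthal-type moment inequality in a quadratic seminorm. -/

section Moments

/-- Constant in the one-step moment expansion. -/
noncomputable def expandConst : ℕ → ℝ
  | 0 => 1
  | k + 1 => 1 + 6 * (k + 1) + 6 * expandConst k

/-- Constant in the moment bound for sums of independent vectors. -/
noncomputable def momentConst (c : ℝ) : ℕ → ℝ
  | 0 => 1
  | k + 1 => expandConst k * c * (momentConst c k + 1)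

lemma expandConst_nonneg (k : ℕ) : 0 ≤ expandConst k := by
  induction k with
  | zero => simp [expandConst]
  | succ k ih => rw [expandConst]; positivity

lemma momentConst_nonneg {c : ℝ} (hc : 0 ≤ c) (k : ℕ) : 0 ≤ momentConst c k := by
  induction k with
  | zero => simp [momentConst]
  | succ k ih =>
    rw [momentConst]
    have := expandConst_nonneg k
    positivity

lemma pow_mul_le_add_pow {a d : ℝ} (ha : 0 ≤ a) (hd : 0 ≤ d) (k : ℕ) :
    a ^ k * d ^ 2 ≤ a ^ (k + 1) * d + d ^ (k + 2) ∧ a * d ^ (k + 1) ≤ a ^ (k + 1) * d + d ^ (k + 2) := by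
  rcases le_total a d with h | h
  · have h1 : a ^ k ≤ d ^ k := pow_le_pow_left₀ ha h k
    have h2 : 0 ≤ a ^ (k + 1) * d := by positivity
    constructor
    · calc a ^ k * d ^ 2 ≤ d ^ k * d ^ 2 := by gcongr
        _ = d ^ (k + 2) := by ring
        _ ≤ _ := by linarith
    · calc a * d ^ (k + 1) ≤ d * d ^ (k + 1) := by gcongr
        _ = d ^ (k + 2) := by ring
        _ ≤ _ := by linarith
  · have h1 : d ^ k ≤ a ^ k := pow_le_pow_left₀ hd h k
    have h2 : 0 ≤ d ^ (k + 2) := by positivity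
    constructor
    · calc a ^ k * d ^ 2 = a ^ k * d * d := by ring
        _ ≤ a ^ k * d * a := by gcongr
        _ = a ^ (k + 1) * d := by ring
        _ ≤ _ := by linarith
    · calc a * d ^ (k + 1) = a * d * d ^ k := by ring
        _ ≤ a * d * a ^ k := by gcongr
        _ = a ^ (k + 1) * d := by ring
        _ ≤ _ := by linarith

/-- Here `a`, `2 c`, `d` are the old value, the cross term and the new square of a quadratic form
after adding one vector. The term linear in `c` keeps its exact coefficient because it will have
mean zero; all other terms are absorbed using `c ^ 2 ≤ a d`. -/
lemma expand_pow_le (k : ℕ) {a d c : ℝ} (ha : 0 ≤ a) (hd : 0 ≤ d) (hc : c ^ 2 ≤ a * d) :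
    (a + 2 * c + d) ^ (k + 1) ≤ a ^ (k + 1) + 2 * (k + 1) * (a ^ k * c) +
      expandConst k * (a ^ k * d + d ^ (k + 1)) := by
  have h2c : |2 * c| ≤ a + d := abs_le_of_sq_le_sq (by nlinarith [sq_nonneg (a - d)]) (by positivity)
  have hc1 := (abs_le.1 h2c).1
  have hc2 := (abs_le.1 h2c).2
  have hX : 0 ≤ a + 2 * c + d := by linarith
  induction k with
  | zero => simp [expandConst]; linarith
  | succ k ih =>
    have hC := expandConst_nonneg k
    have h1 := mul_le_mul_of_nonneg_right ih hX
    rw [← pow_succ] at h1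
    refine h1.trans ?_
    obtain ⟨hy1, hy2⟩ := pow_mul_le_add_pow ha hd k
    have e1 : a ^ k * c ^ 2 ≤ a ^ (k + 1) * d := by
      calc a ^ k * c ^ 2 ≤ a ^ k * (a * d) := by gcongr
        _ = _ := by ring
    have e2 : 2 * (a ^ k * c * d) ≤ 2 * (a ^ (k + 1) * d) + d ^ (k + 2) := by
      calc 2 * (a ^ k * c * d) = a ^ k * d * (2 * c) := by ring
        _ ≤ a ^ k * d * (a + d) := by gcongr
        _ = a ^ (k + 1) * d + a ^ k * d ^ 2 := by ring
        _ ≤ _ := by linarith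
    have e3 : (a ^ k * d + d ^ (k + 1)) * (a + 2 * c + d) ≤
        6 * (a ^ (k + 1) * d + d ^ (k + 2)) := by
      calc (a ^ k * d + d ^ (k + 1)) * (a + 2 * c + d) ≤
          (a ^ k * d + d ^ (k + 1)) * (2 * (a + d)) := by
            gcongr
            linarith
        _ = 2 * (a ^ (k + 1) * d + a ^ k * d ^ 2 + a * d ^ (k + 1) + d ^ (k + 2)) := by ring
        _ ≤ _ := by linarith
    have e4 := mul_le_mul_of_nonneg_left e3 hC
    have e5 := mul_le_mul_of_nonneg_left e1 (by positivity : (0 : ℝ) ≤ 4 * (k + 1))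
    have e6 := mul_le_mul_of_nonneg_left e2 (by positivity : (0 : ℝ) ≤ (k + 1))
    have e7 : 0 ≤ a ^ (k + 1) * d := by positivity
    have e8 : 0 ≤ d ^ (k + 2) := by positivity
    have e9 : (0 : ℝ) ≤ k * d ^ (k + 2) := by positivity
    rw [expandConst]
    push_cast
    have expand : (a ^ (k + 1) + 2 * (k + 1) * (a ^ k * c) +
        expandConst k * (a ^ k * d + d ^ (k + 1))) * (a + 2 * c + d) =
        a ^ (k + 1 + 1) + 2 * (k + 1 + 1) * (a ^ (k + 1) * c) + a ^ (k + 1) * d +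
        4 * (k + 1) * (a ^ k * c ^ 2) + (k + 1) * (2 * (a ^ k * c * d)) +
        expandConst k * ((a ^ k * d + d ^ (k + 1)) * (a + 2 * c + d)) := by ring
    rw [expand]
    have e10 : d ^ (k + 1 + 1) = d ^ (k + 2) := rfl
    rw [e10]
    nlinarith

variable {H : Type*} [NormedAddCommGroup H] [InnerProductSpace ℝ H] {A : H →L[ℝ] H}

lemma inner_sq_le_of_nonneg (hA : ∀ u v, ⟪A u, v⟫_ℝ = ⟪u, A v⟫_ℝ) (hpos : ∀ u, 0 ≤ ⟪A u, u⟫_ℝ)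
    (u v : H) : ⟪A u, v⟫_ℝ ^ 2 ≤ ⟪A u, u⟫_ℝ * ⟪A v, v⟫_ℝ := by
  have h : ∀ x : ℝ, 0 ≤ ⟪A v, v⟫_ℝ * (x * x) + 2 * ⟪A u, v⟫_ℝ * x + ⟪A u, u⟫_ℝ := fun x => by
    have h1 := hpos (u + x • v)
    have h2 : ⟪A v, u⟫_ℝ = ⟪A u, v⟫_ℝ := by rw [hA, real_inner_comm]
    simp only [map_add, map_smul, inner_add_left, inner_add_right, real_inner_smul_left,
      real_inner_smul_right, h2] at h1
    nlinarith
  have := discrim_le_zero h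
  rw [discrim] at this
  nlinarith

variable {Ω : Type*} [MeasurableSpace Ω] {μ : Measure Ω} [IsProbabilityMeasure μ]
  {ι : Type*} [Fintype ι] {ε : ι → Ω → ℝ} {w : ι → H}

/-- Moment inequality for sums of independent centred vectors `ε i • w i` in the seminorm given by
a nonnegative symmetric operator. -/
lemma integral_quad_pow_le (hA : ∀ u v, ⟪A u, v⟫_ℝ = ⟪u, A v⟫_ℝ) (hpos : ∀ u, 0 ≤ ⟪A u, u⟫_ℝ)
    {K : ℕ} (hind : iIndepFun ε μ) (hmeas : ∀ i, Measurable (ε i))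
    (hLp : ∀ i, MemLp (ε i) ((2 * K : ℕ) : ℝ≥0∞) μ) (hmean : ∀ i, ∫ ω, ε i ω ∂μ = 0)
    {c σ M W : ℝ} (hc : 0 ≤ c) (hW0 : 0 ≤ W)
    (hmom : ∀ i, ∀ l, l + 1 ≤ K → ∫ ω, ε i ω ^ (2 * (l + 1)) ∂μ ≤ c * σ ^ 2 * (M ^ 2) ^ l)
    (hW : ∀ i, ⟪A (w i), w i⟫_ℝ ≤ W) (k : ℕ) (hk : k ≤ K) (s : Finset ι) :
    Integrable (fun ω => ⟪A (∑ i ∈ s, ε i ω • w i), ∑ i ∈ s, ε i ω • w i⟫_ℝ ^ k) μ ∧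
    ∫ ω, ⟪A (∑ i ∈ s, ε i ω • w i), ∑ i ∈ s, ε i ω • w i⟫_ℝ ^ k ∂μ ≤
      momentConst c k * (σ ^ 2 * ∑ i, ⟪A (w i), w i⟫_ℝ + M ^ 2 * W) ^ k := by
  classical
  let S : Finset ι → Ω → H := fun s ω => ∑ i ∈ s, ε i ω • w i
  let N : H → ℝ := fun u => ⟪A u, u⟫_ℝ
  -- A scalar majorant of `‖S s‖` with finite moments up to order `2 K`; all integrability claims
  -- are reduced to it.
  let R : Finset ι → Ω → ℝ := fun s ω => ∑ i ∈ s, ‖w i‖ * ‖ε i ω‖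
  have hR0 : ∀ s ω, 0 ≤ R s ω := fun s ω => by positivity
  have hSR : ∀ s ω, ‖S s ω‖ ≤ R s ω := fun s ω => by
    refine (norm_sum_le _ _).trans (Finset.sum_le_sum fun i _ => ?_)
    rw [norm_smul, mul_comm]
  have hRLp : ∀ s, MemLp (R s) ((2 * K : ℕ) : ℝ≥0∞) μ := fun s =>
    memLp_finsetSum s fun i _ => (hLp i).norm.const_mul ‖w i‖
  have hRint : ∀ s, ∀ p ≤ 2 * K, Integrable (fun ω => R s ω ^ p) μ := fun s p hp => by
    have h1 : MemLp (R s) (p : ℝ≥0∞) μ := (hRLp s).mono_exponent (by exact_mod_cast hp)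
    refine h1.integrable_norm_pow'.congr (ae_of_all _ fun ω => ?_)
    simp only [Real.norm_of_nonneg (hR0 s ω)]
  have hScont : ∀ s : Finset ι, Continuous fun x : s → ℝ => ∑ i : s, x i • w i := fun s => by fun_prop
  have hSx : ∀ s ω, S s ω = (fun x : s → ℝ => ∑ i : s, x i • w i) (fun i => ε i ω) := fun s ω =>
    (Finset.sum_coe_sort s fun i => ε i ω • w i).symm
  have hNle : ∀ u, |N u| ≤ ‖A‖ * ‖u‖ ^ 2 := fun u =>
    (abs_real_inner_le_norm _ _).trans (by
      have := A.le_opNorm u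
      nlinarith [norm_nonneg u])
  have hmeasS : ∀ (s : Finset ι) (F : H → ℝ), Continuous F → Measurable fun ω => F (S s ω) := by
    intro s F hF
    simp only [hSx]
    exact (hF.comp (hScont s)).measurable.comp (measurable_pi_lambda _ fun i => hmeas i)
  have hNc : Continuous N := by fun_prop
  have hNint : ∀ s, ∀ j ≤ K, Integrable (fun ω => N (S s ω) ^ j) μ := fun s j hj => by
    refine Integrable.mono' ((hRint s (2 * j) (by omega)).const_mul (‖A‖ ^ j))
      (hmeasS s (fun u => N u ^ j) (by fun_prop)).aestronglyMeasurable (ae_of_all _ fun ω => ?_)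
    rw [norm_pow, Real.norm_eq_abs, pow_mul, ← mul_pow]
    refine pow_le_pow_left₀ (abs_nonneg _) ((hNle _).trans ?_) j
    have := hSR s ω
    gcongr
  have hcross : ∀ s v, ∀ j, j + 1 ≤ K → Integrable (fun ω => N (S s ω) ^ j * ⟪A (S s ω), v⟫_ℝ) μ := by
    intro s v j hj
    refine Integrable.mono' ((hRint s (2 * j + 1) (by omega)).const_mul (‖A‖ ^ j * (‖A‖ * ‖v‖)))
      (hmeasS s (fun u => N u ^ j * ⟪A u, v⟫_ℝ) (by fun_prop)).aestronglyMeasurable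
      (ae_of_all _ fun ω => ?_)
    have h1 : |N (S s ω)| ^ j ≤ (‖A‖ * R s ω ^ 2) ^ j := by
      refine pow_le_pow_left₀ (abs_nonneg _) ((hNle _).trans ?_) j
      have := hSR s ω
      gcongr
    have h2 : |⟪A (S s ω), v⟫_ℝ| ≤ ‖A‖ * R s ω * ‖v‖ := by
      refine (abs_real_inner_le_norm _ _).trans ?_
      have := A.le_opNorm (S s ω)
      have := hSR s ω
      have h3 : ‖A (S s ω)‖ ≤ ‖A‖ * R s ω := by
        refine (A.le_opNorm _).trans ?_
        gcongr
      gcongr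
    have h4 := hR0 s ω
    rw [norm_mul, norm_pow, Real.norm_eq_abs, Real.norm_eq_abs]
    calc _ ≤ (‖A‖ * R s ω ^ 2) ^ j * (‖A‖ * R s ω * ‖v‖) := by gcongr
      _ = _ := by rw [mul_pow, ← pow_mul]; ring
  have hεint : ∀ i, ∀ l, l + 1 ≤ K → Integrable (fun ω => ε i ω ^ (2 * (l + 1))) μ := by
    intro i l hl
    have h1 : MemLp (ε i) ((2 * (l + 1) : ℕ) : ℝ≥0∞) μ :=
      (hLp i).mono_exponent (by exact_mod_cast (by omega : 2 * (l + 1) ≤ 2 * K))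
    refine h1.integrable_norm_pow'.congr (ae_of_all _ fun ω => ?_)
    simp only [pow_mul, Real.norm_eq_abs, sq_abs]
  have hindS : ∀ (s : Finset ι) (a : ι), a ∉ s → ∀ (F : H → ℝ) (G : ℝ → ℝ), Continuous F →
      Continuous G → IndepFun (fun ω => F (S s ω)) (fun ω => G (ε a ω)) μ := by
    intro s a ha F G hF hG
    have h1 := hind.indepFun_finset s {a} (Finset.disjoint_singleton_right.2 ha) hmeas
    have h2 := h1.comp (φ := fun x : s → ℝ => F (∑ i : s, x i • w i))
      (ψ := fun x : ({a} : Finset ι) → ℝ => G (x ⟨a, Finset.mem_singleton_self a⟩))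
      (hF.comp (hScont s)).measurable (by fun_prop)
    refine h2.congr (ae_of_all _ fun ω => ?_) (ae_of_all _ fun ω => rfl)
    simp only [hSx, Function.comp]
  set V : ℝ := σ ^ 2 * ∑ i, ⟪A (w i), w i⟫_ℝ with hV
  have hV0 : 0 ≤ V := mul_nonneg (sq_nonneg _) (Finset.sum_nonneg fun i _ => hpos _)
  refine ⟨hNint s k hk, ?_⟩
  change ∫ ω, N (S s ω) ^ k ∂μ ≤ _
  induction k generalizing s with
  | zero => simp [momentConst]
  | succ k ih =>
    set G := V + M ^ 2 * W with hG
    have hMW : 0 ≤ M ^ 2 * W := by positivity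
    have hG0 : 0 ≤ G := by positivity
    have hmc := momentConst_nonneg hc k
    have hec := expandConst_nonneg k
    -- Inner induction over the summands: adding the vector `w a` costs an amount linear in `N (w
    -- a)`, times the fixed factor `G ^ k` supplied by the outer induction hypothesis on `k`.
    -- Summing the increments gives one more factor of at most `G`.
    have key : ∀ s : Finset ι, ∫ ω, N (S s ω) ^ (k + 1) ∂μ ≤
        momentConst c (k + 1) * (σ ^ 2 * ∑ i ∈ s, N (w i)) * G ^ k := by
      intro s
      induction s using Finset.induction_on with
      | empty => simp [N, S]
      | insert a s ha ihs =>
        have hSins : ∀ ω, S (insert a s) ω = S s ω + ε a ω • w a := fun ω => by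
          simp only [S]
          rw [Finset.sum_insert ha, add_comm]
        have hNins : ∀ ω, N (S (insert a s) ω) =
            N (S s ω) + 2 * (ε a ω * ⟪A (S s ω), w a⟫_ℝ) + ε a ω ^ 2 * N (w a) := fun ω => by
          have h2 : ⟪A (w a), S s ω⟫_ℝ = ⟪A (S s ω), w a⟫_ℝ := by rw [hA, real_inner_comm]
          simp only [N, hSins, map_add, map_smul, inner_add_left, inner_add_right,
            real_inner_smul_left, real_inner_smul_right, h2]
          ring
        have hpt : ∀ ω, N (S (insert a s) ω) ^ (k + 1) ≤ N (S s ω) ^ (k + 1) +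
            2 * (k + 1) * (N (S s ω) ^ k * ⟪A (S s ω), w a⟫_ℝ * ε a ω) +
            expandConst k * (N (w a) * (N (S s ω) ^ k * ε a ω ^ 2) +
              N (w a) ^ (k + 1) * ε a ω ^ (2 * (k + 1))) := fun ω => by
          rw [hNins]
          have hcs := inner_sq_le_of_nonneg hA hpos (S s ω) (w a)
          have h1 := expand_pow_le k (hpos (S s ω))
            (mul_nonneg (sq_nonneg (ε a ω)) (hpos (w a)))
            (c := ε a ω * ⟪A (S s ω), w a⟫_ℝ) (by
              rw [mul_pow]
              calc _ ≤ ε a ω ^ 2 * (⟪A (S s ω), S s ω⟫_ℝ * ⟪A (w a), w a⟫_ℝ) := by gcongr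
                _ = _ := by ring)
          refine h1.trans (le_of_eq ?_)
          simp only [N]
          rw [mul_pow, ← pow_mul]
          ring
        have i1 := hNint s (k + 1) hk
        have hind2 : IndepFun (fun ω => N (S s ω) ^ k * ⟪A (S s ω), w a⟫_ℝ) (fun ω => ε a ω) μ :=
          hindS s a ha (fun u => N u ^ k * ⟪A u, w a⟫_ℝ) id (by fun_prop) continuous_id
        have hε1 : Integrable (ε a) μ := (hLp a).integrable (by
          exact_mod_cast (by omega : 1 ≤ 2 * K))
        have i2 : Integrable (fun ω => N (S s ω) ^ k * ⟪A (S s ω), w a⟫_ℝ * ε a ω) μ :=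
          hind2.integrable_mul (hcross s (w a) k hk) hε1
        have hind3 : IndepFun (fun ω => N (S s ω) ^ k) (fun ω => ε a ω ^ 2) μ :=
          hindS s a ha (fun u => N u ^ k) (fun x => x ^ 2) (by fun_prop) (by fun_prop)
        have hε2 : Integrable (fun ω => ε a ω ^ 2) μ := hεint a 0 (by omega)
        have i3 : Integrable (fun ω => N (S s ω) ^ k * ε a ω ^ 2) μ :=
          hind3.integrable_mul (hNint s k (by omega)) hε2
        have i4 := hεint a k hk
        have hI2 : ∫ ω, N (S s ω) ^ k * ⟪A (S s ω), w a⟫_ℝ * ε a ω ∂μ = 0 := by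
          -- The new noise variable is independent of the partial sum and centred.
          rw [hind2.integral_fun_mul_eq_mul_integral (hcross s (w a) k hk).1 hε1.1, hmean, mul_zero]
        have hI3 : ∫ ω, N (S s ω) ^ k * ε a ω ^ 2 ∂μ ≤ momentConst c k * G ^ k * (c * σ ^ 2) := by
          rw [hind3.integral_fun_mul_eq_mul_integral (hNint s k (by omega)).1 hε2.1]
          have h1 := ih (by omega) s
          have h2 := hmom a 0 (by omega)
          simp only [zero_add, mul_one, pow_zero] at h2
          have h3 : 0 ≤ ∫ ω, ε a ω ^ 2 ∂μ := integral_nonneg fun ω => sq_nonneg _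
          gcongr
        have hI4 := hmom a k hk
        have hNw := hpos (w a)
        have j1 : Integrable (fun ω => N (S s ω) ^ (k + 1) +
            2 * (k + 1) * (N (S s ω) ^ k * ⟪A (S s ω), w a⟫_ℝ * ε a ω)) μ :=
          i1.add (i2.const_mul _)
        have j2 : Integrable (fun ω => N (w a) * (N (S s ω) ^ k * ε a ω ^ 2) +
            N (w a) ^ (k + 1) * ε a ω ^ (2 * (k + 1))) μ := (i3.const_mul _).add (i4.const_mul _)
        calc ∫ ω, N (S (insert a s) ω) ^ (k + 1) ∂μ ≤ ∫ ω, (N (S s ω) ^ (k + 1) +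
            2 * (k + 1) * (N (S s ω) ^ k * ⟪A (S s ω), w a⟫_ℝ * ε a ω) +
            expandConst k * (N (w a) * (N (S s ω) ^ k * ε a ω ^ 2) +
              N (w a) ^ (k + 1) * ε a ω ^ (2 * (k + 1)))) ∂μ :=
              integral_mono (hNint _ _ hk) (j1.add (j2.const_mul _)) hpt
          _ = ∫ ω, N (S s ω) ^ (k + 1) ∂μ +
              expandConst k * (N (w a) * ∫ ω, N (S s ω) ^ k * ε a ω ^ 2 ∂μ +
                N (w a) ^ (k + 1) * ∫ ω, ε a ω ^ (2 * (k + 1)) ∂μ) := by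
              rw [integral_add j1 (j2.const_mul _),
                integral_add i1 (i2.const_mul _), integral_const_mul, hI2, integral_const_mul,
                integral_add (i3.const_mul _) (i4.const_mul _), integral_const_mul,
                integral_const_mul]
              ring
          _ ≤ momentConst c (k + 1) * (σ ^ 2 * ∑ i ∈ s, N (w i)) * G ^ k +
              expandConst k * (N (w a) * (momentConst c k * G ^ k * (c * σ ^ 2)) +
                N (w a) ^ (k + 1) * (c * σ ^ 2 * (M ^ 2) ^ k)) := by
              have hN0 : 0 ≤ N (w a) := hNw
              gcongr
          _ ≤ momentConst c (k + 1) * (σ ^ 2 * ∑ i ∈ s, N (w i)) * G ^ k +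
              expandConst k * (N (w a) * (momentConst c k * G ^ k * (c * σ ^ 2)) +
                N (w a) * (c * σ ^ 2) * G ^ k) := by
              have h1 : N (w a) ^ (k + 1) * (c * σ ^ 2 * (M ^ 2) ^ k) =
                  N (w a) * (c * σ ^ 2) * (M ^ 2 * N (w a)) ^ k := by
                rw [mul_pow]; ring
              have h2 : M ^ 2 * N (w a) ≤ G := by
                have : M ^ 2 * N (w a) ≤ M ^ 2 * W := mul_le_mul_of_nonneg_left (hW a) (sq_nonneg _)
                linarith
              rw [h1]
              have hN0 : 0 ≤ N (w a) := hNw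
              gcongr
          _ = _ := by
              rw [Finset.sum_insert ha, momentConst]
              ring
    refine (key s).trans ?_
    have hmc1 := momentConst_nonneg hc (k + 1)
    have h1 : σ ^ 2 * ∑ i ∈ s, N (w i) ≤ G := by
      have : ∑ i ∈ s, N (w i) ≤ ∑ i, N (w i) :=
        Finset.sum_le_sum_of_subset_of_nonneg (Finset.subset_univ s) fun i _ _ => hpos _
      have h2 : σ ^ 2 * ∑ i ∈ s, N (w i) ≤ V := mul_le_mul_of_nonneg_left this (sq_nonneg _)
      linarith
    calc _ ≤ momentConst c (k + 1) * G * G ^ k := by gcongr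
      _ = _ := by ring

end Moments


/-! ### Moments of empirical and mixed effective dimensions, by exchangeability. -/

section Sampling

variable {X : Type*} [MeasurableSpace X] {ν : Measure X} [IsProbabilityMeasure ν]

lemma lintegral_pi_prod {ι : Type*} [Fintype ι] {F : ι → X → ℝ≥0∞} (hF : ∀ i, Measurable (F i)) :
    ∫⁻ x : ι → X, ∏ i, F i (x i) ∂(Measure.pi fun _ => ν) = ∏ i, ∫⁻ x, F i x ∂ν := by
  have hind : iIndepFun (fun i (x : ι → X) => F i (x i)) (Measure.pi fun _ => ν) :=
    iIndepFun_pi (μ := fun _ : ι => ν) (X := F) fun i => (hF i).aemeasurable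
  rw [lintegral_prod_eq_prod_lintegral_of_indepFun Finset.univ _ hind fun i =>
    (hF i).comp (measurable_pi_apply i)]
  refine Finset.prod_congr rfl fun i _ => ?_
  exact (measurePreserving_eval (fun _ : ι => ν) i).lintegral_comp (hF i)

lemma lintegral_pi_restrict {ι : Type*} [Fintype ι] (s : Finset ι) {F : (s → X) → ℝ≥0∞}
    (hF : Measurable F) :
    ∫⁻ x : ι → X, F (fun i => x i) ∂(Measure.pi fun _ => ν) =
      ∫⁻ x, F x ∂(Measure.pi fun _ => ν) := by
  have h := Measure.infinitePi_map_restrict (μ := fun _ : ι => ν) (I := s)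
  rw [Measure.infinitePi_eq_pi] at h
  rw [← h, lintegral_map hF (Finset.measurable_restrict s)]
  rfl

/-- Moments of a sum of independent `[0, 1]`-valued variables with mean at most `θ`. -/
lemma lintegral_sum_pow_le {ι : Type*} [Fintype ι] {y : X → ℝ} (hy : Measurable y)
    (hy0 : ∀ x, 0 ≤ y x) (hy1 : ∀ x, y x ≤ 1) {θ J : ℝ} (hθ : 1 ≤ θ) (hJ0 : 0 ≤ J) (hJ : J ≤ θ)
    (hmean : (Fintype.card ι : ℝ≥0∞) * ∫⁻ x, ENNReal.ofReal (y x) ∂ν ≤ ENNReal.ofReal θ) (k : ℕ) :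
    ∫⁻ x : ι → X, ENNReal.ofReal (J + ∑ i, y (x i)) ^ k ∂(Measure.pi fun _ => ν) ≤
      ENNReal.ofReal (k.factorial * Real.exp 3 * θ ^ k) := by
  have hθ0 : 0 < θ := by linarith
  have hpt : ∀ x : ι → X, ENNReal.ofReal (J + ∑ i, y (x i)) ^ k ≤
      ENNReal.ofReal (θ ^ k * k.factorial * Real.exp 1) *
        ∏ i, ENNReal.ofReal (1 + 2 / θ * y (x i)) := by
    intro x
    have hS : 0 ≤ ∑ i, y (x i) := Finset.sum_nonneg fun i _ => hy0 _
    have hf : ∀ i, 0 ≤ 1 + 2 / θ * y (x i) := fun i => by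
      have := hy0 (x i)
      positivity
    rw [← ENNReal.ofReal_pow (by positivity), ← ENNReal.ofReal_prod_of_nonneg fun i _ => hf i,
      ← ENNReal.ofReal_mul (by positivity)]
    refine ENNReal.ofReal_le_ofReal ?_
    -- Exponential moments: `t ^ k ≤ k! exp t` with `t = (J + ∑ y) / θ`. The factor `exp 3` collects
    -- `exp 1` from `J ≤ θ` and `exp 2` from the expectation of the product, in which `exp u ≤ 1 + 2
    -- u` on `[0, 1]` was used.
    have h1 := Real.pow_div_factorial_le_exp ((J + ∑ i, y (x i)) / θ) (by positivity) k
    rw [div_le_iff₀ (by positivity), div_pow, div_le_iff₀ (by positivity)] at h1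
    have h2 : Real.exp ((J + ∑ i, y (x i)) / θ) ≤ Real.exp 1 * ∏ i, (1 + 2 / θ * y (x i)) := by
      rw [add_div, Real.exp_add, Finset.sum_div, Real.exp_sum]
      have h3 : J / θ ≤ 1 := (div_le_one hθ0).2 hJ
      gcongr with i
      have h4 : 0 ≤ y (x i) / θ := div_nonneg (hy0 _) hθ0.le
      have h5 : y (x i) / θ ≤ 1 := (div_le_one hθ0).2 ((hy1 _).trans hθ)
      have h6 := Real.abs_exp_sub_one_sub_id_le (x := y (x i) / θ) (by rwa [abs_of_nonneg h4])
      have h7 := (abs_le.1 h6).2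
      have h8 : 2 / θ * y (x i) = 2 * (y (x i) / θ) := by ring
      rw [h8]
      nlinarith
    calc _ ≤ Real.exp ((J + ∑ i, y (x i)) / θ) * k.factorial * θ ^ k := h1
      _ ≤ (Real.exp 1 * ∏ i, (1 + 2 / θ * y (x i))) * k.factorial * θ ^ k := by gcongr
      _ = _ := by ring
  refine (lintegral_mono hpt).trans ?_
  have hm : ∀ i : ι, Measurable fun x : X => ENNReal.ofReal (1 + 2 / θ * y x) := fun _ => by fun_prop
  have hmp : Measurable fun x : ι → X => ∏ i, ENNReal.ofReal (1 + 2 / θ * y (x i)) :=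
    Finset.measurable_prod _ fun i _ => (hm i).comp (measurable_pi_apply i)
  rw [lintegral_const_mul _ hmp, lintegral_pi_prod hm]
  set τ := ∫⁻ x, ENNReal.ofReal (y x) ∂ν with hτ
  have hτ1 : τ ≤ 1 := by
    calc τ ≤ ∫⁻ _, 1 ∂ν := lintegral_mono fun x => by
          rw [← ENNReal.ofReal_one]; exact ENNReal.ofReal_le_ofReal (hy1 x)
      _ = 1 := by simp
  have hτr : τ = ENNReal.ofReal τ.toReal :=
    (ENNReal.ofReal_toReal (ne_top_of_le_ne_top ENNReal.one_ne_top hτ1)).symm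
  have hint : ∫⁻ x, ENNReal.ofReal (1 + 2 / θ * y x) ∂ν = ENNReal.ofReal (1 + 2 / θ * τ.toReal) := by
    have h1 : ∀ x, ENNReal.ofReal (1 + 2 / θ * y x) =
        1 + ENNReal.ofReal (2 / θ) * ENNReal.ofReal (y x) := fun x => by
      rw [ENNReal.ofReal_add zero_le_one (mul_nonneg (by positivity) (hy0 x)),
        ENNReal.ofReal_mul (by positivity), ENNReal.ofReal_one]
    simp only [h1]
    rw [lintegral_add_left measurable_const, lintegral_const_mul _ (by fun_prop),
      ENNReal.ofReal_add zero_le_one (by positivity), ENNReal.ofReal_mul (by positivity), ← hτr]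
    simp [hτ]
  rw [hint, Finset.prod_const, ← ENNReal.ofReal_pow (by positivity),
    ← ENNReal.ofReal_mul (by positivity)]
  refine ENNReal.ofReal_le_ofReal ?_
  have hn : (Fintype.card ι : ℝ) * τ.toReal ≤ θ := by
    have := hmean
    rw [hτr, ← ENNReal.ofReal_natCast, ← ENNReal.ofReal_mul (by positivity)] at this
    exact (ENNReal.ofReal_le_ofReal_iff hθ0.le).1 this
  have h3 : (1 + 2 / θ * τ.toReal) ^ (Finset.univ : Finset ι).card ≤ Real.exp 2 := by
    rw [Finset.card_univ]
    calc _ ≤ Real.exp (2 / θ * τ.toReal) ^ Fintype.card ι := by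
          gcongr
          rw [add_comm]
          exact Real.add_one_le_exp _
      _ = Real.exp (Fintype.card ι * (2 / θ * τ.toReal)) := (Real.exp_nat_mul _ _).symm
      _ ≤ Real.exp 2 := by
          refine Real.exp_le_exp.2 ?_
          calc _ = 2 / θ * (Fintype.card ι * τ.toReal) := by ring
            _ ≤ 2 / θ * θ := by gcongr
            _ = 2 := by field_simp
  calc _ ≤ θ ^ k * k.factorial * Real.exp 1 * Real.exp 2 := by gcongr
    _ = k.factorial * (Real.exp 1 * Real.exp 2) * θ ^ k := by ring
    _ = _ := by rw [← Real.exp_add]; norm_num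

lemma exists_perm_extending {α β : Type*} [Fintype α] [DecidableEq α] (f g : β ↪ α) :
    ∃ σ : Equiv.Perm α, ∀ b, σ (f b) = g b := by
  classical
  let e : {x // x ∈ range f} ≃ {x // x ∈ range g} :=
    (Equiv.ofInjective f f.injective).symm.trans (Equiv.ofInjective g g.injective)
  refine ⟨e.extendSubtype, fun b => ?_⟩
  rw [e.extendSubtype_apply_of_mem _ ⟨b, rfl⟩]
  simp [e]

/-- Expanding the power gives the sum over all maps `Fin k → α`; the injective ones are part of it.
-/
lemma sum_embedding_prod_le {α : Type*} [Fintype α] (k : ℕ) (F : α → ℝ≥0∞) :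
    ∑ e : Fin k ↪ α, ∏ l, F (e l) ≤ (∑ i, F i) ^ k := by
  classical
  rw [Fintype.sum_pow]
  have h := Finset.sum_image (s := (Finset.univ : Finset (Fin k ↪ α)))
    (g := fun e : Fin k ↪ α => (e : Fin k → α)) (f := fun p => ∏ l, F (p l))
    fun _ _ _ _ h => DFunLike.coe_injective h
  rw [← h]
  exact Finset.sum_le_sum_of_subset (Finset.subset_univ _)

variable {H : Type*} [NormedAddCommGroup H] [InnerProductSpace ℝ H] [MeasurableSpace H]
  [BorelSpace H] [SecondCountableTopology H]

lemma measurable_resQ_comp {K : X → H} (hK : Measurable K) (Λ : ℝ) {α Z : Type*} [Fintype α]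
    [MeasurableSpace Z] {a : Z → α → X} {c : Z → X} (ha : Measurable a) (hc : Measurable c) :
    Measurable fun z => resQ Λ (fun i => K (a z i)) (K (c z)) := by
  have h1 : Measurable fun z => (fun i => K (a z i) : α → H) :=
    measurable_pi_lambda _ fun i => hK.comp ((measurable_pi_apply i).comp ha)
  have h2 : Measurable fun z => K (c z) := hK.comp hc
  have h3 := (measurable_resQ (ι := α) (H := H) Λ).comp (h1.prodMk h2)
  simpa only [Function.comp_def] using h3

/-- Moments of the mixed effective dimension `n ∫ ⟪K x₀, (∑ K ⊗ K + Λ)⁻¹ K x₀⟫ ν(dx₀)`: by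
exchangeability, additional sample points may be treated as part of the sample. -/
lemma lintegral_resQ_pow_le {ι : Type*} [Fintype ι] {K : X → H} (hK : Measurable K)
    (hK1 : ∀ x, ‖K x‖ ≤ 1) {Λ : ℝ} (hΛ : 1 ≤ Λ) {J : ℕ} {f : Fin J → H} (hf : Orthonormal ℝ f)
    {θ : ℝ} (hθ : 1 ≤ θ) (hJ : J ≤ θ) (k : ℕ)
    (hmean : ((Fintype.card ι + k : ℕ) : ℝ≥0∞) *
      ∫⁻ x, ENNReal.ofReal (Λ⁻¹ * ‖orthPart f (K x)‖ ^ 2) ∂ν ≤ ENNReal.ofReal θ) :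
    ∫⁻ x : ι → X, (Fintype.card ι * ∫⁻ x₀, resQ Λ (fun i => K (x i)) (K x₀) ∂ν) ^ k
        ∂(Measure.pi fun _ => ν) ≤
      ENNReal.ofReal ((1 + k) ^ k * (k.factorial * Real.exp 3 * θ ^ k)) := by
  classical
  have hΛ0 : 0 < Λ := by linarith
  set n := Fintype.card ι with hn
  let π : Measure (ι ⊕ Fin k → X) := Measure.pi fun _ => ν
  let P : ℝ≥0∞ := ∫⁻ z : ι ⊕ Fin k → X, ∏ l, resQ Λ (fun i => K (z i)) (K (z (Sum.inr l))) ∂π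
  have hme : ∀ e : Fin k → ι ⊕ Fin k, Measurable fun z : ι ⊕ Fin k → X =>
      ∏ l, resQ Λ (fun i => K (z i)) (K (z (e l))) := fun e =>
    Finset.measurable_prod _ fun l _ => measurable_resQ_comp hK Λ measurable_id (measurable_pi_apply _)
  have hmP := hme Sum.inr
  -- The `k`-th power of the integral over `x₀` is an integral over `k` independent fresh points.
  -- These are then added to the sample inside `resQ`, at a cost of `1 + k` for each factor.
  have h1 : ∫⁻ x : ι → X, (∫⁻ x₀, resQ Λ (fun i => K (x i)) (K x₀) ∂ν) ^ k
        ∂(Measure.pi fun _ => ν) ≤ ENNReal.ofReal (1 + k) ^ k * P := by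
    have e1 : ∀ x : ι → X, (∫⁻ x₀, resQ Λ (fun i => K (x i)) (K x₀) ∂ν) ^ k =
        ∫⁻ x' : Fin k → X, ∏ l, resQ Λ (fun i => K (x i)) (K (x' l)) ∂(Measure.pi fun _ => ν) := by
      intro x
      have hm : Measurable fun y : X => resQ Λ (fun i => K (x i)) (K y) :=
        measurable_resQ_comp hK Λ (measurable_const (a := x)) measurable_id
      rw [lintegral_pi_prod (ν := ν) (F := fun (_ : Fin k) y => resQ Λ (fun i => K (x i)) (K y))
        fun _ => hm]
      simp
    simp only [e1]
    have hm : Measurable fun z : (ι → X) × (Fin k → X) =>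
        ∏ l, resQ Λ (fun i => K (z.1 i)) (K (z.2 l)) :=
      Finset.measurable_prod _ fun l _ => measurable_resQ_comp hK Λ measurable_fst ((measurable_pi_apply l).comp measurable_snd)
    rw [← lintegral_prod _ hm.aemeasurable,
      ← (measurePreserving_sumPiEquivProdPi (X := fun _ : ι ⊕ Fin k => X) (fun _ => ν)).lintegral_comp hm,
      ← lintegral_const_mul _ hmP]
    refine lintegral_mono fun z => ?_
    have e2 : ENNReal.ofReal (1 + k) ^ k = ∏ l : Fin k, ENNReal.ofReal (1 + k) := by simp
    rw [e2, ← Finset.prod_mul_distrib]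
    refine Finset.prod_le_prod' fun l _ => ?_
    have := resQ_inl_le hΛ (fun i => K (z i)) (fun i => hK1 _) (K (z (Sum.inr l)))
    rw [Fintype.card_fin] at this
    exact this
  -- The points are now exchangeable, so the `k` distinguished ones may sit at any `k` distinct
  -- positions.
  have hperm : ∀ e : Fin k ↪ ι ⊕ Fin k,
      ∫⁻ z : ι ⊕ Fin k → X, ∏ l, resQ Λ (fun i => K (z i)) (K (z (e l))) ∂π = P := by
    intro e
    obtain ⟨σ, hσ⟩ := exists_perm_extending (Function.Embedding.inr : Fin k ↪ ι ⊕ Fin k) e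
    have hmp := measurePreserving_piCongrLeft (α := fun _ : ι ⊕ Fin k => X) (fun _ => ν) σ.symm
    have h2 := hmp.lintegral_comp hmP
    rw [show P = _ from h2.symm]
    refine lintegral_congr fun z => Finset.prod_congr rfl fun l _ => ?_
    have e3 : ∀ i, MeasurableEquiv.piCongrLeft (fun _ : ι ⊕ Fin k => X) σ.symm z i = z (σ i) := by
      intro i
      have := MeasurableEquiv.piCongrLeft_apply_apply (β := fun _ : ι ⊕ Fin k => X) σ.symm z (σ i)
      simpa using this
    simp only [e3]
    have hσl : σ (Sum.inr l) = e l := hσ l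
    rw [hσl]
    exact (resQ_equiv σ (fun i => K (z i)) _).symm
  have h2 : (n : ℝ≥0∞) ^ k * P ≤ ENNReal.ofReal (k.factorial * Real.exp 3 * θ ^ k) := by
    -- There are `(n + k) ⋯ (n + 1) ≥ n ^ k` such placements; averaging over them turns the product
    -- into the `k`-th power of the sum of all leverage scores.
    have hcard : n ^ k ≤ Fintype.card (Fin k ↪ ι ⊕ Fin k) := by
      rw [Fintype.card_embedding_eq, Fintype.card_sum, Fintype.card_fin]
      refine le_trans (Nat.pow_le_pow_left (by omega) k) (Nat.pow_sub_le_descFactorial _ _)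
    calc (n : ℝ≥0∞) ^ k * P ≤ (Fintype.card (Fin k ↪ ι ⊕ Fin k) : ℝ≥0∞) * P := by
          gcongr
          exact_mod_cast hcard
      _ = ∑ e : Fin k ↪ ι ⊕ Fin k,
          ∫⁻ z : ι ⊕ Fin k → X, ∏ l, resQ Λ (fun i => K (z i)) (K (z (e l))) ∂π := by
          simp only [hperm]; simp
      _ = ∫⁻ z : ι ⊕ Fin k → X, ∑ e : Fin k ↪ ι ⊕ Fin k,
            ∏ l, resQ Λ (fun i => K (z i)) (K (z (e l))) ∂π := by
          rw [lintegral_finsetSum]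
          exact fun e _ => hme e
      _ ≤ ∫⁻ z : ι ⊕ Fin k → X,
            ENNReal.ofReal (J + ∑ i, Λ⁻¹ * ‖orthPart f (K (z i))‖ ^ 2) ^ k ∂π := by
          refine lintegral_mono fun z => ?_
          refine (sum_embedding_prod_le k fun i => resQ Λ (fun i => K (z i)) (K (z i))).trans ?_
          rw [← Finset.mul_sum]
          gcongr
          exact sum_resQ_le hf hΛ0 _
      _ ≤ _ := by
          refine lintegral_sum_pow_le (y := fun x => Λ⁻¹ * ‖orthPart f (K x)‖ ^ 2) ?_ ?_ ?_ hθ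
            (Nat.cast_nonneg J) hJ ?_ k
          · unfold orthPart
            fun_prop
          · intro x; positivity
          · intro x
            have h3 : ‖orthPart f (K x)‖ ^ 2 ≤ 1 := by
              rw [norm_sq_orthPart hf]
              have : ‖K x‖ ^ 2 ≤ 1 := pow_le_one₀ (norm_nonneg _) (hK1 x)
              have : 0 ≤ ∑ j, ⟪f j, K x⟫_ℝ ^ 2 := by positivity
              linarith
            have h4 : Λ⁻¹ ≤ 1 := inv_le_one_of_one_le₀ hΛ
            exact mul_le_one₀ h4 (sq_nonneg _) h3
          · rw [Fintype.card_sum, Fintype.card_fin]; exact hmean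
  simp only [mul_pow]
  rw [lintegral_const_mul _ (Measurable.pow_const (by
    exact Measurable.lintegral_prod_right' (f := fun z : (ι → X) × X =>
      resQ Λ (fun i => K (z.1 i)) (K z.2)) (measurable_resQ_comp hK Λ measurable_fst measurable_snd)) k)]
  calc _ ≤ (n : ℝ≥0∞) ^ k * (ENNReal.ofReal (1 + k) ^ k * P) := by gcongr
    _ = ENNReal.ofReal (1 + k) ^ k * ((n : ℝ≥0∞) ^ k * P) := by ring
    _ ≤ ENNReal.ofReal (1 + k) ^ k * ENNReal.ofReal (k.factorial * Real.exp 3 * θ ^ k) := by gcongr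
    _ = _ := by
      rw [← ENNReal.ofReal_pow (by positivity), ← ENNReal.ofReal_mul (by positivity)]

end Sampling


/-! ### The population covariance operator and the tail of its trace. -/

section Covariance

lemma orthonormal_countable {E : Type*} [NormedAddCommGroup E] [InnerProductSpace ℝ E]
    [TopologicalSpace.SeparableSpace E] {ι : Type*} {v : ι → E} (hv : Orthonormal ℝ v) :
    Countable ι := by
  refine Pairwise.countable_of_isOpen_disjoint (s := fun i => Metric.ball (v i) (1 / 2)) ?_
    (fun i => Metric.isOpen_ball) fun i => Metric.nonempty_ball.2 (by norm_num)
  intro i j hij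
  refine Metric.ball_disjoint_ball ?_
  rw [dist_eq_norm]
  have h1 : ‖v i - v j‖ ^ 2 = 2 := by
    rw [@norm_sub_sq ℝ, hv.1 i, hv.1 j, hv.2 hij]; norm_num
  nlinarith [norm_nonneg (v i - v j)]

variable {X : Type*} [MeasurableSpace X]
  {H : Type*} [NormedAddCommGroup H] [InnerProductSpace ℝ H] [CompleteSpace H]
  [TopologicalSpace.SeparableSpace H]

/-- Pettis: in a separable space, `K` is the pointwise limit of its expansions in a countable
Hilbert basis. -/
lemma measurable_of_inner [MeasurableSpace H] [BorelSpace H] {K : X → H}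
    (hK : ∀ f : H, Measurable fun x => ⟪f, K x⟫_ℝ) : Measurable K := by
  have : SecondCountableTopology H := UniformSpace.secondCountable_of_separable H
  obtain ⟨w, b, -⟩ := exists_hilbertBasis ℝ H
  have : Countable w := orthonormal_countable b.orthonormal
  refine measurable_of_tendsto_metrizable' atTop
    (f := fun (F : Finset w) x => ∑ i ∈ F, ⟪b i, K x⟫_ℝ • b i) (fun F => ?_) ?_
  · exact Finset.measurable_sum _ fun i _ => (hK (b i)).smul_const _
  · rw [tendsto_pi_nhds]
    intro x
    have := b.hasSum_repr (K x)
    simp only [b.repr_apply_apply] at this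
    exact this

variable [RKHS ℝ H X ℝ]

/-- The normalised kernel section `κ⁻¹ K_x`. -/
noncomputable def nkSec (H : Type*) [NormedAddCommGroup H] [InnerProductSpace ℝ H]
    [CompleteSpace H] [RKHS ℝ H X ℝ] (κ : ℝ) (x : X) : H := κ⁻¹ • kerSec H x

omit [MeasurableSpace X] [TopologicalSpace.SeparableSpace H] in
lemma inner_kerSec (x : X) (f : H) : ⟪kerSec H x, f⟫_ℝ = f x := by
  rw [kerSec, RKHS.kerFun_inner]
  simp

-- The sup-norm bound applied to `K_x` itself at `x` reads `‖K_x‖ ^ 2 ≤ κ ‖K_x‖`.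
omit [MeasurableSpace X] [TopologicalSpace.SeparableSpace H] in
lemma norm_nkSec_le {κ : ℝ} (hκ : 0 < κ) (hbdd : ∀ (f : H) (x : X), |f x| ≤ κ * ‖f‖) (x : X) :
    ‖nkSec H κ x‖ ≤ 1 := by
  have h1 := hbdd (kerSec H x) x
  rw [← inner_kerSec, real_inner_self_eq_norm_sq, abs_of_nonneg (sq_nonneg _)] at h1
  have h2 : ‖kerSec H x‖ ≤ κ := by
    by_contra! h
    nlinarith [norm_nonneg (kerSec H x)]
  rw [nkSec, norm_smul, norm_inv, Real.norm_of_nonneg hκ.le, inv_mul_le_iff₀ hκ]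
  linarith

lemma measurable_nkSec [MeasurableSpace H] [BorelSpace H]
    (hmeas : ∀ f : H, Measurable (fun x : X => f x)) (κ : ℝ) : Measurable (nkSec (X := X) H κ) := by
  refine measurable_of_inner fun f => ?_
  have : (fun x : X => ⟪f, nkSec H κ x⟫_ℝ) = fun x => κ⁻¹ * f x := by
    ext x
    rw [nkSec, real_inner_smul_right, real_inner_comm, inner_kerSec]
  rw [this]
  exact (hmeas f).const_mul _

variable {ν : Measure X} [IsProbabilityMeasure ν]

lemma inner_covOp (hmeas : ∀ f : H, Measurable (fun x : X => f x)) {κ : ℝ} (hκ : 0 < κ)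
    (hbdd : ∀ (f : H) (x : X), |f x| ≤ κ * ‖f‖) (u v : H) :
    ⟪covOp H κ ν u, v⟫_ℝ = ∫ x, ⟪nkSec H κ x, u⟫_ℝ * ⟪nkSec H κ x, v⟫_ℝ ∂ν := by
  borelize H
  have hsc : SecondCountableTopology H := UniformSpace.secondCountable_of_separable H
  have hm := measurable_nkSec (X := X) (H := H) hmeas κ
  have hsm : StronglyMeasurable (nkSec (X := X) H κ) := hm.stronglyMeasurable
  have hint : Integrable (fun x => InnerProductSpace.rankOne ℝ (nkSec H κ x) (nkSec H κ x)) ν := by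
    refine Integrable.of_bound (C := 1) ?_ (ae_of_all _ fun x => ?_)
    · have hc : Continuous fun p : H => InnerProductSpace.rankOne ℝ p p :=
        ((InnerProductSpace.rankOne ℝ : H →L[ℝ] H →L⋆[ℝ] H →L[ℝ] H).continuous).clm_apply
          continuous_id
      exact (hc.comp_stronglyMeasurable hsm).aestronglyMeasurable
    · rw [InnerProductSpace.norm_rankOne]
      have := norm_nkSec_le hκ hbdd x
      exact mul_le_one₀ this (norm_nonneg _) this
  have hcov : covOp H κ ν = ∫ x, InnerProductSpace.rankOne ℝ (nkSec H κ x) (nkSec H κ x) ∂ν := by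
    rw [covOp, ← integral_smul]
    refine integral_congr_ae (ae_of_all _ fun x => ?_)
    ext f
    simp only [smul_apply, InnerProductSpace.rankOne_apply, nkSec,
      real_inner_smul_left, smul_smul]
    congr 1
    rw [sq, mul_inv]; ring_nf
  rw [hcov]
  let L : (H →L[ℝ] H) →L[ℝ] ℝ := (innerSL ℝ v).comp (ContinuousLinearMap.apply ℝ H u)
  have h1 := L.integral_comp_comm hint
  have h2 : ∀ B : H →L[ℝ] H, L B = ⟪B u, v⟫_ℝ := fun B => by
    simp [L, real_inner_comm]
  simp only [h2, InnerProductSpace.rankOne_apply, real_inner_smul_left] at h1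
  exact h1.symm

lemma covOp_symmetric (hmeas : ∀ f : H, Measurable (fun x : X => f x)) {κ : ℝ} (hκ : 0 < κ)
    (hbdd : ∀ (f : H) (x : X), |f x| ≤ κ * ‖f‖) (u v : H) :
    ⟪covOp H κ ν u, v⟫_ℝ = ⟪u, covOp H κ ν v⟫_ℝ := by
  rw [real_inner_comm (covOp H κ ν v) u, inner_covOp hmeas hκ hbdd, inner_covOp hmeas hκ hbdd]
  simp only [mul_comm]

lemma inner_covOp_self (hmeas : ∀ f : H, Measurable (fun x : X => f x)) {κ : ℝ} (hκ : 0 < κ)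
    (hbdd : ∀ (f : H) (x : X), |f x| ≤ κ * ‖f‖) (u : H) :
    0 ≤ ⟪covOp H κ ν u, u⟫_ℝ ∧
    ENNReal.ofReal ⟪covOp H κ ν u, u⟫_ℝ = ∫⁻ x, ENNReal.ofReal (⟪nkSec H κ x, u⟫_ℝ ^ 2) ∂ν := by
  have h1 := inner_covOp (ν := ν) hmeas hκ hbdd u u
  simp only [← sq] at h1
  have hm : Measurable fun x : X => ⟪nkSec H κ x, u⟫_ℝ := by
    simp only [nkSec, real_inner_smul_left, inner_kerSec]
    exact (hmeas u).const_mul _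
  refine ⟨h1 ▸ integral_nonneg fun x => sq_nonneg _, ?_⟩
  rw [h1, ofReal_integral_eq_lintegral_ofReal _ (ae_of_all _ fun x => sq_nonneg _)]
  refine Integrable.of_bound (C := ‖u‖ ^ 2) (hm.pow_const 2).aestronglyMeasurable
    (ae_of_all _ fun x => ?_)
  rw [norm_pow, Real.norm_eq_abs]
  have h2 : |⟪nkSec H κ x, u⟫_ℝ| ≤ ‖u‖ :=
    (abs_real_inner_le_norm _ _).trans
      (mul_le_of_le_one_left (norm_nonneg _) (norm_nkSec_le hκ hbdd x))
  gcongr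

omit [CompleteSpace H] [TopologicalSpace.SeparableSpace H] in
lemma ofReal_norm_sq_eq_tsum {w : Set H} (b : HilbertBasis w ℝ H) (x : H) :
    ENNReal.ofReal (‖x‖ ^ 2) = ∑' i, ENNReal.ofReal (⟪b i, x⟫_ℝ ^ 2) := by
  have h := b.hasSum_inner_mul_inner x x
  rw [real_inner_self_eq_norm_sq] at h
  have h2 : (fun i => ⟪x, b i⟫_ℝ * ⟪b i, x⟫_ℝ) = fun i => ⟪b i, x⟫_ℝ ^ 2 := by
    ext i
    rw [real_inner_comm]; ring
  rw [h2] at h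
  rw [← h.tsum_eq, ENNReal.ofReal_tsum_of_nonneg (fun i => sq_nonneg _) h.summable]

omit [CompleteSpace H] [TopologicalSpace.SeparableSpace H] in
lemma inner_orthPart_comm {J : ℕ} (f : Fin J → H) (x y : H) :
    ⟪orthPart f x, y⟫_ℝ = ⟪x, orthPart f y⟫_ℝ := by
  simp only [orthPart, inner_sub_left, inner_sub_right, sum_inner, inner_sum, real_inner_smul_left,
    real_inner_smul_right]
  congr 1
  refine Finset.sum_congr rfl fun j _ => ?_
  rw [real_inner_comm (f j) x]; ring

/-- Projecting away leading eigenvectors leaves the tail of the trace. -/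
lemma lintegral_norm_sq_orthPart_le (hmeas : ∀ f : H, Measurable (fun x : X => f x)) {κ : ℝ}
    (hκ : 0 < κ) (hbdd : ∀ (f : H) (x : X), |f x| ≤ κ * ‖f‖) {μ : ℕ → ℝ}
    (hμ : IsEigenvalueSeq (covOp H κ ν) μ) (L : ℕ) :
    ∃ J : ℕ, J ≤ L ∧ ∃ f : Fin J → H, Orthonormal ℝ f ∧
      ∫⁻ x, ENNReal.ofReal (‖orthPart f (nkSec H κ x)‖ ^ 2) ∂ν ≤
        ∑' j, if L ≤ j then ENNReal.ofReal (μ j) else 0 := by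
  classical
  obtain ⟨-, hμ0, e, he, hsum⟩ := hμ
  obtain ⟨w, b, -⟩ := exists_hilbertBasis ℝ H
  have : Countable w := orthonormal_countable b.orthonormal
  let F : Finset ℕ := (Finset.range L).filter fun j => 0 < μ j
  -- The removed eigenvectors are those among the first `L` with positive eigenvalue. Only these are
  -- known to be orthonormal, so their number may be less than `L`.
  let em : Fin F.card → {j : ℕ // 0 < μ j} := fun a =>
    ⟨F.equivFin.symm a, (Finset.mem_filter.1 (F.equivFin.symm a).2).2⟩
  have hem : Function.Injective em := fun a a' h => by
    have h1 : ((F.equivFin.symm a : F) : ℕ) = F.equivFin.symm a' := 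
      congrArg (fun p : {j : ℕ // 0 < μ j} => (p : ℕ)) h
    exact F.equivFin.symm.injective (Subtype.ext h1)
  have hf : Orthonormal ℝ fun a => e (em a) := he.comp em hem
  refine ⟨F.card, (Finset.card_filter_le _ _).trans (by simp), fun a => e (em a), hf, ?_⟩
  set f : Fin F.card → H := fun a => e (em a) with hfdef
  have hm : ∀ u : H, Measurable fun x : X => ⟪nkSec H κ x, u⟫_ℝ := fun u => by
    simp only [nkSec, real_inner_smul_left, inner_kerSec]
    exact (hmeas u).const_mul _
  have hop : ∀ x i, ⟪b i, orthPart f (nkSec H κ x)⟫_ℝ = ⟪nkSec H κ x, orthPart f (b i)⟫_ℝ :=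
    fun x i => by rw [← inner_orthPart_comm, real_inner_comm]
  have hquad : ∀ u, ENNReal.ofReal ⟪covOp H κ ν u, u⟫_ℝ =
      ∑' j, ENNReal.ofReal (μ j) * ENNReal.ofReal (⟪e j, u⟫_ℝ ^ 2) := fun u => by
    have h1 := (hsum u).mapL (innerSL ℝ u)
    have h2 : (fun j => innerSL ℝ u ((μ j * ⟪e j, u⟫_ℝ) • e j)) =
        fun j => μ j * ⟪e j, u⟫_ℝ ^ 2 := by
      ext j
      rw [innerSL_apply_apply, real_inner_smul_right, real_inner_comm]; ring
    rw [h2, innerSL_apply_apply, real_inner_comm] at h1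
    rw [← h1.tsum_eq, ENNReal.ofReal_tsum_of_nonneg
      (fun j => mul_nonneg (hμ0 j) (sq_nonneg _)) h1.summable]
    exact tsum_congr fun j => ENNReal.ofReal_mul (hμ0 j)
  -- With `Q` the projection `orthPart f`, the left side is the trace of `Q T̄ Q`. It is computed
  -- once in a Hilbert basis and once through the eigenexpansion of `T̄`, giving `∑ μ j ‖Q e j‖ ^
  -- 2`, whose terms with `j < L` vanish.
  calc ∫⁻ x, ENNReal.ofReal (‖orthPart f (nkSec H κ x)‖ ^ 2) ∂ν
      = ∫⁻ x, ∑' i, ENNReal.ofReal (⟪nkSec H κ x, orthPart f (b i)⟫_ℝ ^ 2) ∂ν := by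
        refine lintegral_congr fun x => ?_
        rw [ofReal_norm_sq_eq_tsum b]
        exact tsum_congr fun i => by rw [hop]
    _ = ∑' i, ∫⁻ x, ENNReal.ofReal (⟪nkSec H κ x, orthPart f (b i)⟫_ℝ ^ 2) ∂ν :=
        lintegral_tsum fun i => ((hm _).pow_const 2).ennreal_ofReal.aemeasurable
    _ = ∑' i, ∑' j, ENNReal.ofReal (μ j) * ENNReal.ofReal (⟪e j, orthPart f (b i)⟫_ℝ ^ 2) :=
        tsum_congr fun i => by rw [← (inner_covOp_self hmeas hκ hbdd _).2, hquad]
    _ = ∑' j, ENNReal.ofReal (μ j) * ENNReal.ofReal (‖orthPart f (e j)‖ ^ 2) := by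
        rw [ENNReal.tsum_comm]
        refine tsum_congr fun j => ?_
        rw [ENNReal.tsum_mul_left, ofReal_norm_sq_eq_tsum b]
        congr 1
        exact tsum_congr fun i => by rw [← inner_orthPart_comm, real_inner_comm]
    _ ≤ _ := by
        refine ENNReal.tsum_le_tsum fun j => ?_
        rcases (hμ0 j).eq_or_lt with h0 | hpos
        · simp [← h0]
        have hn : ‖orthPart f (e j)‖ ^ 2 = 1 - ∑ a, ⟪f a, e j⟫_ℝ ^ 2 := by
          rw [norm_sq_orthPart hf, show ‖e j‖ = 1 from he.1 ⟨j, hpos⟩]; norm_num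
        have hnn : 0 ≤ ∑ a, ⟪f a, e j⟫_ℝ ^ 2 := by positivity
        split_ifs with hL
        · refine mul_le_of_le_one_right' ?_
          rw [← ENNReal.ofReal_one]
          exact ENNReal.ofReal_le_ofReal (by linarith)
        · have hjF : j ∈ F := Finset.mem_filter.2 ⟨Finset.mem_range.2 (not_le.1 hL), hpos⟩
          have h1 : f (F.equivFin ⟨j, hjF⟩) = e j := by simp [f, em]
          have h2 : 1 ≤ ∑ a, ⟪f a, e j⟫_ℝ ^ 2 := by
            refine le_trans (le_of_eq ?_) (Finset.single_le_sum (f := fun a => ⟪f a, e j⟫_ℝ ^ 2)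
              (fun a _ => sq_nonneg _) (Finset.mem_univ (F.equivFin ⟨j, hjF⟩)))
            simp only [h1]
            rw [real_inner_self_eq_norm_sq, show ‖e j‖ = 1 from he.1 ⟨j, hpos⟩]; norm_num
          rw [ENNReal.ofReal_of_nonpos (p := ‖orthPart f (e j)‖ ^ 2) (by linarith), mul_zero]

end Covariance

/-! ### Tail sums of polynomially decaying eigenvalues. -/

section Tail

/-- The comparison of `(x + 1) ^ (-b)` with the integral of `t ^ (-b)` over `[x, x + 1]`, derived
from `1 - 1 / y ≤ log y` and `1 + y ≤ exp y`. Summed over `x`, it telescopes. -/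
lemma rpow_neg_le_sub {b : ℝ} (hb : 1 < b) {x : ℝ} (hx : 0 < x) :
    (b - 1) * (x + 1) ^ (-b) ≤ x ^ (1 - b) - (x + 1) ^ (1 - b) := by
  have hx1 : 0 < x + 1 := by linarith
  have h1 : (x + 1) ^ (1 - b) = (x + 1) ^ (-b) * (x + 1) := by
    rw [← Real.rpow_add_one hx1.ne']; ring_nf
  have h2 : x ^ (1 - b) = (x + 1) ^ (1 - b) * ((x + 1) / x) ^ (b - 1) := by
    rw [Real.div_rpow hx1.le hx.le, ← mul_div_assoc, ← Real.rpow_add hx1]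
    rw [show 1 - b + (b - 1) = 0 by ring, Real.rpow_zero, show 1 - b = -(b - 1) by ring,
      Real.rpow_neg hx.le, one_div]
  have h3 : 1 + (b - 1) * (1 / (x + 1)) ≤ ((x + 1) / x) ^ (b - 1) := by
    have hq : 0 < (x + 1) / x := by positivity
    have h4 := Real.one_sub_inv_le_log_of_pos hq
    have h5 : 1 - ((x + 1) / x)⁻¹ = 1 / (x + 1) := by field_simp; ring
    rw [h5] at h4
    rw [Real.rpow_def_of_pos hq]
    have h6 := Real.add_one_le_exp (Real.log ((x + 1) / x) * (b - 1))
    nlinarith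
  have h7 := Real.rpow_pos_of_pos hx1 (1 - b)
  have h8 := mul_le_mul_of_nonneg_left h3 h7.le
  rw [← h2] at h8
  have h9 : (x + 1) ^ (1 - b) * (1 + (b - 1) * (1 / (x + 1))) =
      (x + 1) ^ (1 - b) + (b - 1) * (x + 1) ^ (-b) := by
    rw [mul_add, h1]; field_simp
  linarith

lemma tsum_tail_le {b β : ℝ} (hb : 1 < b) (hβ : 0 < β) {μ : ℕ → ℝ}
    (hμ : ∀ j, μ j ≤ β / ((j : ℝ) + 1) ^ b) {L : ℕ} (hL : 1 ≤ L) :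
    ∑' j, (if L ≤ j then ENNReal.ofReal (μ j) else 0) ≤
      ENNReal.ofReal (β / (b - 1) * (L : ℝ) ^ (1 - b)) := by
  have hb1 : 0 < b - 1 := by linarith
  have hL0 : (0 : ℝ) < L := by exact_mod_cast hL
  have key : ∀ N : ℕ, ∑ j ∈ Finset.range N, (if L ≤ j then (b - 1) * ((j : ℝ) + 1) ^ (-b) else 0) ≤
      (L : ℝ) ^ (1 - b) - (max L N : ℕ) ^ (1 - b) := by
    intro N
    induction N with
    | zero => simp
    | succ N ih =>
      rw [Finset.sum_range_succ]
      split_ifs with h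
      · have h1 := rpow_neg_le_sub hb (x := N) (by exact_mod_cast (by omega : 0 < N))
        rw [max_eq_right h] at ih
        rw [max_eq_right (by omega)]
        push_cast
        linarith
      · rw [max_eq_left (by omega)] at ih ⊢
        linarith
  refine ENNReal.tsum_le_of_sum_range_le fun N => ?_
  have h1 : ∀ j : ℕ, (if L ≤ j then ENNReal.ofReal (μ j) else 0) ≤
      ENNReal.ofReal (β / (b - 1) * if L ≤ j then (b - 1) * ((j : ℝ) + 1) ^ (-b) else 0) := by
    intro j
    split_ifs
    · refine ENNReal.ofReal_le_ofReal ((hμ j).trans (le_of_eq ?_))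
      rw [Real.rpow_neg (by positivity)]
      field_simp
    · exact zero_le
  refine (Finset.sum_le_sum fun j _ => h1 j).trans ?_
  have hnn : ∀ j : ℕ, 0 ≤ if L ≤ j then (b - 1) * ((j : ℝ) + 1) ^ (-b) else 0 := fun j => by
    split_ifs <;> positivity
  rw [← ENNReal.ofReal_sum_of_nonneg fun j _ => mul_nonneg (by positivity) (hnn j),
    ← Finset.mul_sum]
  refine ENNReal.ofReal_le_ofReal (mul_le_mul_of_nonneg_left ((key N).trans ?_) (by positivity))
  have : 0 ≤ ((max L N : ℕ) : ℝ) ^ (1 - b) := by positivity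
  linarith

end Tail


/-! ### Conditioning on the inputs. -/

section Conditioning

/-- For arbitrary `F` only this half of Tonelli holds, via a measurable minorant with the same
integral. It spares any proof that the estimators, defined through `opFun`, are measurable in the
sample. -/
lemma lintegral_prod_le_iterated {α β : Type*} [MeasurableSpace α] [MeasurableSpace β]
    {μ : Measure α} {ν : Measure β} [SFinite ν] (F : α × β → ℝ≥0∞) :
    ∫⁻ z, F z ∂(μ.prod ν) ≤ ∫⁻ x, ∫⁻ y, F (x, y) ∂ν ∂μ := by
  obtain ⟨G, hG, hle, heq⟩ := exists_measurable_le_lintegral_eq (μ := μ.prod ν) F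
  rw [heq, lintegral_prod _ hG.aemeasurable]
  exact lintegral_mono fun x => lintegral_mono fun y => hle (x, y)

variable {X : Type*} [MeasurableSpace X] {ν : Measure X} [IsProbabilityMeasure ν]
  {η : Kernel X ℝ} [IsMarkovKernel η] {h : X → unitInterval → ℝ}

lemma compProd_eq_map (hm : Measurable (Function.uncurry h))
    (hh : ∀ a, (volume : Measure unitInterval).map (h a) = η a) :
    ν ⊗ₘ η = (ν.prod (volume : Measure unitInterval)).map (fun p => (p.1, h p.1 p.2)) := by
  ext s hs
  have hm' : Measurable (fun p : X × unitInterval => (p.1, h p.1 p.2)) := measurable_fst.prodMk hm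
  rw [Measure.map_apply hm' hs, Measure.compProd_apply hs, Measure.prod_apply (hm' hs)]
  refine lintegral_congr fun x => ?_
  rw [← hh, Measure.map_apply (by fun_prop) (measurable_prodMk_left hs)]
  rfl

/-- An i.i.d. sample from `ν ⊗ η` may be generated by first drawing the inputs and then, given
these, independent uniform variables. -/
lemma lintegral_pi_compProd_le (hm : Measurable (Function.uncurry h))
    (hh : ∀ a, (volume : Measure unitInterval).map (h a) = η a) {n : ℕ}
    (F : (Fin n → X × ℝ) → ℝ≥0∞) :
    ∫⁻ z, F z ∂(Measure.pi fun _ => ν ⊗ₘ η) ≤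
      ∫⁻ x : Fin n → X, ∫⁻ u : Fin n → unitInterval, F (fun i => (x i, h (x i) (u i)))
        ∂(Measure.pi fun _ => volume) ∂(Measure.pi fun _ => ν) := by
  have hm' : Measurable (fun p : X × unitInterval => (p.1, h p.1 p.2)) := measurable_fst.prodMk hm
  have h1 : (Measure.pi fun _ : Fin n => ν ⊗ₘ η) =
      (Measure.pi fun _ : Fin n => ν.prod (volume : Measure unitInterval)).map
        (fun p i => ((p i).1, h (p i).1 (p i).2)) := by
    have hp : IsProbabilityMeasure
        ((ν.prod (volume : Measure unitInterval)).map (fun p => (p.1, h p.1 p.2))) :=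
      Measure.isProbabilityMeasure_map hm'.aemeasurable
    rw [Measure.pi_map_pi (f := fun _ (p : X × unitInterval) => (p.1, h p.1 p.2))
      fun _ => hm'.aemeasurable, compProd_eq_map hm hh]
  have hmp := (measurePreserving_arrowProdEquivProdArrow X unitInterval (Fin n) (fun _ => ν)
    (fun _ => volume)).symm
  rw [h1]
  -- Without measurability of `F`, pulling back along the map still gives an upper bound.
  refine (lintegral_map_le _ _).trans ?_
  rw [← hmp.map_eq, MeasureTheory.lintegral_map_equiv]
  exact lintegral_prod_le_iterated _

variable {H : Type*} [NormedAddCommGroup H] [InnerProductSpace ℝ H] {A : H →L[ℝ] H}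

omit [IsMarkovKernel η] in
/-- Conditional moment bound, given the inputs. -/
lemma lintegral_quad_noise_le (hA : ∀ u v, ⟪A u, v⟫_ℝ = ⟪u, A v⟫_ℝ) (hpos : ∀ u, 0 ≤ ⟪A u, u⟫_ℝ)
    (hm : Measurable (Function.uncurry h))
    (hh : ∀ a, (volume : Measure unitInterval).map (h a) = η a) {n : ℕ} {x : Fin n → X}
    {f : Fin n → ℝ} {K : ℕ} (hK : 1 ≤ K) {c σ M W : ℝ} (hc : 0 ≤ c) (hW0 : 0 ≤ W)
    (hint : ∀ i, Integrable (fun y => y) (η (x i))) (hmean : ∀ i, ∫ y, y ∂(η (x i)) = f i)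
    (hmom : ∀ i, ∀ l, l + 1 ≤ K →
      ∫⁻ y, ‖y - f i‖ₑ ^ (2 * (l + 1)) ∂(η (x i)) ≤ ENNReal.ofReal (c * σ ^ 2 * (M ^ 2) ^ l))
    {w : Fin n → H} (hW : ∀ i, ⟪A (w i), w i⟫_ℝ ≤ W) :
    ∫⁻ u : Fin n → unitInterval,
      ENNReal.ofReal ⟪A (∑ i, (h (x i) (u i) - f i) • w i), ∑ i, (h (x i) (u i) - f i) • w i⟫_ℝ ^ K
        ∂(Measure.pi fun _ => volume) ≤
      ENNReal.ofReal (momentConst c K * (σ ^ 2 * ∑ i, ⟪A (w i), w i⟫_ℝ + M ^ 2 * W) ^ K) := by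
  set P : Measure (Fin n → unitInterval) := Measure.pi fun _ => volume
  let ε : Fin n → (Fin n → unitInterval) → ℝ := fun i u => h (x i) (u i) - f i
  have hmx : ∀ i, Measurable (h (x i)) := fun i => hm.comp measurable_prodMk_left
  have hmp : ∀ i, MeasurePreserving (fun u : Fin n → unitInterval => h (x i) (u i)) P (η (x i)) :=
    fun i => MeasurePreserving.comp ⟨hmx i, hh _⟩
      (measurePreserving_eval (fun _ : Fin n => (volume : Measure unitInterval)) i)
  have hmeas : ∀ i, Measurable (ε i) := fun i => (hmp i).measurable.sub_const _
  have hind : iIndepFun ε P :=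
    iIndepFun_pi (X := fun i t => h (x i) t - f i) fun i => ((hmx i).sub_const _).aemeasurable
  have hl : ∀ i p, ∫⁻ u, ‖ε i u‖ₑ ^ p ∂P = ∫⁻ y, ‖y - f i‖ₑ ^ p ∂(η (x i)) := fun i p =>
    (hmp i).lintegral_comp (f := fun y => ‖y - f i‖ₑ ^ p) (by fun_prop)
  have hLp : ∀ i, MemLp (ε i) ((2 * K : ℕ) : ℝ≥0∞) P := fun i => by
    refine ⟨(hmeas i).aestronglyMeasurable, ?_⟩
    have h0 : ((2 * K : ℕ) : ℝ≥0∞) ≠ 0 := by exact_mod_cast (by omega : 2 * K ≠ 0)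
    rw [eLpNorm_lt_top_iff_lintegral_rpow_enorm_lt_top h0 (ENNReal.natCast_ne_top _),
      ENNReal.toReal_natCast]
    simp only [ENNReal.rpow_natCast]
    rw [hl]
    have h1 := hmom i (K - 1) (by omega)
    rw [show K - 1 + 1 = K by omega] at h1
    exact h1.trans_lt ENNReal.ofReal_lt_top
  have hmean' : ∀ i, ∫ u, ε i u ∂P = 0 := fun i => by
    have h1 : Integrable (fun u : Fin n → unitInterval => h (x i) (u i)) P :=
      (hmp i).integrable_comp_of_integrable (hint i)
    have h2 : ∫ u : Fin n → unitInterval, h (x i) (u i) ∂P = f i := by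
      rw [← hmean i, ← (hmp i).map_eq, integral_map (hmp i).measurable.aemeasurable
        (by fun_prop)]
    simp only [ε]
    rw [integral_sub h1 (integrable_const _), h2]
    simp
  have hmom' : ∀ i, ∀ l, l + 1 ≤ K → ∫ u, ε i u ^ (2 * (l + 1)) ∂P ≤ c * σ ^ 2 * (M ^ 2) ^ l := by
    intro i l hlK
    have hnn : ∀ u, 0 ≤ ε i u ^ (2 * (l + 1)) := fun u => by rw [pow_mul]; positivity
    rw [integral_eq_lintegral_of_nonneg_ae (ae_of_all _ hnn)
      ((hmeas i).pow_const _).aestronglyMeasurable]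
    refine ENNReal.toReal_le_of_le_ofReal (by positivity) ?_
    refine le_trans (le_of_eq ?_) (hmom i l hlK)
    rw [← hl]
    refine lintegral_congr fun u => ?_
    rw [Real.enorm_eq_ofReal_abs, ← ENNReal.ofReal_pow (abs_nonneg _), pow_mul, pow_mul, sq_abs]
  obtain ⟨hI, hle⟩ := integral_quad_pow_le hA hpos hind hmeas hLp hmean' hc hW0 hmom' hW K le_rfl
    Finset.univ
  refine le_trans (le_of_eq ?_) (ENNReal.ofReal_le_ofReal hle)
  rw [ofReal_integral_eq_lintegral_ofReal hI (ae_of_all _ fun u => pow_nonneg (hpos _) _)]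
  exact lintegral_congr fun u => (ENNReal.ofReal_pow (hpos _) _).symm

end Conditioning

/-! ### The noise of one block in terms of filtered vectors. -/

section Blocks

variable {X : Type*} {H : Type*} [NormedAddCommGroup H] [InnerProductSpace ℝ H] [CompleteSpace H]
  [RKHS ℝ H X ℝ]

lemma empCov_apply {κ : ℝ} {n : ℕ} (I : Finset (Fin n)) (z : Fin n → X × ℝ) (v : H) :
    empCov H κ I z v = (I.card : ℝ)⁻¹ • ∑ i : I, ⟪nkSec H κ (z i).1, v⟫_ℝ • nkSec H κ (z i).1 := by
  rw [Finset.sum_coe_sort I fun i => ⟪nkSec H κ (z i).1, v⟫_ℝ • nkSec H κ (z i).1, empCov]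
  simp only [smul_apply, sum_apply, InnerProductSpace.rankOne_apply, nkSec,
    real_inner_smul_left, smul_smul, Finset.smul_sum]
  refine Finset.sum_congr rfl fun i _ => ?_
  congr 1
  rw [sq, mul_inv]; ring_nf

lemma empCov_apply_eq {κ : ℝ} {n : ℕ} (I : Finset (Fin n)) (z : Fin n → X × ℝ) (f : H) :
    empCov H κ I z f = ∑ i : I, (κ⁻¹ * (I.card : ℝ)⁻¹ * f (z i).1) • nkSec H κ (z i).1 := by
  rw [empCov_apply, Finset.smul_sum]
  refine Finset.sum_congr rfl fun i _ => ?_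
  rw [smul_smul]
  congr 1
  rw [nkSec, real_inner_smul_left, inner_kerSec]; ring

lemma empAdj_eq {κ : ℝ} {n : ℕ} (I : Finset (Fin n)) (z : Fin n → X × ℝ) :
    empAdj H κ I z = ∑ i : I, (κ⁻¹ * (I.card : ℝ)⁻¹ * (z i).2) • nkSec H κ (z i).1 := by
  rw [Finset.sum_coe_sort I fun i => (κ⁻¹ * (I.card : ℝ)⁻¹ * (z i).2) • nkSec H κ (z i).1, empAdj]
  simp only [nkSec, smul_smul, Finset.smul_sum]
  refine Finset.sum_congr rfl fun i _ => ?_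
  congr 1
  rw [sq, mul_inv]; ring_nf

variable [MeasurableSpace X] [TopologicalSpace.SeparableSpace H] {ν : Measure X}
  [IsProbabilityMeasure ν]

/-- The noise part of one block: representation by filtered vectors, and bounds on these. -/
lemma exists_filtered_block (hmeas : ∀ f : H, Measurable (fun x : X => f x)) {κ : ℝ} (hκ : 0 < κ)
    (hbdd : ∀ (f : H) (x : X), |f x| ≤ κ * ‖f‖) {φ : ℝ → ℝ} {l B : ℝ} (hl : 0 < l)
    (hφ : ∀ t, 0 < t → t ≤ 1 → |φ t| * (t + l) ≤ B) {n : ℕ} (I : Finset (Fin n))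
    (hI : 0 < I.card) (x : Fin n → X) {J : ℕ} {f' : Fin J → H} (hf' : Orthonormal ℝ f') :
    ∃ w : Fin n → H,
      (∀ (y : Fin n → ℝ) (f : H),
        opFun φ (empCov H κ I fun i => (x i, y i)) (empCov H κ I (fun i => (x i, y i)) f) -
          opFun φ (empCov H κ I fun i => (x i, y i)) (empAdj H κ I fun i => (x i, y i)) =
        -((κ⁻¹ * (I.card : ℝ)⁻¹) • ∑ i ∈ I, (y i - f (x i)) • w i)) ∧
      ∑ i ∈ I, ENNReal.ofReal (⟪covOp H κ ν (w i), w i⟫_ℝ + l * ‖w i‖ ^ 2) ≤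
        ENNReal.ofReal (B ^ 2 * I.card) *
          (I.card * ∫⁻ x₀, resQ (I.card * l) (fun i : I => nkSec H κ (x i)) (nkSec H κ x₀) ∂ν +
            ENNReal.ofReal (J + (I.card * l)⁻¹ * ∑ i : I, ‖orthPart f' (nkSec H κ (x i))‖ ^ 2)) ∧
      ∀ i ∈ I, ENNReal.ofReal (⟪covOp H κ ν (w i), w i⟫_ℝ + l * ‖w i‖ ^ 2) ≤
        ENNReal.ofReal (B ^ 2 / l) *
          (I.card * ∫⁻ x₀, resQ (I.card * l) (fun i : I => nkSec H κ (x i)) (nkSec H κ x₀) ∂ν + 1) := by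
  classical
  set N : ℝ := (I.card : ℝ) with hN
  have hN0 : 0 < N := by rw [hN]; exact_mod_cast hI
  have hNl : 0 < N * l := mul_pos hN0 hl
  set k : I → H := fun i => nkSec H κ (x i) with hk
  obtain ⟨d, e, τ, he, hτ0, hexp, hτ⟩ := exists_singular_basis k
  have hk1 : ∀ i, ‖k i‖ ≤ 1 := fun i => norm_nkSec_le hκ hbdd _
  have hτN : ∀ a, τ a ≤ N := fun a => by
    have h1 := sum_inner_mul_inner_eq he hτ a a
    simp only [if_true] at h1
    rw [← h1]
    calc _ ≤ ∑ i : I, (1 : ℝ) := Finset.sum_le_sum fun i _ => by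
          rw [← sq, ← sq_abs]
          refine pow_le_one₀ (abs_nonneg _) ((abs_real_inner_le_norm _ _).trans ?_)
          rw [he.1 a, mul_one]; exact hk1 i
      _ = N := by simp [hN]
  -- The hypothesis on `φ` covers only `(0, 1]`. This suffices: the `τ a` are positive, and `τ a ≤
  -- N` because `‖k i‖ ≤ 1`.
  have hφa : ∀ a, |φ (τ a / N)| * (τ a / N + l) ≤ B := fun a =>
    hφ _ (div_pos (hτ0 a) hN0) ((div_le_one hN0).2 (hτN a))
  obtain ⟨b1, b2, b3, b4⟩ := filtered_bounds he hτ0 hexp hτ hk1 hN0 hl hφa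
  set w : I → H := fun i => ∑ a, (φ (τ a / N) * ⟪e a, k i⟫_ℝ) • e a with hw
  set D : ℝ≥0∞ := I.card * ∫⁻ x₀, resQ (N * l) k (nkSec H κ x₀) ∂ν with hD
  have hsum : ∀ c : I → ℝ, ∑ i, c i • k i = ∑ a, (∑ i, c i * ⟪e a, k i⟫_ℝ) • e a := fun c => by
    simp only [Finset.sum_smul, ← smul_smul]
    rw [Finset.sum_comm]
    refine Finset.sum_congr rfl fun i _ => ?_
    rw [← Finset.smul_sum, ← hexp]
  have hop : ∀ (y : Fin n → ℝ) (c : I → ℝ),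
      opFun φ (empCov H κ I fun i => (x i, y i)) (∑ i, c i • k i) = ∑ i, c i • w i := by
    intro y c
    rw [hsum, opFun_sum (t := fun a => τ a / N)]
    · simp only [hw, Finset.smul_sum, Finset.mul_sum, Finset.sum_smul, smul_smul]
      rw [Finset.sum_comm]
      refine Finset.sum_congr rfl fun i _ => Finset.sum_congr rfl fun a _ => ?_
      congr 1; ring
    · intro u v
      simp only [empCov_apply, sum_inner, inner_sum, real_inner_smul_left, real_inner_smul_right]
      congr 1
      refine Finset.sum_congr rfl fun i _ => ?_
      rw [real_inner_comm u (nkSec H κ (x i))]; ring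
    · intro a
      rw [empCov_apply]
      have := hτ a
      simp only [hk] at this
      rw [this, smul_smul, div_eq_inv_mul]
  have hquad : ∀ u : H, ENNReal.ofReal (⟪covOp H κ ν u, u⟫_ℝ + l * ‖u‖ ^ 2) =
      ∫⁻ x₀, ENNReal.ofReal (⟪u, nkSec H κ x₀⟫_ℝ ^ 2) ∂ν + ENNReal.ofReal (l * ‖u‖ ^ 2) := fun u => by
    obtain ⟨h1, h2⟩ := inner_covOp_self (ν := ν) hmeas hκ hbdd u
    rw [ENNReal.ofReal_add h1 (mul_nonneg hl.le (sq_nonneg _)), h2]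
    simp only [real_inner_comm u]
  have hm : ∀ u : H, Measurable fun x₀ : X => ENNReal.ofReal (⟪u, nkSec H κ x₀⟫_ℝ ^ 2) := fun u => by
    have h1 : ∀ x₀ : X, ⟪u, nkSec H κ x₀⟫_ℝ = κ⁻¹ * u x₀ := fun x₀ => by
      rw [nkSec, real_inner_smul_right, real_inner_comm, inner_kerSec]
    simp only [h1]
    exact (((hmeas u).const_mul _).pow_const 2).ennreal_ofReal
  have nn1 : 0 ≤ B ^ 2 * N ^ 2 := mul_nonneg (sq_nonneg _) (sq_nonneg _)
  have nn2 : 0 ≤ B ^ 2 * N := mul_nonneg (sq_nonneg _) hN0.le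
  have nn3 : 0 ≤ B ^ 2 / l := div_nonneg (sq_nonneg _) hl.le
  have nn4 : ∀ u : H, 0 ≤ l * ‖u‖ ^ 2 := fun u => mul_nonneg hl.le (sq_nonneg _)
  have hres : ∀ x₀ : X, ENNReal.ofReal (∑ a, ⟪e a, nkSec H κ x₀⟫_ℝ ^ 2 / (τ a + N * l)) ≤
      resQ (N * l) k (nkSec H κ x₀) := fun x₀ => le_resQ he hτ0 hexp hτ hNl _
  have hext : ∀ i (hi : i ∈ I), (fun i => if hi : i ∈ I then w ⟨i, hi⟩ else 0) i = w ⟨i, hi⟩ :=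
    fun i hi => dif_pos hi
  refine ⟨fun i => if hi : i ∈ I then w ⟨i, hi⟩ else 0, fun y f => ?_, ?_, ?_⟩
  · rw [empCov_apply_eq, empAdj_eq]
    simp only
    rw [hop y fun i => κ⁻¹ * (I.card : ℝ)⁻¹ * f (x i), hop y fun i => κ⁻¹ * (I.card : ℝ)⁻¹ * y i,
      ← Finset.sum_coe_sort I fun i => (y i - f (x i)) • if hi : i ∈ I then w ⟨i, hi⟩ else 0,
      ← Finset.sum_sub_distrib, Finset.smul_sum, ← Finset.sum_neg_distrib]
    refine Finset.sum_congr rfl fun i _ => ?_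
    rw [dif_pos i.2, ← sub_smul, smul_smul, ← neg_smul]
    congr 1; ring
  · rw [← Finset.sum_coe_sort I]
    simp only [Subtype.coe_eta, Finset.coe_mem, dif_pos, hquad]
    rw [Finset.sum_add_distrib, mul_add]
    refine add_le_add ?_ ?_
    -- The `T̄`-part of the form is `∫ ⟪w i, k_x⟫ ^ 2 ν(dx)`, so the pointwise bound by `resQ` at
    -- `k_x` is integrated.
    · rw [← lintegral_finsetSum _ fun i _ => hm _]
      calc _ ≤ ∫⁻ x₀, ENNReal.ofReal (B ^ 2 * N ^ 2) * resQ (N * l) k (nkSec H κ x₀) ∂ν := by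
            refine lintegral_mono fun x₀ => ?_
            rw [← ENNReal.ofReal_sum_of_nonneg fun i _ => sq_nonneg _]
            refine (ENNReal.ofReal_le_ofReal (b1 _)).trans ?_
            rw [ENNReal.ofReal_mul nn1]
            exact mul_le_mul_right (hres x₀) _
        _ = _ := by
            rw [lintegral_const_mul' _ _ ENNReal.ofReal_ne_top, hD, ← mul_assoc]
            congr 1
            rw [← ENNReal.ofReal_natCast, ← ENNReal.ofReal_mul nn2, ← hN]
            congr 1; ring
    · rw [← ENNReal.ofReal_sum_of_nonneg fun i _ => nn4 _, ← Finset.mul_sum,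
        ← ENNReal.ofReal_mul nn2]
      refine ENNReal.ofReal_le_ofReal (b2.trans ?_)
      exact mul_le_mul_of_nonneg_left (sum_div_le hf' he hτ0 hexp hτ hNl) nn2
  · intro i hi
    simp only [dif_pos hi, hquad]
    rw [mul_add, mul_one]
    refine add_le_add ?_ (ENNReal.ofReal_le_ofReal (b4 _))
    calc _ ≤ ∫⁻ x₀, ENNReal.ofReal (B ^ 2 / l * N) * resQ (N * l) k (nkSec H κ x₀) ∂ν := by
          refine lintegral_mono fun x₀ => ?_
          refine (ENNReal.ofReal_le_ofReal (b3 _ _)).trans ?_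
          rw [ENNReal.ofReal_mul (mul_nonneg nn3 hN0.le)]
          exact mul_le_mul_right (hres x₀) _
      _ = _ := by
          rw [lintegral_const_mul' _ _ ENNReal.ofReal_ne_top, hD, ← mul_assoc]
          congr 1
          rw [← ENNReal.ofReal_natCast, ← ENNReal.ofReal_mul nn3]

end Blocks


/-! ### Moments of the block dimension. -/

section EffectiveDimension

lemma add_three_pow_le (a b c : ℝ≥0∞) (K : ℕ) :
    (a + b + c) ^ K ≤ 3 ^ K * (a ^ K + b ^ K + c ^ K) := by
  have h1 : a + b + c ≤ 3 * max a (max b c) := by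
    calc a + b + c ≤ max a (max b c) + max a (max b c) + max a (max b c) := by
          gcongr
          · exact le_max_left _ _
          · exact (le_max_left _ _).trans (le_max_right _ _)
          · exact (le_max_right _ _).trans (le_max_right _ _)
      _ = _ := by ring
  have h2 : max a (max b c) ^ K ≤ a ^ K + b ^ K + c ^ K := by
    rcases max_choice a (max b c) with h | h
    · rw [h, add_assoc]; exact le_self_add
    · rw [h]
      rcases max_choice b c with h | h
      · rw [h, add_right_comm]; exact le_add_self
      · rw [h]; exact le_add_self
  calc _ ≤ (3 * max a (max b c)) ^ K := by gcongr
    _ = 3 ^ K * max a (max b c) ^ K := mul_pow _ _ _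
    _ ≤ _ := by gcongr

/-- Convexity of the power, in the form of Jensen's inequality for uniform weights. It makes
independence between the block dimensions unnecessary. -/
lemma sum_pow_le_card_mul {m : ℕ} (hm : 0 < m) (q : Fin m → ℝ≥0∞) {K : ℕ} (hK : 1 ≤ K) :
    (∑ j, q j) ^ K ≤ (m : ℝ≥0∞) ^ K * ((m : ℝ≥0∞)⁻¹ * ∑ j, q j ^ K) := by
  have hm0 : (m : ℝ≥0∞) ≠ 0 := by exact_mod_cast hm.ne'
  have hm1 : (m : ℝ≥0∞) ≠ ∞ := ENNReal.natCast_ne_top m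
  have h := ENNReal.rpow_arith_mean_le_arith_mean_rpow Finset.univ (fun _ : Fin m => (m : ℝ≥0∞)⁻¹) q
    (by simp [ENNReal.mul_inv_cancel hm0 hm1]) (p := K) (by exact_mod_cast hK)
  simp only [ENNReal.rpow_natCast, ← Finset.mul_sum] at h
  calc (∑ j, q j) ^ K = ((m : ℝ≥0∞) * ((m : ℝ≥0∞)⁻¹ * ∑ j, q j)) ^ K := by
        rw [← mul_assoc, ENNReal.mul_inv_cancel hm0 hm1, one_mul]
    _ = (m : ℝ≥0∞) ^ K * ((m : ℝ≥0∞)⁻¹ * ∑ j, q j) ^ K := mul_pow _ _ _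
    _ ≤ _ := by gcongr

variable {X : Type*} [MeasurableSpace X] {ν : Measure X} [IsProbabilityMeasure ν]
  {H : Type*} [NormedAddCommGroup H] [InnerProductSpace ℝ H]

/-- The random quantity controlling the conditional variance of one block of size `N`. -/
noncomputable def blockDim (ν : Measure X) (kf : X → H) (N Λ : ℝ) {J : ℕ} (f : Fin J → H)
    {n : ℕ} (I : Finset (Fin n)) (x : Fin n → X) : ℝ≥0∞ :=
  ENNReal.ofReal N * ∫⁻ x₀, resQ Λ (fun i : I => kf (x i)) (kf x₀) ∂ν +
    ENNReal.ofReal (J + Λ⁻¹ * ∑ i : I, ‖orthPart f (kf (x i))‖ ^ 2) + 1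

variable [MeasurableSpace H] [BorelSpace H] [SecondCountableTopology H]

lemma measurable_blockDim {kf : X → H} (hk : Measurable kf) (N Λ : ℝ) {J : ℕ} (f : Fin J → H)
    {n : ℕ} (I : Finset (Fin n)) : Measurable (blockDim ν kf N Λ f I) := by
  have h1 : Measurable fun z : (Fin n → X) × X => resQ Λ (fun i : I => kf (z.1 i)) (kf z.2) :=
    measurable_resQ_comp hk Λ (a := fun (z : (Fin n → X) × X) (i : I) => z.1 i)
      (measurable_pi_lambda _ fun i => (measurable_pi_apply _).comp measurable_fst) measurable_snd
  have h2 : Measurable fun x : Fin n → X => ∫⁻ x₀, resQ Λ (fun i : I => kf (x i)) (kf x₀) ∂ν :=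
    h1.lintegral_prod_right'
  have h3 : Measurable fun x : Fin n → X =>
      ENNReal.ofReal (J + Λ⁻¹ * ∑ i : I, ‖orthPart f (kf (x i))‖ ^ 2) := by
    unfold orthPart
    fun_prop
  exact ((h2.const_mul _).add h3).add_const _

/-- The `+ K` in `hmean` accounts for the fresh points that `lintegral_resQ_pow_le` adds to the
sample; the empirical term needs the hypothesis with `I.card` alone. -/
lemma lintegral_blockDim_pow_le {kf : X → H} (hk : Measurable kf) (hk1 : ∀ x, ‖kf x‖ ≤ 1)
    {Λ : ℝ} (hΛ : 1 ≤ Λ) {J : ℕ} {f : Fin J → H} (hf : Orthonormal ℝ f) {θ : ℝ} (hθ : 1 ≤ θ)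
    (hJ : J ≤ θ) (K : ℕ) {n : ℕ} (I : Finset (Fin n))
    (hmean : ((I.card + K : ℕ) : ℝ≥0∞) *
      ∫⁻ x, ENNReal.ofReal (Λ⁻¹ * ‖orthPart f (kf x)‖ ^ 2) ∂ν ≤ ENNReal.ofReal θ) :
    ∫⁻ x : Fin n → X, blockDim ν kf I.card Λ f I x ^ K ∂(Measure.pi fun _ => ν) ≤
      ENNReal.ofReal (3 ^ K * (((1 + K) ^ K + 1) * (K.factorial * Real.exp 3) + 1) * θ ^ K) := by
  have hΛ0 : 0 < Λ := by linarith
  have hθ0 : 0 < θ := by linarith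
  have hm1 : Measurable fun x : I → X => ∫⁻ x₀, resQ Λ (fun i => kf (x i)) (kf x₀) ∂ν := by
    have h1 : Measurable fun z : (I → X) × X => resQ Λ (fun i => kf (z.1 i)) (kf z.2) :=
      measurable_resQ_comp hk Λ measurable_fst measurable_snd
    exact h1.lintegral_prod_right'
  have hm2 : Measurable fun x : I → X =>
      ENNReal.ofReal (J + Λ⁻¹ * ∑ i : I, ‖orthPart f (kf (x i))‖ ^ 2) := by
    unfold orthPart
    fun_prop
  have hD : ∫⁻ x : Fin n → X,
      (ENNReal.ofReal I.card * ∫⁻ x₀, resQ Λ (fun i : I => kf (x i)) (kf x₀) ∂ν) ^ K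
        ∂(Measure.pi fun _ => ν) ≤
      ENNReal.ofReal ((1 + K) ^ K * (K.factorial * Real.exp 3 * θ ^ K)) := by
    rw [lintegral_pi_restrict I (F := fun x : I → X =>
      (ENNReal.ofReal I.card * ∫⁻ x₀, resQ Λ (fun i => kf (x i)) (kf x₀) ∂ν) ^ K)
      ((hm1.const_mul _).pow_const _)]
    have h1 := lintegral_resQ_pow_le (ι := I) hk hk1 hΛ hf hθ hJ K
      (by rw [Fintype.card_coe]; exact hmean)
    rw [Fintype.card_coe] at h1
    simpa only [ENNReal.ofReal_natCast] using h1
  have hY : ∫⁻ x : Fin n → X,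
      ENNReal.ofReal (J + Λ⁻¹ * ∑ i : I, ‖orthPart f (kf (x i))‖ ^ 2) ^ K
        ∂(Measure.pi fun _ => ν) ≤ ENNReal.ofReal (K.factorial * Real.exp 3 * θ ^ K) := by
    rw [lintegral_pi_restrict I (F := fun x : I → X =>
      ENNReal.ofReal (J + Λ⁻¹ * ∑ i : I, ‖orthPart f (kf (x i))‖ ^ 2) ^ K) (hm2.pow_const _)]
    simp only [Finset.mul_sum]
    refine lintegral_sum_pow_le (y := fun x => Λ⁻¹ * ‖orthPart f (kf x)‖ ^ 2) ?_ ?_ ?_ hθ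
      (Nat.cast_nonneg J) hJ ?_ K
    · unfold orthPart
      fun_prop
    · intro x; positivity
    · intro x
      have h3 : ‖orthPart f (kf x)‖ ^ 2 ≤ 1 := by
        rw [norm_sq_orthPart hf]
        have : ‖kf x‖ ^ 2 ≤ 1 := pow_le_one₀ (norm_nonneg _) (hk1 x)
        have : 0 ≤ ∑ j, ⟪f j, kf x⟫_ℝ ^ 2 := by positivity
        linarith
      exact mul_le_one₀ (inv_le_one_of_one_le₀ hΛ) (sq_nonneg _) h3
    · rw [Fintype.card_coe]
      refine le_trans ?_ hmean
      gcongr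
      omega
  have hm1' : Measurable fun x : Fin n → X =>
      ∫⁻ x₀, resQ Λ (fun i : I => kf (x i)) (kf x₀) ∂ν :=
    hm1.comp (measurable_pi_lambda (fun (x : Fin n → X) (i : I) => x i) fun i => measurable_pi_apply _)
  have hm2' : Measurable fun x : Fin n → X =>
      ENNReal.ofReal (J + Λ⁻¹ * ∑ i : I, ‖orthPart f (kf (x i))‖ ^ 2) :=
    hm2.comp (measurable_pi_lambda (fun (x : Fin n → X) (i : I) => x i) fun i => measurable_pi_apply _)
  calc ∫⁻ x : Fin n → X, blockDim ν kf I.card Λ f I x ^ K ∂(Measure.pi fun _ => ν)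
      ≤ ∫⁻ x : Fin n → X, 3 ^ K *
          ((ENNReal.ofReal I.card * ∫⁻ x₀, resQ Λ (fun i : I => kf (x i)) (kf x₀) ∂ν) ^ K +
          ENNReal.ofReal (J + Λ⁻¹ * ∑ i : I, ‖orthPart f (kf (x i))‖ ^ 2) ^ K + 1 ^ K)
          ∂(Measure.pi fun _ => ν) := lintegral_mono fun x => add_three_pow_le _ _ _ _
    _ ≤ 3 ^ K * (ENNReal.ofReal ((1 + K) ^ K * (K.factorial * Real.exp 3 * θ ^ K)) +
          ENNReal.ofReal (K.factorial * Real.exp 3 * θ ^ K) + 1) := by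
        rw [lintegral_const_mul' _ _ (by simp), lintegral_add_right _ measurable_const,
          lintegral_add_right _ (hm2'.pow_const K)]
        gcongr
        simp
    _ ≤ _ := by
        rw [← ENNReal.ofReal_add (by positivity) (by positivity), ← ENNReal.ofReal_one,
          ← ENNReal.ofReal_add (by positivity) zero_le_one,
          show (3 : ℝ≥0∞) = ENNReal.ofReal 3 by simp, ← ENNReal.ofReal_pow (by norm_num),
          ← ENNReal.ofReal_mul (by positivity)]
        refine ENNReal.ofReal_le_ofReal ?_
        rw [mul_assoc (3 ^ K : ℝ)]
        have : 1 ≤ θ ^ K := one_le_pow₀ hθ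
        refine mul_le_mul_of_nonneg_left ?_ (by positivity)
        linarith

end EffectiveDimension

/-! ### Conditional error of the averaged estimator. -/

section Risk

variable {X : Type*} [MeasurableSpace X] {H : Type*} [NormedAddCommGroup H] [InnerProductSpace ℝ H]
  [CompleteSpace H] [TopologicalSpace.SeparableSpace H] [RKHS ℝ H X ℝ]

/-- Bound on the conditional moments of the error of the averaged estimator, given the inputs. -/
lemma conditional_error_le (hmeas : ∀ f : H, Measurable (fun x : X => f x)) {κ : ℝ} (hκ : 0 < κ)
    (hbdd : ∀ (f : H) (x : X), |f x| ≤ κ * ‖f‖) {φ : ℝ → ℝ} {l B : ℝ} (hl : 0 < l) (hB : 0 < B)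
    (hφ : ∀ t, 0 < t → t ≤ 1 → |φ t| * (t + l) ≤ B) {n m N : ℕ} (hm₀ : 0 < m) (hN : 0 < N)
    (part : Fin n → Fin m) (hpart : ∀ j, (block part j).card = N)
    {ν : Measure X} [IsProbabilityMeasure ν] {η : Kernel X ℝ} {h : X → unitInterval → ℝ}
    (hm : Measurable (Function.uncurry h))
    (hh : ∀ a, (volume : Measure unitInterval).map (h a) = η a) (f : H) {s : ℝ}
    (hs : s ∈ Icc (0 : ℝ) (1 / 2)) {K : ℕ} (hK : 1 ≤ K) {c σ M : ℝ} (hc : 0 ≤ c) (hσ : 0 < σ)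
    (hM : M ^ 2 ≤ σ ^ 2 * (N * l)) {J : ℕ} {f' : Fin J → H} (hf' : Orthonormal ℝ f')
    {x : Fin n → X} (hint : ∀ i, Integrable (fun y => y) (η (x i)))
    (hmean : ∀ i, ∫ y, y ∂(η (x i)) = f (x i))
    (hmom : ∀ i, ∀ k, k + 1 ≤ K →
      ∫⁻ y, ‖y - f (x i)‖ₑ ^ (2 * (k + 1)) ∂(η (x i)) ≤
        ENNReal.ofReal (c * σ ^ 2 * (M ^ 2) ^ k)) :
    ∫⁻ u : Fin n → unitInterval,
      ENNReal.ofReal (‖opPow (covOp H κ ν) s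
        (avgNoiseless κ φ part f (fun i => (x i, h (x i) (u i))) -
          avgEst H κ φ part (fun i => (x i, h (x i) (u i))))‖ ^ 2) ^ K
        ∂(Measure.pi fun _ => volume) ≤
      ENNReal.ofReal ((momentConst c K + 1) * (l ^ (2 * s - 1) * ((m : ℝ)⁻¹ * κ⁻¹ * (N : ℝ)⁻¹) ^ 2 *
        (2 * σ ^ 2 * B ^ 2 * N)) ^ K) *
      (∑ j, blockDim ν (nkSec H κ) N (N * l) f' (block part j) x) ^ K := by
  classical
  have hN0 : (0 : ℝ) < N := by exact_mod_cast hN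
  have hlp := Real.rpow_pos_of_pos hl (2 * s - 1)
  have hmc := momentConst_nonneg hc K
  set q : Fin m → ℝ≥0∞ := fun j => blockDim ν (nkSec H κ) N (N * l) f' (block part j) x with hq
  have hm0 : (0 : ℝ) < m := by exact_mod_cast hm₀
  set ρ : ℝ := (m : ℝ)⁻¹ * κ⁻¹ * (N : ℝ)⁻¹ with hρ
  have hρ0 : 0 < ρ := by positivity
  -- If a block dimension is infinite the right side is infinite, because its prefactor is positive;
  -- the `+ 1` after `momentConst` guarantees this.
  by_cases hQ : ∑ j, q j = ∞
  · rw [hQ, ENNReal.top_pow (by omega), ENNReal.mul_top]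
    · exact le_top
    · rw [Ne, ENNReal.ofReal_eq_zero, not_le]
      positivity
  have hex := fun j => exists_filtered_block (ν := ν) hmeas hκ hbdd hl hφ (block part j)
    (by rw [hpart]; exact hN) x hf'
  choose w hw1 hw2 hw3 using hex
  simp only [hpart] at hw1 hw2 hw3
  -- The seminorm in which the moments are taken is that of `T̄ + l`, as required by the
  -- interpolation bound.
  let A : H →L[ℝ] H := covOp H κ ν + l • ContinuousLinearMap.id ℝ H
  have hAin : ∀ u v, ⟪A u, v⟫_ℝ = ⟪covOp H κ ν u, v⟫_ℝ + l * ⟪u, v⟫_ℝ := fun u v => by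
    simp [A, inner_add_left, real_inner_smul_left]
  have hAself : ∀ u, ⟪A u, u⟫_ℝ = ⟪covOp H κ ν u, u⟫_ℝ + l * ‖u‖ ^ 2 := fun u => by
    rw [hAin, real_inner_self_eq_norm_sq]
  have hTpos : ∀ u, 0 ≤ ⟪covOp H κ ν u, u⟫_ℝ := fun u => (inner_covOp_self hmeas hκ hbdd u).1
  have hTsymm := covOp_symmetric (ν := ν) hmeas hκ hbdd
  have hA : ∀ u v, ⟪A u, v⟫_ℝ = ⟪u, A v⟫_ℝ := fun u v => by
    rw [hAin, real_inner_comm (A v) u, hAin, hTsymm, real_inner_comm u v, real_inner_comm u]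
  have hApos : ∀ u, 0 ≤ ⟪A u, u⟫_ℝ := fun u => by
    rw [hAself]
    have := hTpos u
    positivity
  let w' : Fin n → H := fun i => w (part i) i
  set Q : ℝ := (∑ j, q j).toReal with hQdef
  have hQr : ∑ j, q j = ENNReal.ofReal Q := (ENNReal.ofReal_toReal hQ).symm
  have hQ0 : 0 ≤ Q := ENNReal.toReal_nonneg
  have hW : ∀ i, ⟪A (w' i), w' i⟫_ℝ ≤ B ^ 2 / l * Q := by
    intro i
    have h1 := hw3 (part i) i (by simp [block])
    rw [← hAself] at h1
    have h2 : ENNReal.ofReal ⟪A (w' i), w' i⟫_ℝ ≤ ENNReal.ofReal (B ^ 2 / l * Q) := by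
      refine h1.trans ?_
      rw [ENNReal.ofReal_mul (by positivity), ← hQr]
      gcongr
      refine le_trans ?_ (Finset.single_le_sum (f := q) (fun _ _ => zero_le) (Finset.mem_univ (part i)))
      simp only [hq, blockDim, ENNReal.ofReal_natCast]
      gcongr
      exact le_self_add
    exact (ENNReal.ofReal_le_ofReal_iff (by positivity)).1 h2
  have hV : ∑ i, ⟪A (w' i), w' i⟫_ℝ ≤ B ^ 2 * N * Q := by
    have h2 : ENNReal.ofReal (∑ i, ⟪A (w' i), w' i⟫_ℝ) ≤ ENNReal.ofReal (B ^ 2 * N * Q) := by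
      rw [ENNReal.ofReal_sum_of_nonneg fun i _ => hApos _, ENNReal.ofReal_mul (by positivity), ← hQr,
        ← Finset.sum_fiberwise Finset.univ part, Finset.mul_sum]
      refine Finset.sum_le_sum fun j _ => ?_
      have h3 : ∑ i ∈ Finset.univ.filter (fun i => part i = j), ENNReal.ofReal ⟪A (w' i), w' i⟫_ℝ =
          ∑ i ∈ block part j,
            ENNReal.ofReal (⟪covOp H κ ν (w j i), w j i⟫_ℝ + l * ‖w j i‖ ^ 2) := by
        refine Finset.sum_congr rfl fun i hi => ?_
        have : part i = j := (Finset.mem_filter.1 hi).2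
        rw [hAself]
        simp only [w', this]
      rw [h3]
      refine (hw2 j).trans ?_
      simp only [hq, blockDim, ENNReal.ofReal_natCast]
      exact mul_le_mul_right le_self_add _
    exact (ENNReal.ofReal_le_ofReal_iff (by positivity)).1 h2
  have herr : ∀ u : Fin n → unitInterval,
      avgNoiseless κ φ part f (fun i => (x i, h (x i) (u i))) -
          avgEst H κ φ part (fun i => (x i, h (x i) (u i))) =
        (-ρ) • ∑ i, (h (x i) (u i) - f (x i)) • w' i := fun u => by
    rw [avgNoiseless, avgEst, ← smul_sub, ← Finset.sum_sub_distrib]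
    have h1 := fun j => hw1 j (fun i => h (x i) (u i)) f
    simp only [h1]
    rw [← Finset.sum_fiberwise Finset.univ part fun i => (h (x i) (u i) - f (x i)) • w' i,
      Finset.smul_sum, Finset.smul_sum]
    refine Finset.sum_congr rfl fun j _ => ?_
    have h3 : ∑ i ∈ Finset.univ.filter (fun i => part i = j), (h (x i) (u i) - f (x i)) • w' i =
        ∑ i ∈ block part j, (h (x i) (u i) - f (x i)) • w j i := by
      refine Finset.sum_congr rfl fun i hi => ?_
      have : part i = j := (Finset.mem_filter.1 hi).2
      simp only [w', this]
    rw [h3, smul_neg, smul_smul, neg_smul, hρ, mul_assoc]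
  have hpt : ∀ u : Fin n → unitInterval,
      ENNReal.ofReal (‖opPow (covOp H κ ν) s
        (avgNoiseless κ φ part f (fun i => (x i, h (x i) (u i))) -
          avgEst H κ φ part (fun i => (x i, h (x i) (u i))))‖ ^ 2) ^ K ≤
      ENNReal.ofReal (l ^ (2 * s - 1) * ρ ^ 2) ^ K *
        ENNReal.ofReal ⟪A (∑ i, (h (x i) (u i) - f (x i)) • w' i),
          ∑ i, (h (x i) (u i) - f (x i)) • w' i⟫_ℝ ^ K := fun u => by
    rw [← mul_pow, ← ENNReal.ofReal_mul (by positivity)]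
    gcongr
    refine (norm_sq_opPow_le hTsymm hTpos hl hs _).trans (le_of_eq ?_)
    rw [← hAself, herr, map_smul, real_inner_smul_left, real_inner_smul_right]
    ring
  refine (lintegral_mono hpt).trans ?_
  rw [lintegral_const_mul' _ _ (by simp)]
  have hmain := lintegral_quad_noise_le hA hApos hm hh hK hc (by positivity) hint hmean hmom hW
  refine (mul_le_mul_right hmain _).trans ?_
  rw [hQr, ← ENNReal.ofReal_pow (by positivity), ← ENNReal.ofReal_pow hQ0,
    ← ENNReal.ofReal_mul (by positivity), ← ENNReal.ofReal_mul (by positivity)]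
  refine ENNReal.ofReal_le_ofReal ?_
  -- By `M ^ 2 ≤ σ ^ 2 * (N * l)` the contribution of single summands is no larger than the variance
  -- bound, whence the factor `2`.
  have hG : σ ^ 2 * ∑ i, ⟪A (w' i), w' i⟫_ℝ + M ^ 2 * (B ^ 2 / l * Q) ≤
      2 * σ ^ 2 * B ^ 2 * N * Q := by
    have h1 := mul_le_mul_of_nonneg_left hV (sq_nonneg σ)
    have h2 : M ^ 2 * (B ^ 2 / l * Q) ≤ σ ^ 2 * (N * l) * (B ^ 2 / l * Q) := by gcongr
    have h3 : σ ^ 2 * (N * l) * (B ^ 2 / l * Q) = σ ^ 2 * (B ^ 2 * N * Q) := by field_simp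
    linarith
  have hG0 : 0 ≤ σ ^ 2 * ∑ i, ⟪A (w' i), w' i⟫_ℝ + M ^ 2 * (B ^ 2 / l * Q) := by
    have : 0 ≤ ∑ i, ⟪A (w' i), w' i⟫_ℝ := Finset.sum_nonneg fun i _ => hApos _
    positivity
  calc _ ≤ (l ^ (2 * s - 1) * ρ ^ 2) ^ K *
        ((momentConst c K + 1) * (2 * σ ^ 2 * B ^ 2 * N * Q) ^ K) := by
        gcongr
        linarith
    _ = _ := by simp only [mul_pow]; ring

end Risk


/-! ### Spectral cut-off and unconditional moments of the error. -/

section Risk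

variable {X : Type*} [MeasurableSpace X] {H : Type*} [NormedAddCommGroup H] [InnerProductSpace ℝ H]
  [CompleteSpace H] [TopologicalSpace.SeparableSpace H] [RKHS ℝ H X ℝ]

/-- A spectral cut-off at level `l ^ (-1 / b)` balances rank and tail of the trace. -/
lemma exists_cutoff (hmeas : ∀ f : H, Measurable (fun x : X => f x)) {κ : ℝ} (hκ : 0 < κ)
    (hbdd : ∀ (f : H) (x : X), |f x| ≤ κ * ‖f‖) {b β : ℝ} (hb : 1 < b) (hβ : 0 < β)
    {ν : Measure X} [IsProbabilityMeasure ν] (hdec : EigenDecay H κ b β ν) {l : ℝ} (hl : 0 < l)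
    (hl1 : l ≤ 1) {N : ℕ} (hN : 0 < N) (K : ℕ) :
    ∃ (J : ℕ) (f : Fin J → H), Orthonormal ℝ f ∧
      (J : ℝ) ≤ (2 + (1 + K) * (β / (b - 1))) * l ^ (-(1 / b)) ∧
      ((N + K : ℕ) : ℝ≥0∞) *
        ∫⁻ x, ENNReal.ofReal ((N * l)⁻¹ * ‖orthPart f (nkSec H κ x)‖ ^ 2) ∂ν ≤
        ENNReal.ofReal ((2 + (1 + K) * (β / (b - 1))) * l ^ (-(1 / b))) := by
  obtain ⟨μ, hμ, hμb⟩ := hdec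
  have hb0 : 0 < b := by linarith
  have hb1 : 0 < b - 1 := by linarith
  have hN0 : (0 : ℝ) < N := by exact_mod_cast hN
  have hN1 : (1 : ℝ) ≤ N := by exact_mod_cast hN
  set t : ℝ := l ^ (-(1 / b)) with ht
  have ht1 : 1 ≤ t := Real.one_le_rpow_of_pos_of_le_one_of_nonpos hl hl1
    (neg_nonpos.2 (by positivity))
  have ht0 : 0 < t := by linarith
  set L := ⌈t⌉₊ with hLdef
  have hLt : t ≤ L := Nat.le_ceil t
  have hL2 : (L : ℝ) ≤ 2 * t := by
    have := Nat.ceil_lt_add_one ht0.le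
    linarith
  have hL1 : 1 ≤ L := Nat.one_le_ceil_iff.2 ht0
  obtain ⟨J, hJL, f, hf, htail⟩ := lintegral_norm_sq_orthPart_le hmeas hκ hbdd hμ L
  refine ⟨J, f, hf, ?_, ?_⟩
  · have h1 : (J : ℝ) ≤ L := by exact_mod_cast hJL
    have h2 : 0 ≤ (1 + K) * (β / (b - 1)) * t := by positivity
    nlinarith
  · have h1 := htail.trans (tsum_tail_le hb hβ hμb hL1)
    -- With `t = l ^ (-1 / b)` one has `t ^ (1 - b) = l * t`, so the factor `l⁻¹` in front of the
    -- tail is cancelled and rank and tail are both of order `t`.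
    have h2 : (L : ℝ) ^ (1 - b) ≤ l * t := by
      calc (L : ℝ) ^ (1 - b) ≤ t ^ (1 - b) :=
            Real.rpow_le_rpow_of_nonpos ht0 hLt (by linarith)
        _ = l * t := by
            rw [ht, ← Real.rpow_mul hl.le, ← Real.rpow_one_add' hl.le]
            · congr 1
              field_simp
              ring
            · have : 1 / b < 1 := (div_lt_one hb0).2 hb
              linarith
    have hNl : 0 < (N * l)⁻¹ := inv_pos.2 (mul_pos hN0 hl)
    simp only [ENNReal.ofReal_mul hNl.le]
    rw [lintegral_const_mul' _ _ ENNReal.ofReal_ne_top]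
    calc _ ≤ ENNReal.ofReal (N + K : ℕ) * (ENNReal.ofReal (N * l)⁻¹ *
          ENNReal.ofReal (β / (b - 1) * (L : ℝ) ^ (1 - b))) := by
          rw [ENNReal.ofReal_natCast]
          gcongr
      _ = ENNReal.ofReal ((N + K : ℕ) * ((N * l)⁻¹ * (β / (b - 1) * (L : ℝ) ^ (1 - b)))) := by
          rw [← ENNReal.ofReal_mul hNl.le, ← ENNReal.ofReal_mul (by positivity)]
      _ ≤ _ := by
          refine ENNReal.ofReal_le_ofReal ?_
          have h3 : ((N + K : ℕ) : ℝ) ≤ N * (1 + K) := by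
            push_cast
            have : (K : ℝ) ≤ N * K := le_mul_of_one_le_left (by positivity) hN1
            linarith
          calc ((N + K : ℕ) : ℝ) * ((N * l)⁻¹ * (β / (b - 1) * (L : ℝ) ^ (1 - b)))
              ≤ (N * (1 + K)) * ((N * l)⁻¹ * (β / (b - 1) * (l * t))) := by gcongr
            _ = (1 + K) * (β / (b - 1)) * t := by field_simp
            _ ≤ _ := by linarith

/-- The constant in the moment bound for the error of the averaged estimator. -/
noncomputable def errorConst (κ b β B c : ℝ) (K : ℕ) : ℝ :=
  (momentConst c K + 1) * (2 * B ^ 2 / κ ^ 2) ^ K *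
    (3 ^ K * (((1 + K) ^ K + 1) * (K.factorial * Real.exp 3) + 1) *
      (2 + (1 + K) * (β / (b - 1))) ^ K)

lemma errorConst_nonneg {κ b β B c : ℝ} (hb : 1 < b) (hβ : 0 < β) (hc : 0 ≤ c) (K : ℕ) :
    0 ≤ errorConst κ b β B c K := by
  have := momentConst_nonneg hc K
  have : 0 < b - 1 := by linarith
  unfold errorConst
  positivity

/-- The conditional bound is integrated over the inputs; Jensen over the blocks leaves the moment of
one block dimension, which is of order `l ^ (-1 / b)`. -/
lemma error_moment_le (hmeas : ∀ f : H, Measurable (fun x : X => f x)) {κ : ℝ} (hκ : 0 < κ)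
    (hbdd : ∀ (f : H) (x : X), |f x| ≤ κ * ‖f‖) {b β r R : ℝ} (hb : 1 < b) (hβ : 0 < β)
    {φ : ℝ → ℝ} {l B : ℝ} (hl : 0 < l) (hl1 : l ≤ 1) (hB : 0 < B)
    (hφ : ∀ t, 0 < t → t ≤ 1 → |φ t| * (t + l) ≤ B) {n m N : ℕ} (hm₀ : 0 < m) (hN : 0 < N)
    (hn : m * N = n) (part : Fin n → Fin m) (hpart : ∀ j, (block part j).card = N)
    {ν : Measure X} {η : Kernel X ℝ} {f : H} {s : ℝ} (hs : s ∈ Icc (0 : ℝ) (1 / 2))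
    {K : ℕ} (hK : 1 ≤ K) {c σ M : ℝ} (hc : 0 ≤ c) (hσ : 0 < σ) (hNl : 1 ≤ N * l)
    (hM : M ^ 2 ≤ σ ^ 2 * (N * l)) (hmod : IsModel κ b β r σ R ν η f)
    (hmom : ∀ᵐ x ∂ν, ∀ k, k + 1 ≤ K →
      ∫⁻ y, ‖y - f x‖ₑ ^ (2 * (k + 1)) ∂(η x) ≤ ENNReal.ofReal (c * σ ^ 2 * (M ^ 2) ^ k)) :
    ∫⁻ z : Fin n → X × ℝ,
      ENNReal.ofReal (‖opPow (covOp H κ ν) s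
        (avgNoiseless κ φ part f z - avgEst H κ φ part z)‖ ^ 2) ^ K
        ∂(Measure.pi fun _ => ν ⊗ₘ η) ≤
      ENNReal.ofReal (errorConst κ b β B c K *
        (σ ^ 2 / n * (l ^ (2 * s - 1) * l ^ (-(1 / b)))) ^ K) := by
  borelize H
  have hsc : SecondCountableTopology H := UniformSpace.secondCountable_of_separable H
  have := hmod.prob
  have := hmod.markov
  have hb1 : 0 < b - 1 := by linarith
  have hN0 : (0 : ℝ) < N := by exact_mod_cast hN
  have hm0 : (0 : ℝ) < m := by exact_mod_cast hm₀
  obtain ⟨h, hm, hh⟩ := Kernel.exists_measurable_map_eq_unitInterval η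
  obtain ⟨J, f', hf', hJ, hτ⟩ := exists_cutoff hmeas hκ hbdd hb hβ hmod.decay hl hl1 hN K
  set t : ℝ := l ^ (-(1 / b)) with ht
  set θ₀ : ℝ := 2 + (1 + K) * (β / (b - 1)) with hθ₀
  have ht1 : 1 ≤ t := Real.one_le_rpow_of_pos_of_le_one_of_nonpos hl hl1
    (neg_nonpos.2 (by positivity))
  have hθ1 : 1 ≤ θ₀ := by
    have : 0 ≤ (1 + K) * (β / (b - 1)) := by positivity
    linarith
  have hθ : 1 ≤ θ₀ * t := one_le_mul_of_one_le_of_one_le hθ1 ht1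
  have hk := measurable_nkSec (X := X) (H := H) hmeas κ
  have hmc := momentConst_nonneg hc K
  have hlp := Real.rpow_pos_of_pos hl (2 * s - 1)
  have hae : ∀ {P : X → Prop}, (∀ᵐ x ∂ν, P x) →
      ∀ᵐ x : Fin n → X ∂(Measure.pi fun _ => ν), ∀ i, P (x i) := fun {P} hP =>
    ae_all_iff.2 fun i =>
      (measurePreserving_eval (fun _ : Fin n => ν) i).quasiMeasurePreserving.ae hP
  let q : Fin m → (Fin n → X) → ℝ≥0∞ := fun j x =>
    blockDim ν (nkSec H κ) N (N * l) f' (block part j) x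
  have hqm : ∀ j, Measurable (q j) := fun j => measurable_blockDim hk _ _ _ _
  set E : ℝ := 3 ^ K * (((1 + K) ^ K + 1) * (K.factorial * Real.exp 3) + 1) * (θ₀ * t) ^ K with hE
  have hqE : ∀ j, ∫⁻ x, q j x ^ K ∂(Measure.pi fun _ => ν) ≤ ENNReal.ofReal E := fun j => by
    have := lintegral_blockDim_pow_le (ν := ν) hk (norm_nkSec_le hκ hbdd) hNl hf' hθ hJ K
      (block part j) (by rw [hpart]; exact hτ)
    rw [hpart] at this
    exact this
  set c1 : ℝ := (momentConst c K + 1) * (l ^ (2 * s - 1) * ((m : ℝ)⁻¹ * κ⁻¹ * (N : ℝ)⁻¹) ^ 2 *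
    (2 * σ ^ 2 * B ^ 2 * N)) ^ K with hc1
  have hc10 : 0 ≤ c1 := by positivity
  refine (lintegral_pi_compProd_le hm hh _).trans ?_
  calc _ ≤ ∫⁻ x : Fin n → X, ENNReal.ofReal c1 *
        ((m : ℝ≥0∞) ^ K * ((m : ℝ≥0∞)⁻¹ * ∑ j, q j x ^ K)) ∂(Measure.pi fun _ => ν) := by
        refine lintegral_mono_ae ?_
        filter_upwards [hae hmod.integrable, hae hmod.mean, hae hmom] with x h1 h2 h3
        refine (conditional_error_le hmeas hκ hbdd hl hB hφ hm₀ hN part hpart hm hh f hs hK hc hσ hM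
          hf' h1 h2 h3).trans ?_
        exact mul_le_mul_right (sum_pow_le_card_mul hm₀ _ hK) _
    _ = ENNReal.ofReal c1 * ((m : ℝ≥0∞) ^ K *
        ((m : ℝ≥0∞)⁻¹ * ∑ j, ∫⁻ x, q j x ^ K ∂(Measure.pi fun _ => ν))) := by
        rw [lintegral_const_mul' _ _ ENNReal.ofReal_ne_top, lintegral_const_mul' _ _ (by simp),
          lintegral_const_mul' _ _ (by simp [hm₀.ne']),
          lintegral_finsetSum _ fun j _ => (hqm j).pow_const K]
    _ ≤ ENNReal.ofReal c1 * ((m : ℝ≥0∞) ^ K *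
        ((m : ℝ≥0∞)⁻¹ * ∑ j : Fin m, ENNReal.ofReal E)) := by
        gcongr with j
        exact hqE j
    _ = ENNReal.ofReal (c1 * (m ^ K * E)) := by
        have hcancel : (m : ℝ≥0∞)⁻¹ * ((m : ℝ≥0∞) * ENNReal.ofReal E) = ENNReal.ofReal E := by
          rw [← mul_assoc, ENNReal.inv_mul_cancel (by exact_mod_cast hm₀.ne')
            (ENNReal.natCast_ne_top m), one_mul]
        rw [Finset.sum_const, Finset.card_univ, Fintype.card_fin, nsmul_eq_mul, hcancel,
          ENNReal.ofReal_mul (p := c1) hc10, ENNReal.ofReal_mul (p := (m : ℝ) ^ K) (by positivity),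
          ENNReal.ofReal_pow hm0.le, ENNReal.ofReal_natCast]
    _ = _ := by
        congr 1
        have hnr : (n : ℝ) = m * N := by rw [← hn]; push_cast; ring
        -- The powers of `m` and `N` combine to `1 / n`: the prefactor has `(m N)⁻²`, the variance
        -- of one block a factor `N`, and summing over the blocks a factor `m`.
        have hX : l ^ (2 * s - 1) * ((m : ℝ)⁻¹ * κ⁻¹ * (N : ℝ)⁻¹) ^ 2 * (2 * σ ^ 2 * B ^ 2 * N) *
            m * (θ₀ * t) = 2 * B ^ 2 / κ ^ 2 * θ₀ * (σ ^ 2 / n * (l ^ (2 * s - 1) * t)) := by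
          rw [hnr]
          field_simp
        have hXK := congrArg (fun a : ℝ => a ^ K) hX
        simp only [mul_pow _ _ K] at hXK
        rw [hc1, hE, errorConst, ← hθ₀]
        simp only [mul_pow _ _ K]
        linear_combination ((momentConst c K + 1) *
          (3 ^ K * (((1 + K) ^ K + 1) * (K.factorial * Real.exp 3) + 1))) * hXK

end Risk


/-! ### Normalised risk, rates and block sizes. -/

section Theorem

lemma rpow_le_one_add_sq_pow {u p : ℝ} {K : ℕ} (hu : 0 ≤ u) (hp : 0 ≤ p) (hK : p ≤ 2 * K) :
    u ^ p ≤ 1 + (u ^ 2) ^ K := by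
  rcases le_total u 1 with h | h
  · have := Real.rpow_le_one hu h hp
    have : 0 ≤ (u ^ 2) ^ K := by positivity
    linarith
  · have h1 : u ^ p ≤ u ^ ((2 * K : ℕ) : ℝ) :=
      Real.rpow_le_rpow_of_exponent_le h (by push_cast; exact hK)
    rw [Real.rpow_natCast, pow_mul] at h1
    linarith

/-- From the moment of order `2 K` to the one of order `p ≤ 2 K`, using `u ^ p ≤ 1 + u ^ (2 K)` for
`u = ‖F‖ / a`. This avoids Hölder's inequality, and with it any measurability of `F`. -/
lemma lintegral_rpow_div_le {Ω E : Type*} [MeasurableSpace Ω] [NormedAddCommGroup E]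
    {μ : Measure Ω} [IsProbabilityMeasure μ] (F : Ω → E) {p a A : ℝ} {K : ℕ} (hp : 1 ≤ p)
    (hK : p ≤ 2 * K) (ha : 0 < a) (hA : 0 ≤ A)
    (h : ∫⁻ z, ENNReal.ofReal (‖F z‖ ^ 2) ^ K ∂μ ≤ ENNReal.ofReal (A * (a ^ 2) ^ K)) :
    (∫⁻ z, ‖F z‖ₑ ^ p ∂μ) ^ (1 / p) / ENNReal.ofReal a ≤ ENNReal.ofReal (1 + A) := by
  have hp0 : 0 < p := by linarith
  have hpt : ∀ z, ‖F z‖ₑ ^ p ≤ ENNReal.ofReal (a ^ p) *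
      (1 + ENNReal.ofReal ((a ^ 2) ^ K)⁻¹ * ENNReal.ofReal (‖F z‖ ^ 2) ^ K) := by
    intro z
    have h1 := rpow_le_one_add_sq_pow (div_nonneg (norm_nonneg (F z)) ha.le) hp0.le hK
    rw [Real.div_rpow (norm_nonneg _) ha.le, div_le_iff₀ (by positivity), div_pow, div_pow] at h1
    rw [← ofReal_norm, ENNReal.ofReal_rpow_of_nonneg (norm_nonneg _) hp0.le,
      ← ENNReal.ofReal_pow (by positivity), ← ENNReal.ofReal_mul (by positivity),
      ← ENNReal.ofReal_one, ← ENNReal.ofReal_add (by norm_num) (by positivity),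
      ← ENNReal.ofReal_mul (by positivity)]
    refine ENNReal.ofReal_le_ofReal (h1.trans_eq ?_)
    rw [div_eq_inv_mul]
    ring
  have hint : ∫⁻ z, ‖F z‖ₑ ^ p ∂μ ≤ ENNReal.ofReal (a ^ p * (1 + A)) := by
    calc ∫⁻ z, ‖F z‖ₑ ^ p ∂μ ≤ ∫⁻ z, ENNReal.ofReal (a ^ p) *
          (1 + ENNReal.ofReal ((a ^ 2) ^ K)⁻¹ * ENNReal.ofReal (‖F z‖ ^ 2) ^ K) ∂μ :=
          lintegral_mono hpt
      _ = ENNReal.ofReal (a ^ p) * (1 + ENNReal.ofReal ((a ^ 2) ^ K)⁻¹ *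
          ∫⁻ z, ENNReal.ofReal (‖F z‖ ^ 2) ^ K ∂μ) := by
          rw [lintegral_const_mul' _ _ ENNReal.ofReal_ne_top,
            lintegral_add_left measurable_const, lintegral_const_mul' _ _ ENNReal.ofReal_ne_top,
            lintegral_const, measure_univ, mul_one]
      _ ≤ ENNReal.ofReal (a ^ p) * (1 + ENNReal.ofReal ((a ^ 2) ^ K)⁻¹ *
          ENNReal.ofReal (A * (a ^ 2) ^ K)) := by gcongr
      _ = _ := by
          rw [← ENNReal.ofReal_mul (by positivity), ← ENNReal.ofReal_one,
            ← ENNReal.ofReal_add (by norm_num) (by positivity),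
            ← ENNReal.ofReal_mul (by positivity)]
          congr 3
          field_simp
  refine ENNReal.div_le_of_le_mul ?_
  calc (∫⁻ z, ‖F z‖ₑ ^ p ∂μ) ^ (1 / p) ≤ ENNReal.ofReal (a ^ p * (1 + A)) ^ (1 / p) := by gcongr
    _ = ENNReal.ofReal ((1 + A) ^ (1 / p) * a) := by
        rw [ENNReal.ofReal_rpow_of_nonneg (by positivity) (by positivity),
          Real.mul_rpow (by positivity) (by positivity), ← Real.rpow_mul ha.le,
          mul_one_div_cancel hp0.ne', Real.rpow_one, mul_comm]
    _ ≤ ENNReal.ofReal ((1 + A) * a) := by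
        refine ENNReal.ofReal_le_ofReal (mul_le_mul_of_nonneg_right ?_ ha.le)
        exact Real.rpow_le_self_of_one_le (by linarith) ((div_le_one hp0).2 hp)
    _ = _ := ENNReal.ofReal_mul (by positivity)

lemma IsRegularization.exists_bound {g : ℝ → ℝ → ℝ} (hg : IsRegularization g) :
    ∃ B : ℝ, 0 < B ∧ ∀ l, 0 < l → l ≤ 1 → ∀ t, 0 < t → t ≤ 1 → |g l t| * (t + l) ≤ B := by
  obtain ⟨D, hD⟩ := hg.bound_mul
  obtain ⟨E, hE⟩ := hg.bound
  have hD1 := (abs_nonneg _).trans (hD 1 one_pos le_rfl 1 one_pos le_rfl)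
  have hE1 := (abs_nonneg _).trans (hE 1 one_pos le_rfl 1 one_pos le_rfl)
  refine ⟨D + E + 1, by rw [div_one] at hE1; linarith, fun l hl hl1 t ht ht1 => ?_⟩
  have h1 := hD l hl hl1 t ht ht1
  have h2 := hE l hl hl1 t ht ht1
  rw [le_div_iff₀ hl] at h2
  rw [abs_mul, abs_of_pos ht] at h1
  linarith

/-- An identity of exponents: with `d = 2 b r + b + 1`, one has `1 + (b / d) (2 s - 1 - 1 / b) = 2 b
(r + s) / d`. -/
lemma rate_sq {b r s σ R : ℝ} (hb : 1 < b) (hr : 0 < r) (hσ : 0 < σ) (hR : 0 < R) {n : ℕ}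
    (hn : 0 < n) {l : ℝ} (hl : l = (σ ^ 2 / (R ^ 2 * n)) ^ (b / (2 * b * r + b + 1))) :
    σ ^ 2 / n * (l ^ (2 * s - 1) * l ^ (-(1 / b))) = rate b r s σ R n ^ 2 := by
  have hn0 : (0 : ℝ) < n := by exact_mod_cast hn
  have hb0 : 0 < b := by linarith
  have hd : 0 < 2 * b * r + b + 1 := by positivity
  set x : ℝ := σ ^ 2 / (R ^ 2 * n) with hx
  have hx0 : 0 < x := by positivity
  have h1 : σ ^ 2 / n = R ^ 2 * x ^ (1 : ℝ) := by rw [Real.rpow_one, hx]; field_simp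
  rw [rate, ← hx, mul_pow, ← Real.rpow_natCast (x ^ _), ← Real.rpow_mul hx0.le, hl,
    ← Real.rpow_mul hx0.le, ← Real.rpow_mul hx0.le, h1, mul_assoc, ← Real.rpow_add hx0,
    ← Real.rpow_add hx0]
  congr 2
  push_cast
  field_simp
  ring

/-- Since `N ≥ n ^ (1 - α)` and `λ_n` is of order `n ^ (-e)` with `e = b / (2 b r + b + 1)`, the
product `N λ_n` tends to infinity exactly because `1 - α - e > 0`. Any threshold `Λ`, in particular
one depending on `M / σ`, is eventually exceeded. -/
lemma eventually_block_size {α b r σ R : ℝ} (hb : 1 < b) (hr : 0 < r) (hσ : 0 < σ) (hR : 0 < R)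
    (hα : α < 2 * b * r / (2 * b * r + b + 1)) {m : ℕ → ℕ} {part : ∀ n, Fin n → Fin (m n)}
    (hm : IsAdmissible α m part) (Λ : ℝ) :
    ∀ᶠ n : ℕ in atTop, 0 < n ∧ 0 < m n ∧
      regParam b r σ R n = (σ ^ 2 / (R ^ 2 * n)) ^ (b / (2 * b * r + b + 1)) ∧
      ∃ N, 0 < N ∧ m n * N = n ∧ (∀ j, (block (part n) j).card = N) ∧
        Λ ≤ N * regParam b r σ R n := by
  have hb0 : 0 < b := by linarith
  have hd : 0 < 2 * b * r + b + 1 := by positivity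
  set e : ℝ := b / (2 * b * r + b + 1) with he
  have he0 : 0 < e := by positivity
  have hgap : 0 < 1 - α - e := by
    have : 2 * b * r / (2 * b * r + b + 1) + e + 1 / (2 * b * r + b + 1) = 1 := by
      rw [he]; field_simp
    have : 0 < 1 / (2 * b * r + b + 1) := by positivity
    linarith
  set y : ℝ := σ ^ 2 / R ^ 2 with hy
  have hy0 : 0 < y := by positivity
  have hT : Tendsto (fun n : ℕ => y ^ e * (n : ℝ) ^ (1 - α - e)) atTop atTop :=
    ((tendsto_rpow_atTop hgap).comp tendsto_natCast_atTop_atTop).const_mul_atTop (by positivity)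
  filter_upwards [hm, hT.eventually_ge_atTop Λ, eventually_gt_atTop 0,
    tendsto_natCast_atTop_atTop.eventually_ge_atTop y] with n h1 h2 h3 h4
  have hn0 : (0 : ℝ) < n := by exact_mod_cast h3
  have hmn : 0 < m n := (part n ⟨0, h3⟩).pos
  have hN := h1.2 ⟨0, hmn⟩
  have hx : σ ^ 2 / (R ^ 2 * n) = y / n := by rw [hy, div_div]
  have hreg : regParam b r σ R n = (σ ^ 2 / (R ^ 2 * n)) ^ e := by
    rw [regParam, min_eq_left]
    rw [hx]
    exact Real.rpow_le_one (by positivity) ((div_le_one hn0).2 h4) he0.le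
  refine ⟨h3, hmn, hreg, _, Nat.pos_of_ne_zero fun h0 => ?_, hN,
    fun j => Nat.eq_of_mul_eq_mul_left hmn ((h1.2 j).trans hN.symm), h2.trans ?_⟩
  · rw [h0] at hN; omega
  set N := (block (part n) ⟨0, hmn⟩).card
  have hNn : (m n : ℝ) * N = n := by exact_mod_cast hN
  have hNle : (n : ℝ) ^ (1 - α) ≤ N := by
    rw [Real.rpow_sub hn0, Real.rpow_one, div_le_iff₀ (by positivity)]
    calc (n : ℝ) = N * m n := by rw [← hNn, mul_comm]
      _ ≤ _ := mul_le_mul_of_nonneg_left h1.1 (Nat.cast_nonneg _)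
  rw [hreg, hx, Real.div_rpow hy0.le hn0.le, Real.rpow_sub hn0 (1 - α) e]
  calc y ^ e * ((n : ℝ) ^ (1 - α) / (n : ℝ) ^ e) ≤ y ^ e * (N / (n : ℝ) ^ e) := by gcongr
    _ = _ := by ring

variable {X : Type*} [MeasurableSpace X]
    {H : Type*} [NormedAddCommGroup H] [InnerProductSpace ℝ H] [CompleteSpace H]
    [TopologicalSpace.SeparableSpace H] [RKHS ℝ H X ℝ]

lemma normalizedRisk_le (hmeas : ∀ f : H, Measurable (fun x : X => f x)) {κ : ℝ} (hκ : 0 < κ)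
    (hbdd : ∀ (f : H) (x : X), |f x| ≤ κ * ‖f‖) {b β r s p B c : ℝ} (hb : 1 < b) (hβ : 0 < β)
    (hr : 0 < r) (hs : s ∈ Icc (0 : ℝ) (1 / 2)) (hp : 1 ≤ p) {K : ℕ} (hK : p ≤ 2 * K)
    (hc : 0 ≤ c) {g : ℝ → ℝ → ℝ} (hB : 0 < B)
    (hg : ∀ l, 0 < l → l ≤ 1 → ∀ t, 0 < t → t ≤ 1 → |g l t| * (t + l) ≤ B)
    {σ M R : ℝ} (hσ : 0 < σ) (hR : 0 < R) {n m N : ℕ} {part : Fin n → Fin m}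
    (hn : 0 < n) (hm : 0 < m) (hreg : regParam b r σ R n =
      (σ ^ 2 / (R ^ 2 * n)) ^ (b / (2 * b * r + b + 1))) (hN : 0 < N) (hmN : m * N = n)
    (hpart : ∀ j, (block part j).card = N)
    (hsize : max 1 (M ^ 2 / σ ^ 2) ≤ N * regParam b r σ R n)
    {ν : Measure X} {η : Kernel X ℝ} {f : H} (hmod : IsModel κ b β r σ R ν η f)
    (hmom : ∀ᵐ x ∂ν, ∀ k, k + 1 ≤ K →
      ∫⁻ y, ‖y - f x‖ₑ ^ (2 * (k + 1)) ∂(η x) ≤ ENNReal.ofReal (c * σ ^ 2 * (M ^ 2) ^ k)) :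
    normalizedRisk κ g b r s p σ R part ν η f ≤ ENNReal.ofReal (1 + errorConst κ b β B c K) := by
  have := hmod.prob
  have := hmod.markov
  have hn0 : (0 : ℝ) < n := by exact_mod_cast hn
  have hl : 0 < regParam b r σ R n := by rw [hreg]; positivity
  have hl1 : regParam b r σ R n ≤ 1 := min_le_right _ _
  have hK1 : 1 ≤ K := by
    refine Nat.one_le_iff_ne_zero.2 fun h => ?_
    rw [h, Nat.cast_zero] at hK
    linarith
  have hM : M ^ 2 ≤ σ ^ 2 * (N * regParam b r σ R n) := by
    have := (le_max_right _ _).trans hsize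
    rwa [div_le_iff₀' (by positivity)] at this
  refine lintegral_rpow_div_le (K := K) _ hp hK ?_ (errorConst_nonneg hb hβ hc K) ?_
  · rw [rate]; positivity
  · rw [← rate_sq hb hr hσ hR hn hreg]
    exact error_moment_le hmeas hκ hbdd hb hβ hl hl1 hB (hg _ hl hl1) hm hN hmN part hpart hs hK1 hc
      hσ ((le_max_left _ _).trans hsize) hM hmod hmom

-- Replacing all factorials by `(2 K)!` gives one constant for all even moments up to order `2 K`,
-- independent of `σ` and `M`.
omit [TopologicalSpace.SeparableSpace H] in
lemma IsBernsteinModel.even_moment_le {κ b β r σ M R : ℝ} {ν : Measure X} {η : Kernel X ℝ} {f : H}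
    (h : IsBernsteinModel κ b β r σ M R ν η f) (K : ℕ) :
    ∀ᵐ x ∂ν, ∀ k, k + 1 ≤ K → ∫⁻ y, ‖y - f x‖ₑ ^ (2 * (k + 1)) ∂(η x) ≤
      ENNReal.ofReal ((2 * K).factorial * σ ^ 2 * (M ^ 2) ^ k) := by
  filter_upwards [h.bernstein] with x hx k hk
  refine (hx (2 * (k + 1)) (by omega)).trans (ENNReal.ofReal_le_ofReal ?_)
  rw [show 2 * (k + 1) - 2 = 2 * k by omega, pow_mul]
  have h1 : ((2 * (k + 1)).factorial : ℝ) ≤ (2 * K).factorial := by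
    exact_mod_cast Nat.factorial_le (by omega)
  have h2 : 1 / 2 * ((2 * (k + 1)).factorial : ℝ) ≤ (2 * K).factorial := by
    have : (0 : ℝ) ≤ (2 * (k + 1)).factorial := by positivity
    linarith
  gcongr

end Theorem

end DistLearn

theorem theorem3p2 {X : Type*} [MeasurableSpace X] [StandardBorelSpace X]
    {H : Type*} [NormedAddCommGroup H] [InnerProductSpace ℝ H] [CompleteSpace H]
    [TopologicalSpace.SeparableSpace H] [RKHS ℝ H X ℝ]
    (hmeas : ∀ f : H, Measurable (fun x : X => f x))
    (κ : ℝ) (hκ : 0 < κ) (hbdd : ∀ (f : H) (x : X), |f x| ≤ κ * ‖f‖)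
    (b β r s p q : ℝ) (hb : 1 < b) (hβ : 0 < β) (hr : 0 < r) (hs : s ∈ Set.Icc (0 : ℝ) (1 / 2))
    (hp : 1 ≤ p)
    (g : ℝ → ℝ → ℝ) (hg : DistLearn.IsRegularization g)
    (hq : DistLearn.HasQualification g q) (hqrs : r + s ≤ q) :
    (∃ C : ℝ≥0, ∀ α : ℝ, α < 2 * b * r / (2 * b * r + b + 1) →
      ∀ (m : ℕ → ℕ) (part : ∀ n, Fin n → Fin (m n)), DistLearn.IsAdmissible α m part →
        (⨆ (σ : ℝ) (_ : 0 < σ) (M : ℝ) (_ : 0 < M) (R : ℝ) (_ : 0 < R),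
          limsup (fun n : ℕ =>
            ⨆ (ν : Measure X) (η : Kernel X ℝ) (f : H)
              (_ : DistLearn.IsBernsteinModel κ b β r σ M R ν η f),
              DistLearn.normalizedRisk κ g b r s p σ R (part n) ν η f) atTop) ≤ (C : ℝ≥0∞)) ∧
    (p ≤ 2 → ∃ C : ℝ≥0, ∀ α : ℝ, α < 2 * b * r / (2 * b * r + b + 1) →
      ∀ (m : ℕ → ℕ) (part : ∀ n, Fin n → Fin (m n)), DistLearn.IsAdmissible α m part →
        (⨆ (σ : ℝ) (_ : 0 < σ) (R : ℝ) (_ : 0 < R),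
          limsup (fun n : ℕ =>
            ⨆ (ν : Measure X) (η : Kernel X ℝ) (f : H)
              (_ : DistLearn.IsModel κ b β r σ R ν η f),
              DistLearn.normalizedRisk κ g b r s p σ R (part n) ν η f) atTop) ≤ (C : ℝ≥0∞)) := by
  have hp0 : 0 < p := by linarith
  obtain ⟨B, hB, hgB⟩ := hg.exists_bound
  refine ⟨?_, fun hp2 => ?_⟩
  -- The least `K` with `p ≤ 2 K`.
  · set K : ℕ := ⌈p / 2⌉₊ with hK
    have hpK : p ≤ 2 * K := by
      have := Nat.le_ceil (p / 2)
      rw [← hK] at this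
      linarith
    refine ⟨Real.toNNReal (1 + DistLearn.errorConst κ b β B (2 * K).factorial K),
      fun α hα m part hm => ?_⟩
    refine iSup_le fun σ => iSup_le fun hσ => iSup_le fun M => iSup_le fun _ => iSup_le fun R =>
      iSup_le fun hR => limsup_le_of_le (by isBoundedDefault) ?_
    filter_upwards [DistLearn.eventually_block_size hb hr hσ hR hα hm (max 1 (M ^ 2 / σ ^ 2))]
      with n ⟨hn, hmn, hreg, N, hN, hmN, hpart, hsize⟩
    exact iSup_le fun ν => iSup_le fun η => iSup_le fun f => iSup_le fun hmod =>
      DistLearn.normalizedRisk_le hmeas hκ hbdd hb hβ hr hs hp hpK (Nat.cast_nonneg _) hB hgB hσ hR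
        hn hmn hreg hN hmN hpart hsize hmod.toIsModel (hmod.even_moment_le K)
  · refine ⟨Real.toNNReal (1 + DistLearn.errorConst κ b β B 1 1), fun α hα m part hm => ?_⟩
    refine iSup_le fun σ => iSup_le fun hσ => iSup_le fun R => iSup_le fun hR =>
      limsup_le_of_le (by isBoundedDefault) ?_
    -- For `p ≤ 2` take `K = 1`, so that the second moment is the only one needed. Then `M` occurs
    -- only to the power `0` in the moment condition, and `σ` may be put in its place.
    filter_upwards [DistLearn.eventually_block_size hb hr hσ hR hα hm (max 1 (σ ^ 2 / σ ^ 2))]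
      with n ⟨hn, hmn, hreg, N, hN, hmN, hpart, hsize⟩
    refine iSup_le fun ν => iSup_le fun η => iSup_le fun f => iSup_le fun hmod =>
      DistLearn.normalizedRisk_le hmeas hκ hbdd hb hβ hr hs hp (by simpa using hp2) zero_le_one hB
        hgB hσ hR hn hmn hreg hN hmN hpart hsize hmod ?_
    filter_upwards [hmod.variance] with x hx k hk
    obtain rfl : k = 0 := by omega
    simpa using hx
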